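/- Let $F=\mathbb{Z}^n$ and let $S(n,r)=\operatorname{End}_{\mathbb{Z}\mathfrak{S}_r}(F^{\otimes r})$ be the integral Schur algebra, whose modules are the homogeneous polynomial representations of $GL_n(\mathbb{Z})$ of degree $r$. Write $D_i=D_iF$ and $\Lambda^i=\Lambda^iF$ for the divided and exterior powers of $F$, and $\Delta(h)$ for the Weyl module of the hook partition $h=(a,1^b)$, that is, the image of the canonical map $D_a\otimes D_1^{\otimes b}\to F^{\otimes(a+b)}\to\Lambda^{b+1}\otimes(\Lambda^1)^{\otimes(a-1)}$ given by comultiplication in the divided power algebra along the row of $h$ and multiplication in the exterior algebra along the columns of $h$. Let $a\ge 1$, $n\ge b+1$ and $0\le k<b$. Then there is an isomorphism of abelian groups $$\operatorname{Ext}^2_{S(n,a+b)}\bigl(\Delta(h),\,D_{a+k}\otimes\Lambda^{b-k}\bigr)\;\cong\;\operatorname{Ext}^2_{S(n,k+1)}\bigl(\Lambda^{k+1},\,D_{k+1}\bigr),$$ and $$\operatorname{Ext}^2_{S(n,a+b)}\bigl(\Delta(h),\,D_{a+k}\otimes\Lambda^{b-k}\bigr)\;\cong\;\begin{cases}\mathbb{Z}/3\mathbb{Z},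 & k=2,3,\\ 0, & k\ne 2,3.\end{cases}$$ -/

import Mathlib

open scoped TensorProduct

noncomputable section

namespace HookExt

/-- The natural module `F`, free of rank `n` over the integers. -/
abbrev NatMod (n : ℕ) : Type := Fin n → ℤ

/-- Tensor space `F ⊗ ⋯ ⊗ F` (`r` factors). -/
abbrev TensorSpace (n r : ℕ) : Type := ⨂[ℤ]^r (NatMod n)

/-- The place permutation of tensor space given by `σ`. -/
def placePerm (n : ℕ) {r : ℕ} (σ : Equiv.Perm (Fin r)) : Module.End ℤ (TensorSpace n r) :=
  (PiTensorProduct.reindex ℤ (fun _ : Fin r => NatMod n) σ).toLinearMap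

/-- The integral Schur algebra `S(n,r)`: the algebra of all endomorphisms of tensor space that
commute with all place permutations. Homogeneous polynomial representations of `GL_n` of degree
`r` over the integers are the same as modules over it. -/
def schurAlgebra (n r : ℕ) : Subalgebra ℤ (Module.End ℤ (TensorSpace n r)) :=
  Subalgebra.centralizer ℤ (Set.range (placePerm n (r := r)))

/-- The tensors that are symmetric in the places from `A`, as an `S(n,r)`-submodule of tensor
space. Since `F` is free, the divided power `D_p F` is the module of symmetric tensors in
`F^{⊗p}`, so this is `D_p F ⊗ F^{⊗(r-p)}`, with `p` the size of `A` and with the places of the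
factor `D_p F` being those in `A`. -/
def symTensors (n r : ℕ) (A : Set (Fin r)) : Submodule (schurAlgebra n r) (TensorSpace n r) where
  carrier := {x | ∀ σ : Equiv.Perm (Fin r), (∀ i, i ∉ A → σ i = i) → placePerm n σ x = x}
  add_mem' := by
    intro x y hx hy σ hσ
    rw [map_add, hx σ hσ, hy σ hσ]
  zero_mem' := fun σ _ => map_zero _
  smul_mem' := by
    intro c x hx σ hσ
    have h := (Subalgebra.mem_centralizer_iff ℤ).1 c.2 (placePerm n σ) ⟨σ, rfl⟩
    have h2 := LinearMap.congr_fun h x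
    change placePerm n σ (c.1 x) = c.1 x
    rw [← Module.End.mul_apply, h2, Module.End.mul_apply, hx σ hσ]

/-- The `S(n,r)`-submodule of tensor space generated by the decomposable tensors with equal
entries in two different places from `B`. The quotient of tensor space by it is
`Λ^q F ⊗ F^{⊗(r-q)}`, with `q` the size of `B` and with the places of the factor `Λ^q F` being
those in `B`. -/
def altRelations (n r : ℕ) (B : Set (Fin r)) :
    Submodule (schurAlgebra n r) (TensorSpace n r) :=
  Submodule.span (schurAlgebra n r)
    {x | ∃ v : Fin r → NatMod n, (∃ i ∈ B, ∃ j ∈ B, i ≠ j ∧ v i = v j) ∧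
      x = PiTensorProduct.tprod ℤ v}

/-- The image of the composite `D_A ⊗ F^{⊗(r-p)} → F^{⊗r} → Λ_B ⊗ F^{⊗(r-q)}` of the inclusion of
the tensors symmetric in the places from `A` (comultiplication of the divided power algebra) and
the projection that is alternating in the places from `B` (multiplication of the exterior
algebra). -/
def symAltImage (n r : ℕ) (A B : Set (Fin r)) :
    Submodule (schurAlgebra n r) (TensorSpace n r ⧸ altRelations n r B) :=
  (symTensors n r A).map (altRelations n r B).mkQ

/-- The `S(n,r)`-module `D_p ⊗ Λ^{r-p}` (for `p ≤ r`): the image of `D_p ⊗ F^{⊗(r-p)}` in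
`F^{⊗p} ⊗ Λ^{r-p}`. -/
def divTensorExt (n r p : ℕ) : ModuleCat.{0} (schurAlgebra n r) :=
  ModuleCat.of (schurAlgebra n r)
    (symAltImage n r {i | (i : ℕ) < p} {i | p ≤ (i : ℕ)})

/-- The divided power `D_r` of the natural module, as an `S(n,r)`-module. -/
def divPower (n r : ℕ) : ModuleCat.{0} (schurAlgebra n r) :=
  ModuleCat.of (schurAlgebra n r) (symTensors n r Set.univ)

/-- The exterior power `Λ^r` of the natural module, as an `S(n,r)`-module. -/
def extPower (n r : ℕ) : ModuleCat.{0} (schurAlgebra n r) :=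
  ModuleCat.of (schurAlgebra n r) (TensorSpace n r ⧸ altRelations n r Set.univ)

/-- The Weyl module `Δ(h)` of the hook `h = (a, 1^b)`, `a ≥ 1`. The places of tensor space are the
boxes of `h`: the first row consists of the places `0, …, a - 1`, the remaining boxes of the first
column are the places `a, …, a + b - 1`. The Weyl module is the image of the canonical map from
the tensor product of the divided powers of the rows to the tensor product of the exterior powers
of the columns, `D_a ⊗ D_1^{⊗b} → F^{⊗(a+b)} → Λ^{b+1} ⊗ (Λ^1)^{⊗(a-1)}`. -/
def hookWeyl (n a b : ℕ) : ModuleCat.{0} (schurAlgebra n (a + b)) :=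
  ModuleCat.of (schurAlgebra n (a + b))
    (symAltImage n (a + b) {i | (i : ℕ) < a} {i | (i : ℕ) = 0 ∨ a ≤ (i : ℕ)})

end HookExt

end

/-!
Both extension groups are computed from one explicit projective resolution.

*Resolution.* For a set `I` of places, a subset `B` of `I` (the bars) cuts the row of `r` places
into blocks, and the tensors symmetric in each block form a tensor product of divided powers. Adding
up the inclusions between these modules, with signs, gives a complex of `S(n,r)`-modules
`resPart n r I q`. It is exact in positive degrees (`resPart_exact`): order the words lexicographically; the
leading coefficients of a cycle form a cycle of a simplex, and contracting that simplex gives a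
boundary with the same leading coefficients, so that the leading word can be lowered by subtracting
a boundary. In degree zero the same step applies to the alternating relations in the first column of
the hook, since by the antisymmetrizer the leading word of such a relation has a weak descent at one
of the places in `I`; hence these relations are boundaries (`exists_bdry_of_mem_altRelations`). So
the complex with `I = {a, …, r - 1}` resolves `Δ(a, 1^b)`; for `a = 1` this is `Λ^{b+1}`. The module
of tensors symmetric in given blocks is generated by one weight vector as soon as there are as many
letters as blocks, and it is then isomorphic to the left ideal of an idempotent, hence projective
(`projective_resPart`); this is where `n ≥ b + 1` enters.

*The complex of homomorphisms.* Homomorphisms from such a module to `M` are vectors of a given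
weight in `M`, and the differential becomes a coboundary operator on families of weight vectors
(`famHom_comp_resD`). For `M = D_p ⊗ Λ^q` the weight spaces have bases indexed by lists of letters
`x^{(u)} y^ε`, one for each block, and the complex is the part of bidegree `(p, q)` of the bar
construction of the algebra `Γ[x] ⊗ Λ[y]`, with the first letter of degree at least `a`
(`coboundary_listHom`, `exists_listHom_eq`, `listHom_injOn`). Dimension shifting
(`exists_extTwo_hom`) turns this into a description of `Ext²` (`exists_bar_addEquiv_ext`).

*Stripping exterior letters.* Splitting the first letter `x^{(u)} y` of a list into `x^{(u)}` and
`y`, and moving that `y` to the right, is a contracting homotopy on the lists that do not start with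
the letter `x^{(a-1)} y`. The quotient is spanned by the lists that do start with it, and deleting
this letter lowers the number of exterior letters by one (`bar_strip`, `bar_strip_all`). At the end
only the algebra `Γ[x]` in degree `k + 1` is left, with no restriction on the first letter, and this
is also the complex for `Ext²(Λ^{k+1}, D_{k+1})`.

*Divided powers in one variable.* Multiplying each list in the bar construction of `Γ[x]` by the
product of the factorials of its exponents turns the binomial coefficients of the differential into
signs, so over the rationals the complex is that of a simplex with `K - 1` vertices, `K = k + 1`. A
cycle in the degree of `Ext²` is therefore the coboundary of a potential `G` on the vertices
`1, …, K - 1`, and integrality of the cycle says that `6 (G i - G (i + 1))` is integral for neighbours and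
`4 (G i - G j)` is integral otherwise, whereas the cycle is a boundary exactly when all
`2 (G i - G j)` are integral. Since `1/4 ℤ ∩ 1/6 ℤ = 1/2 ℤ`, the latter is automatic if
`i` and `j` are not neighbours. For `K ≥ 5` any two vertices are joined by a path of non-neighbours and for `K ≤ 2`
there is at most one vertex (`bar_divided_subsingleton`), while for `K = 3, 4` the class of
`6 (G 1 - G 2)` modulo `3` is the only obstruction and it takes the value `1` (`bar_divided_zmod`).
-/

open scoped TensorProduct

noncomputable section

namespace HookExt

/-! ### The bar complex of `Γ[x] ⊗ Λ[y]` -/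

/-- A letter `(u, ε)` stands for the basis element `x^{(u)} y^ε` of the algebra `Γ[x] ⊗ Λ[y]`
in one divided power variable `x` and one exterior variable `y`. Letters `(0, false)`, the unit
of the algebra, are excluded by `barIndex` below. -/
abbrev Letter : Type := ℕ × Bool

/-- The degree of the letter `x^{(u)} y^ε`. -/
def Letter.deg (w : Letter) : ℕ := w.1 + w.2.toNat

/-- The free abelian group on lists of letters: the bar construction of `Γ[x] ⊗ Λ[y]`. -/
abbrev BarMod : Type := List Letter →₀ ℤ

/-- Prepend a letter. -/
def consHom (w : Letter) : BarMod →ₗ[ℤ] BarMod := Finsupp.lmapDomain ℤ ℤ (List.cons w)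

/-- Multiply the first letter of a list by `w` from the left. The empty list gives `0`: the
ground ring is the trivial module. -/
def mulList : Letter → List Letter → BarMod
  | _, [] => 0
  | w, w' :: L => if w.2 && w'.2 then 0 else
      Finsupp.single ((w.1 + w'.1, w.2 || w'.2) :: L) ((w.1 + w'.1).choose w.1 : ℤ)

/-- The linear extension of `mulList w`. -/
def mulHom (w : Letter) : BarMod →ₗ[ℤ] BarMod := Finsupp.linearCombination ℤ (mulList w)

/-- The bar differential of a single list: the alternating sum of all products of two adjacent
letters. -/
def barList : List Letter → BarMod
  | [] => 0
  | w :: L => mulList w L - consHom w (barList L)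

/-- The bar differential. -/
def barD : BarMod →ₗ[ℤ] BarMod := Finsupp.linearCombination ℤ barList

@[simp] lemma consHom_single (w : Letter) (L : List Letter) (c : ℤ) :
    consHom w (Finsupp.single L c) = Finsupp.single (w :: L) c := by
  simp [consHom]

lemma mulHom_single (w : Letter) (L : List Letter) :
    mulHom w (Finsupp.single L 1) = mulList w L := by
  simp [mulHom]

lemma barD_single (L : List Letter) : barD (Finsupp.single L 1) = barList L := by
  simp [barD]

lemma barD_consHom (w : Letter) (x : BarMod) :
    barD (consHom w x) = mulHom w x - consHom w (barD x) := by
  induction x using Finsupp.induction_linear with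
  | zero => simp
  | add f g hf hg => simp only [map_add, hf, hg]; abel
  | single L c =>
    rw [consHom_single, ← mul_one c, ← smul_eq_mul, ← Finsupp.smul_single, ← Finsupp.smul_single,
      map_smul, map_smul, map_smul, map_smul, barD_single, barD_single, mulHom_single, barList,
      smul_sub]

lemma mulHom_consHom (w w' : Letter) (x : BarMod) :
    mulHom w (consHom w' x) = if w.2 && w'.2 then 0 else
      ((w.1 + w'.1).choose w.1 : ℤ) • consHom (w.1 + w'.1, w.2 || w'.2) x := by
  induction x using Finsupp.induction_linear with
  | zero => simp
  | add f g hf hg =>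
    simp only [map_add, hf, hg]
    split_ifs <;> simp
  | single L c =>
    rw [consHom_single, consHom_single, ← mul_one c, ← smul_eq_mul, ← Finsupp.smul_single,
      map_smul, mulHom_single, mulList]
    split_ifs <;> simp [mul_comm]

lemma choose_assoc (a b c : ℕ) :
    (b + c).choose b * (a + (b + c)).choose a = (a + b).choose a * (a + b + c).choose (a + b) := by
  have h := Nat.choose_mul (n := a + b + c) (k := a + b) (s := a) (by omega)
  rw [show a + b + c - a = b + c by omega, show a + b - a = b by omega] at h
  rw [← add_assoc, mul_comm, ← h, mul_comm]

lemma barD_mulList (w : Letter) (L : List Letter) :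
    barD (mulList w L) = mulHom w (barList L) := by
  rcases L with _ | ⟨w1, L⟩
  · simp [mulList, barList]
  · rw [barList, map_sub, mulHom_consHom, mulList]
    rcases w with ⟨u, ε⟩
    rcases w1 with ⟨u1, ε1⟩
    have key : mulHom (u, ε) (mulList (u1, ε1) L) = if ε && ε1 then 0 else
        ((u + u1).choose u : ℤ) • mulList (u + u1, ε || ε1) L := by
      rcases L with _ | ⟨⟨u2, ε2⟩, L⟩
      · simp [mulList]
      · simp only [mulList]
        have := choose_assoc u u1 u2
        by_cases h1 : (ε1 && ε2) = true
        · simp only [h1, if_true, map_zero]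
          cases ε <;> cases ε1 <;> cases ε2 <;> simp_all
        · simp only [h1, if_false, Bool.false_eq_true]
          rw [← mul_one (((u1 + u2).choose u1 : ℕ) : ℤ), ← smul_eq_mul, ← Finsupp.smul_single,
            map_smul, mulHom_single, mulList]
          have hc : (((u1 + u2).choose u1 : ℕ) : ℤ) * ((u + (u1 + u2)).choose u : ℕ) =
            ((u + u1).choose u : ℕ) * ((u + u1 + u2).choose (u + u1) : ℕ) := by exact_mod_cast this
          cases ε <;> cases ε1 <;> cases ε2 <;> simp_all [add_assoc]
    rw [key]
    by_cases h : (ε && ε1) = true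
    · simp [h]
    · simp only [h]
      rw [← mul_one (((u + u1).choose u : ℕ) : ℤ), ← smul_eq_mul, ← Finsupp.smul_single]
      simp only [Bool.false_eq_true, if_false, smul_eq_mul, mul_one, map_smul]
      rw [barD_single, barList, smul_sub]

lemma barD_barList (L : List Letter) : barD (barList L) = 0 := by
  induction L with
  | nil => simp [barList]
  | cons w L ih => rw [barList, map_sub, barD_consHom, ih, barD_mulList]; simp

lemma barD_barD (x : BarMod) : barD (barD x) = 0 := by
  induction x using Finsupp.induction_linear with
  | zero => simp
  | add f g hf hg => simp [hf, hg]
  | single L c =>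
    rw [← mul_one c, ← smul_eq_mul, ← Finsupp.smul_single, map_smul, map_smul, barD_single,
      barD_barList, smul_zero]

/-- Insert a letter `y` into a list, summed with signs over the positions up to the first letter
divisible by `y`. -/
def insertY : List Letter → BarMod
  | [] => Finsupp.single [(0, true)] 1
  | (u, false) :: L =>
    Finsupp.single ((0, true) :: (u, false) :: L) 1 - consHom (u, false) (insertY L)
  | (u, true) :: L => Finsupp.single ((0, true) :: (u, true) :: L) 1

/-- The contracting homotopy: split the first letter `x^{(u)} y` divisible by `y` into `x^{(u)}`
and `y`, and move the latter `y` to the right. -/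
def splitList : List Letter → BarMod
  | [] => 0
  | (u, false) :: L => - consHom (u, false) (splitList L)
  | (u, true) :: L => if u = 0 then 0 else consHom (u, false) (insertY L)

/-- The linear extension of `insertY`. -/
def insertYHom : BarMod →ₗ[ℤ] BarMod := Finsupp.linearCombination ℤ insertY

/-- The linear extension of `splitList`. -/
def splitHom : BarMod →ₗ[ℤ] BarMod := Finsupp.linearCombination ℤ splitList

lemma insertYHom_single (L : List Letter) (c : ℤ) :
    insertYHom (Finsupp.single L c) = c • insertY L := by
  simp [insertYHom]

lemma splitHom_single (L : List Letter) (c : ℤ) :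
    splitHom (Finsupp.single L c) = c • splitList L := by
  simp [splitHom]

lemma insertYHom_consHom_false (u : ℕ) (x : BarMod) :
    insertYHom (consHom (u, false) x) =
      consHom (0, true) (consHom (u, false) x) - consHom (u, false) (insertYHom x) := by
  induction x using Finsupp.induction_linear with
  | zero => simp
  | add f g hf hg => simp only [map_add, hf, hg]; abel
  | single L c => simp [insertYHom_single, insertY, smul_sub]

lemma insertYHom_consHom_true (u : ℕ) (x : BarMod) :
    insertYHom (consHom (u, true) x) = consHom (0, true) (consHom (u, true) x) := by
  induction x using Finsupp.induction_linear with
  | zero => simp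
  | add f g hf hg => simp only [map_add, hf, hg]
  | single L c => simp [insertYHom_single, insertY]

lemma splitHom_consHom_false (u : ℕ) (x : BarMod) :
    splitHom (consHom (u, false) x) = - consHom (u, false) (splitHom x) := by
  induction x using Finsupp.induction_linear with
  | zero => simp
  | add f g hf hg => simp only [map_add, hf, hg]; abel
  | single L c => simp [splitHom_single, splitList]

lemma splitHom_consHom_true (u : ℕ) (x : BarMod) :
    splitHom (consHom (u, true) x) = if u = 0 then 0 else consHom (u, false) (insertYHom x) := by
  induction x using Finsupp.induction_linear with
  | zero => simp
  | add f g hf hg => simp only [map_add, hf, hg]; split_ifs <;> simp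
  | single L c =>
    simp only [consHom_single, splitHom_single, splitList, insertYHom_single]
    split_ifs <;> simp

lemma single_eq_consHom (w : Letter) (L : List Letter) :
    (Finsupp.single (w :: L) 1 : BarMod) = consHom w (Finsupp.single L 1) := by simp

/-- Inserting `y` anticommutes with the bar differential. -/
lemma barD_insertY (L : List Letter) : barD (insertY L) = - insertYHom (barList L) := by
  induction L with
  | nil =>
    rw [insertY, barD_single]
    simp [barList, mulList]
  | cons w L ih =>
    rcases w with ⟨u, ε⟩
    cases ε
    · rw [insertY, single_eq_consHom, map_sub, barD_consHom, barD_single, barD_consHom, ih,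
        mulHom_single, barList, map_sub insertYHom, insertYHom_consHom_false, map_sub]
      rcases L with _ | ⟨⟨u', ε'⟩, L⟩
      · rw [insertY, single_eq_consHom (0, true), mulHom_consHom]
        simp [mulList, barList]
      · cases ε'
        · rw [insertY, single_eq_consHom (0, true)]
          simp only [mulList, map_sub, mulHom_consHom]
          simp [insertYHom_single, insertY, smul_sub]
          abel
        · rw [insertY, single_eq_consHom (0, true)]
          simp only [mulList, mulHom_consHom]
          simp [insertYHom_single, insertY]
          try abel
    · rw [insertY, single_eq_consHom, barD_consHom, mulHom_single, barD_single, barList,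
        map_sub insertYHom, insertYHom_consHom_true, mulList]
      have : insertYHom (mulList (u, true) L) = consHom (0, true) (mulList (u, true) L) := by
        rcases L with _ | ⟨⟨u', ε'⟩, L⟩
        · simp [mulList]
        · cases ε' <;> simp [mulList, insertYHom_single, insertY]
      rw [this]
      simp

/-- The homotopy formula: `splitHom` contracts the lists that contain `y` and do not start with
the letter `y` itself. -/
lemma barD_splitList (L : List Letter) (hL : ∃ w ∈ L, w.2 = true) (h1 : ∀ w ∈ L, w ≠ (0, false))
    (h2 : ∀ w ∈ L.head?, w ≠ (0, true)) :
    barD (splitList L) + splitHom (barList L) = Finsupp.single L 1 := by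
  induction L with
  | nil => simp at hL
  | cons w L ih =>
    rcases w with ⟨u, ε⟩
    cases ε
    · have hu : u ≠ 0 := by
        rintro rfl; exact h1 (0, false) (by simp) rfl
      have hL' : ∃ w ∈ L, w.2 = true := by simpa using hL
      have h1' : ∀ w ∈ L, w ≠ (0, false) := fun w hw => h1 w (by simp [hw])
      rw [splitList, map_neg, barD_consHom, barList, map_sub, splitHom_consHom_false]
      rcases L with _ | ⟨⟨u', ε'⟩, L⟩
      · simp at hL'
      · by_cases hy : (u', ε') = ((0 : ℕ), true)
        · obtain ⟨rfl, rfl⟩ := Prod.mk.inj hy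
          have e1 : splitList ((0, true) :: L) = 0 := by simp [splitList]
          rw [e1, barList, map_sub, splitHom_consHom_true]
          have e2 : splitHom (mulList (u, false) ((0, true) :: L)) =
              consHom (u, false) (insertY L) := by
            simp [mulList, splitHom_single, splitList, hu]
          rw [e2]
          rcases L with _ | ⟨⟨u'', ε''⟩, L⟩
          · simp [mulList, insertY]
          · cases ε''
            · by_cases hu'' : u'' = 0
              · exact absurd (by simp [hu'']) (h1' (u'', false) (by simp) )
              simp [mulList, insertY, splitHom_single, splitList, hu'']
            · simp [mulList, insertY]
        · have hy' : ∀ w ∈ ((u', ε') :: L).head?, w ≠ (0, true) := by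
            intro w hw; simp at hw; rw [← hw]; exact hy
          have IH := ih hL' h1' hy'
          have key : splitHom (mulList (u, false) ((u', ε') :: L)) =
              mulHom (u, false) (splitList ((u', ε') :: L)) := by
            cases ε'
            · simp [mulList, splitHom_single, splitList, mulHom_consHom]
            · have hu' : u' ≠ 0 := by rintro rfl; exact hy rfl
              simp [mulList, splitHom_single, splitList, mulHom_consHom, hu, hu']
          rw [key, single_eq_consHom, ← IH, map_add]
          abel
    · have hu : u ≠ 0 := by
        rintro rfl; exact h2 (0, true) (by simp) rfl
      rw [splitList, if_neg hu, barD_consHom, barD_insertY, barList, map_sub,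
        splitHom_consHom_true, if_neg hu, map_neg]
      rcases L with _ | ⟨⟨u', ε'⟩, L⟩
      · rw [insertY, single_eq_consHom, mulHom_consHom]
        simp [mulList]
      · cases ε'
        · simp only [mulList, insertY, single_eq_consHom, mulHom_consHom, map_sub]
          simp [splitHom_single, splitList, hu]
        · simp only [mulList, insertY, single_eq_consHom, mulHom_consHom]
          simp

/-! ### Homology of the bar complex and stripping of exterior letters -/

/-- The subquotient `Z / (Z ∩ B)` of an abelian group. -/
abbrev SubQuot {V : Type*} [AddCommGroup V] (Z B : Submodule ℤ V) : Type _ :=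
  Z ⧸ B.submoduleOf Z

lemma subQuot_addEquiv {V V' : Type*} [AddCommGroup V] [AddCommGroup V'] {Z B : Submodule ℤ V}
    {Z' B' : Submodule ℤ V'} (f : V →ₗ[ℤ] V') (hZ : ∀ z ∈ Z, f z ∈ Z')
    (hB : ∀ z ∈ Z, f z ∈ B' ↔ z ∈ B) (hs : ∀ z' ∈ Z', ∃ z ∈ Z, f z - z' ∈ B') :
    Nonempty (SubQuot Z B ≃+ SubQuot Z' B') := by
  let g : Z →ₗ[ℤ] Z' := f.restrict hZ
  have hg : B.submoduleOf Z ≤ (B'.submoduleOf Z').comap g := by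
    intro z hz
    exact (hB z.1 z.2).2 hz
  let F := Submodule.mapQ (B.submoduleOf Z) (B'.submoduleOf Z') g hg
  refine ⟨(LinearEquiv.ofBijective F ⟨?_, ?_⟩).toAddEquiv⟩
  · rw [← LinearMap.ker_eq_bot, LinearMap.ker_eq_bot']
    intro m hm
    obtain ⟨z, rfl⟩ := Submodule.Quotient.mk_surjective _ m
    rw [Submodule.mapQ_apply, Submodule.Quotient.mk_eq_zero] at hm
    rw [Submodule.Quotient.mk_eq_zero]
    exact (hB z.1 z.2).1 hm
  · intro m
    obtain ⟨z', rfl⟩ := Submodule.Quotient.mk_surjective _ m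
    obtain ⟨z, hz, h⟩ := hs z'.1 z'.2
    refine ⟨Submodule.Quotient.mk ⟨z, hz⟩, ?_⟩
    rw [Submodule.mapQ_apply, Submodule.Quotient.eq]
    exact h

/-- The lists of letters `≠ 1` with `x`-degree `p`, `y`-degree `q` and `N - i` letters, the first
of which has degree at least `a`. -/
def barIndex (a p q N i : ℕ) : Set (List Letter) :=
  {L | L.length + i = N ∧ (L.map Prod.fst).sum = p ∧ L.countP (·.2) = q ∧
    (∀ w ∈ L, w ≠ (0, false)) ∧ ∀ w ∈ L.head?, a ≤ w.deg}

/-- The part of the bar construction spanned by `barIndex a p q N i`. -/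
def barPart (a p q N i : ℕ) : Submodule ℤ BarMod := Finsupp.supported ℤ ℤ (barIndex a p q N i)

/-- The cycles among the combinations of lists of `N - 2` letters. -/
def barCycles (a p q N : ℕ) : Submodule ℤ BarMod := barPart a p q N 2 ⊓ LinearMap.ker barD

/-- The boundaries of the combinations of lists of `N - 1` letters. -/
def barBoundaries (a p q N : ℕ) : Submodule ℤ BarMod := (barPart a p q N 1).map barD

lemma supported_le_comap {S S' : Set (List Letter)} (f : BarMod →ₗ[ℤ] BarMod)
    (h : ∀ L ∈ S, f (Finsupp.single L 1) ∈ Finsupp.supported ℤ ℤ S') {x : BarMod}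
    (hx : x ∈ Finsupp.supported ℤ ℤ S) : f x ∈ Finsupp.supported ℤ ℤ S' := by
  suffices Finsupp.supported ℤ ℤ S ≤ (Finsupp.supported ℤ ℤ S').comap f from this hx
  rw [Finsupp.supported_eq_span_single, Submodule.span_le]
  rintro _ ⟨L, hL, rfl⟩
  exact h L hL

lemma one_le_deg {w : Letter} (hw : w ≠ (0, false)) : 1 ≤ w.deg := by
  rcases w with ⟨u, ε⟩
  cases ε
  · have : u ≠ 0 := by rintro rfl; exact hw rfl
    simp [Letter.deg]; omega
  · simp [Letter.deg]

lemma cons_mem_barIndex {a p q N i : ℕ} {w : Letter} {L : List Letter} (hw : w ≠ (0, false))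
    (ha : a ≤ w.deg) (hL : L ∈ barIndex 1 p q N i) :
    w :: L ∈ barIndex a (w.1 + p) (w.2.toNat + q) (N + 1) i := by
  obtain ⟨h1, h2, h3, h4, h5⟩ := hL
  refine ⟨by simp; omega, by simp [h2], ?_, ?_, by simpa using ha⟩
  · rw [List.countP_cons, h3]; cases w.2 <;> simp [add_comm]
  · intro w' hw'
    rcases List.mem_cons.1 hw' with rfl | h
    · exact hw
    · exact h4 _ h

lemma of_cons_mem_barIndex {a p q N i : ℕ} {w : Letter} {L : List Letter}
    (h : w :: L ∈ barIndex a p q N i) : w ≠ (0, false) ∧ a ≤ w.deg ∧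
      ∃ p' q' N', p = w.1 + p' ∧ q = w.2.toNat + q' ∧ N = N' + 1 ∧ L ∈ barIndex 1 p' q' N' i := by
  obtain ⟨h1, h2, h3, h4, h5⟩ := h
  refine ⟨h4 w (by simp), h5 w (by simp), (L.map Prod.fst).sum, L.countP (·.2), L.length + i,
    by rw [← h2]; simp, ?_, by rw [← h1]; simp; omega, rfl, rfl, rfl,
    fun w hw => h4 w (by simp [hw]), ?_⟩
  · rw [← h3, List.countP_cons]; cases w.2 <;> simp [add_comm]
  · intro w' hw'
    exact one_le_deg (h4 w' (List.mem_cons_of_mem _ (List.mem_of_mem_head? hw')))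

lemma consHom_mem {a p q N i : ℕ} {w : Letter} (hw : w ≠ (0, false))
    (ha : a ≤ w.deg) {x : BarMod} (hx : x ∈ barPart 1 p q N i) :
    consHom w x ∈ barPart a (w.1 + p) (w.2.toNat + q) (N + 1) i := by
  refine supported_le_comap _ (fun L hL => ?_) hx
  rw [consHom_single]
  exact Finsupp.single_mem_supported ℤ _ (cons_mem_barIndex hw ha hL)

lemma mulList_mem {a p q N i : ℕ} {w : Letter} {L : List Letter}
    (h : w :: L ∈ barIndex a p q N i) : mulList w L ∈ barPart a p q N (i + 1) := by
  rcases L with _ | ⟨w', L⟩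
  · simp [mulList]
  · rw [mulList]
    split_ifs with hy
    · exact zero_mem _
    · obtain ⟨hw, ha, p1, q1, N1, rfl, rfl, rfl, h'⟩ := of_cons_mem_barIndex h
      obtain ⟨hw', -, p2, q2, N2, rfl, rfl, rfl, h''⟩ := of_cons_mem_barIndex h'
      refine Finsupp.single_mem_supported ℤ _ ?_
      have hq : w.2.toNat + w'.2.toNat = (w.2 || w'.2).toNat := by
        rcases w with ⟨u, _ | _⟩ <;> rcases w' with ⟨u', _ | _⟩ <;> simp_all
      have := cons_mem_barIndex (a := a) (w := (w.1 + w'.1, w.2 || w'.2)) (L := L) (p := p2)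
          (q := q2)
        (N := N2 + 1) (i := i + 1) ?_ ?_ ⟨?_, h''.2⟩
      · simpa [← hq, add_assoc] using this
      · rcases w with ⟨u, _ | _⟩ <;> rcases w' with ⟨u', _ | _⟩ <;> simp_all
      · simp only [Letter.deg] at ha ⊢
        rw [← hq]; omega
      · have := h''.1; omega

lemma barList_mem {a p q N i : ℕ} {L : List Letter}
    (h : L ∈ barIndex a p q N i) : barList L ∈ barPart a p q N (i + 1) := by
  induction L generalizing a p q N with
  | nil => simp [barList]
  | cons w L ih =>
    rw [barList]
    refine sub_mem (mulList_mem h) ?_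
    obtain ⟨hw, ha, p1, q1, N1, rfl, rfl, rfl, h'⟩ := of_cons_mem_barIndex h
    exact consHom_mem hw ha (ih h')

lemma barD_mem {a p q N i : ℕ} {x : BarMod}
    (hx : x ∈ barPart a p q N i) : barD x ∈ barPart a p q N (i + 1) := by
  refine supported_le_comap _ (fun L hL => ?_) hx
  rw [barD_single]
  exact barList_mem hL

lemma insertY_mem {p q N i : ℕ} {L : List Letter}
    (h : L ∈ barIndex 1 p q N i) : insertY L ∈ barPart 1 p (q + 1) (N + 1) i := by
  have hc : Finsupp.single ((0, true) :: L) 1 ∈ barPart 1 p (q + 1) (N + 1) i := by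
    refine Finsupp.single_mem_supported ℤ _ ?_
    have := cons_mem_barIndex (a := 1) (w := ((0 : ℕ), true)) (by simp) (by simp [Letter.deg]) h
    simpa [add_comm] using this
  induction L generalizing p q N with
  | nil => exact hc
  | cons w L ih =>
    rcases w with ⟨u, ε⟩
    cases ε
    · rw [insertY]
      refine sub_mem hc ?_
      obtain ⟨hw, ha, p1, q1, N1, rfl, rfl, rfl, h'⟩ := of_cons_mem_barIndex h
      have hc' : Finsupp.single ((0, true) :: L) 1 ∈ barPart 1 p1 (q1 + 1) (N1 + 1) i := by
        refine Finsupp.single_mem_supported ℤ _ ?_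
        have := cons_mem_barIndex (a := 1)
            (w := ((0 : ℕ), true)) (by simp) (by simp [Letter.deg]) h'
        simpa [add_comm] using this
      have := consHom_mem (a := 1) hw ha (ih h' hc')
      simpa using this
    · exact hc

/-- The condition on the head excludes the letter `x^{(a-1)} y`, whose splitting would violate
the bound on the degree of the head, unless that letter is `y`, which is not split at all. -/
lemma splitList_mem {a p q N i : ℕ} {L : List Letter}
    (h : L ∈ barIndex a p q N (i + 1)) (ha : ∀ w ∈ L.head?, w = (a - 1, true) → a = 1) :
    splitList L ∈ barPart a p q N i := by
  induction L generalizing a p q N with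
  | nil => simp [splitList]
  | cons w L ih =>
    obtain ⟨hw, hd, p1, q1, N1, rfl, rfl, rfl, h'⟩ := of_cons_mem_barIndex h
    rcases w with ⟨u, ε⟩
    cases ε
    · rw [splitList]
      exact neg_mem (consHom_mem hw hd (ih h' (by simp)))
    · rw [splitList]
      split_ifs with hu
      · exact zero_mem _
      · have h1 : L ∈ barIndex 1 p1 q1 (N1 - i - 1 + i) i := by
          refine ⟨?_, h'.2⟩
          have := h'.1; omega
        have hd' : a ≤ Letter.deg (u, false) := by
          simp only [Letter.deg, Bool.toNat_true, Bool.toNat_false] at hd ⊢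
          rcases Nat.lt_or_ge u a with hua | hua
          · have : u = a - 1 := by omega
            have := ha (u, true) (by simp) (by rw [this])
            omega
          · omega
        have := consHom_mem (w := (u, false)) (a := a) (by simpa using hu) hd' (insertY_mem h1)
        have e : N1 - i - 1 + i + 1 + 1 = N1 + 1 := by
          have := h'.1; omega
        rw [e] at this
        simpa [add_comm] using this

/-- Delete the first letter if it equals `x^{(c)} y`; all other lists go to `0`. -/
def stripHom (c : ℕ) : BarMod →ₗ[ℤ] BarMod :=
  Finsupp.lcomapDomain (List.cons (c, true)) (List.cons_injective)

lemma stripHom_apply (c : ℕ) (x : BarMod) (L : List Letter) :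
    stripHom c x L = x ((c, true) :: L) := rfl

lemma stripHom_consHom (c : ℕ) (w : Letter) (x : BarMod) :
    stripHom c (consHom w x) = if w = (c, true) then x else 0 := by
  ext L
  rw [stripHom_apply]
  induction x using Finsupp.induction_linear with
  | zero => simp
  | add f g hf hg =>
    rw [map_add, Finsupp.add_apply, hf, hg]
    split_ifs <;> simp
  | single L' z =>
    rw [consHom_single]
    by_cases hw : w = (c, true)
    · simp [hw, Finsupp.single_apply]
    · simp [hw]

lemma stripHom_barList {c p q N i : ℕ} {L : List Letter}
    (h : L ∈ barIndex (c + 1) p q N i) :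
    stripHom c (barList L) = - barD (stripHom c (Finsupp.single L 1)) := by
  rcases L with _ | ⟨w, L⟩
  · have : stripHom c (Finsupp.single [] 1) = 0 := by
      ext L; simp [stripHom_apply]
    simp [barList, this]
  · obtain ⟨hw, hd, p1, q1, N1, rfl, rfl, rfl, h'⟩ := of_cons_mem_barIndex h
    rw [barList, map_sub, stripHom_consHom, single_eq_consHom, stripHom_consHom]
    have : stripHom c (mulList w L) = 0 := by
      rcases L with _ | ⟨w', L⟩
      · simp [mulList]
      · obtain ⟨hw', hd', -⟩ := of_cons_mem_barIndex h'
        rw [mulList]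
        split_ifs with hy
        · simp
        · ext M
          rw [stripHom_apply, Finsupp.single_apply, if_neg]
          · simp
          · intro he
            have he := (List.cons.inj he).1
            rcases w with ⟨u, _ | _⟩ <;> rcases w' with ⟨u', _ | _⟩ <;>
              simp_all [Letter.deg] <;> omega
    rw [this]
    split_ifs <;> simp [barD_single]

lemma stripHom_barD {c p q N i : ℕ} {x : BarMod} (hx : x ∈ barPart (c + 1) p q N i) :
    stripHom c (barD x) = - barD (stripHom c x) := by
  rw [barPart, Finsupp.supported_eq_span_single] at hx
  induction hx using Submodule.span_induction with
  | mem x h =>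
    obtain ⟨L, hL, rfl⟩ := h
    rw [barD_single]
    exact stripHom_barList hL
  | zero => simp
  | add x y _ _ hx hy => rw [map_add, map_add, hx, hy, map_add, map_add, neg_add]
  | smul a x _ hx => rw [map_smul, map_smul, hx, map_smul, map_smul, smul_neg]

lemma stripHom_mem {c p q N i : ℕ} {x : BarMod}
    (hx : x ∈ barPart (c + 1) (p + c) (q + 1) (N + 1) i) : stripHom c x ∈ barPart 1 p q N i := by
  refine supported_le_comap _ (fun L hL => ?_) hx
  rcases L with _ | ⟨w, L⟩
  · have : stripHom c (Finsupp.single [] 1) = 0 := by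
      ext L; simp [stripHom_apply]
    rw [this]; exact zero_mem _
  · rw [single_eq_consHom, stripHom_consHom]
    split_ifs with hw
    · obtain ⟨-, -, p1, q1, N1, hp, hq, hN, h'⟩ := of_cons_mem_barIndex hL
      subst hw
      refine Finsupp.single_mem_supported ℤ _ ?_
      simp only [Bool.toNat_true] at hp hq
      obtain rfl : p = p1 := by omega
      obtain rfl : q = q1 := by omega
      obtain rfl : N = N1 := by omega
      exact h'
    · exact zero_mem _

lemma consHom_mem_barPart {c p q N i : ℕ} {x : BarMod} (hx : x ∈ barPart 1 p q N i) :
    consHom (c, true) x ∈ barPart (c + 1) (p + c) (q + 1) (N + 1) i := by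
  have := consHom_mem (a := c + 1) (w := (c, true)) (by simp) (by simp [Letter.deg]) hx
  simpa [add_comm] using this

/-- On the lists not starting with `x^{(c)} y`, where `c + 1` is the bound on the degree of the
first letter, `splitHom` is a contracting homotopy. -/
lemma splitHom_homotopy {c p q N i : ℕ} {x : BarMod}
    (hx : x ∈ barPart (c + 1) p (q + 1) N (i + 1)) (h0 : stripHom c x = 0) :
    splitHom x ∈ barPart (c + 1) p (q + 1) N i ∧ stripHom c (splitHom x) = 0 ∧
      barD (splitHom x) + splitHom (barD x) = x := by
  have hx' : x ∈ Finsupp.supported ℤ ℤ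
      {L | L ∈ barIndex (c + 1) p (q + 1) N (i + 1) ∧ ∀ w ∈ L.head?, w ≠ (c, true)} := by
    rw [Finsupp.mem_supported]
    intro L hL
    refine ⟨hx hL, ?_⟩
    rintro w hw rfl
    rcases L with _ | ⟨w, L⟩
    · simp at hw
    · simp only [List.head?_cons, Option.mem_some_iff] at hw
      subst hw
      have := DFunLike.congr_fun h0 L
      rw [stripHom_apply] at this
      simp at hL
      exact hL this
  have hhead : ∀ L ∈ barIndex (c + 1) p (q + 1) N (i + 1), (∀ w ∈ L.head?, w ≠ (c, true)) →
      ∀ w ∈ L.head?, w ≠ (0, true) := by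
    rintro L hL hw w hw' rfl
    have := hL.2.2.2.2 _ hw'
    simp only [Letter.deg, Bool.toNat_true] at this
    obtain rfl : c = 0 := by omega
    exact hw _ hw' rfl
  rw [Finsupp.supported_eq_span_single] at hx'
  clear hx h0
  induction hx' using Submodule.span_induction with
  | mem x h =>
    obtain ⟨L, ⟨hL, hw⟩, rfl⟩ := h
    rw [splitHom_single, one_smul, barD_single]
    refine ⟨splitList_mem hL ?_, ?_, ?_⟩
    · intro w hw' hw''
      exact absurd hw'' (hw w hw')
    · rcases L with _ | ⟨⟨u, _ | _⟩, L⟩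
      · simp [splitList]
      · simp [splitList, stripHom_consHom]
      · rw [splitList]; split_ifs <;> simp [stripHom_consHom]
    · refine barD_splitList L ?_ hL.2.2.2.1 (hhead L hL hw)
      have := hL.2.2.1
      have h2 : 0 < L.countP (·.2) := by omega
      simpa [List.countP_pos_iff] using h2
  | zero => simp
  | add x y _ _ hx hy =>
    obtain ⟨a1, a2, a3⟩ := hx
    obtain ⟨b1, b2, b3⟩ := hy
    refine ⟨by rw [map_add]; exact add_mem a1 b1, by rw [map_add, map_add, a2, b2, add_zero], ?_⟩
    simp only [map_add]
    rw [← add_add_add_comm, a3, b3]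
  | smul a x _ hx =>
    obtain ⟨a1, a2, a3⟩ := hx
    refine ⟨by rw [map_smul]; exact Submodule.smul_mem _ _ a1,
      by rw [map_smul, map_smul, a2, smul_zero], ?_⟩
    simp only [map_smul]
    rw [← smul_add, a3]

/-- Stripping the first letter `x^{(c)} y` is an isomorphism in homology. -/
theorem bar_strip (c p q N : ℕ) :
    Nonempty (SubQuot (barCycles (c + 1) (p + c) (q + 1) (N + 1))
        (barBoundaries (c + 1) (p + c) (q + 1) (N + 1)) ≃+
      SubQuot (barCycles 1 p q N) (barBoundaries 1 p q N)) := by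
  have hss : ∀ x, stripHom c (consHom (c, true) x) = x := by
    intro x; simp [stripHom_consHom]
  refine subQuot_addEquiv (stripHom c) ?_ ?_ ?_
  · rintro z ⟨hz, hz0⟩
    refine ⟨stripHom_mem hz, ?_⟩
    change barD _ = 0
    have := stripHom_barD hz
    rw [show barD z = 0 from hz0, map_zero] at this
    exact neg_eq_zero.1 this.symm
  · rintro z ⟨hz, hz0⟩
    constructor
    · rintro ⟨u, hu, hu'⟩
      have hu1 := consHom_mem_barPart (c := c) hu
      have h1 := stripHom_barD hu1
      rw [hss, hu'] at h1
      obtain ⟨b1, b2, b3⟩ := splitHom_homotopy (i := 1)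
        (x := z + barD (consHom (c, true) u)) (add_mem hz (barD_mem hu1))
        (by rw [map_add, h1]; simp)
      rw [map_add barD z, show barD z = 0 from hz0, barD_barD] at b3
      refine ⟨splitHom (z + barD (consHom (c, true) u)) - consHom (c, true) u,
        sub_mem b1 hu1, ?_⟩
      rw [map_sub]
      rw [add_zero, map_zero, add_zero] at b3
      rw [b3]; abel
    · rintro ⟨u, hu, rfl⟩
      refine ⟨- stripHom c u, neg_mem (stripHom_mem hu), ?_⟩
      rw [stripHom_barD hu, map_neg]
  · rintro z' ⟨hz, hz0⟩
    have hu1 := consHom_mem_barPart (c := c) hz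
    have h1 := stripHom_barD hu1
    rw [hss, LinearMap.mem_ker.1 hz0, neg_zero] at h1
    obtain ⟨b1, b2, b3⟩ := splitHom_homotopy (i := 2) (barD_mem hu1) h1
    rw [barD_barD, map_zero, add_zero] at b3
    refine ⟨consHom (c, true) z' - splitHom (barD (consHom (c, true) z')), ⟨sub_mem hu1 b1, ?_⟩, ?_⟩
    · change barD _ = 0
      rw [map_sub, b3, sub_self]
    · rw [map_sub, b2, hss]; simp

/-- All exterior letters can be stripped. -/
theorem bar_strip_all (a k b : ℕ) (ha : 1 ≤ a) (hk : k < b) :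
    Nonempty (SubQuot (barCycles a (a + k) (b - k) (b + 1))
        (barBoundaries a (a + k) (b - k) (b + 1)) ≃+
      SubQuot (barCycles 1 (k + 1) 0 (k + 1)) (barBoundaries 1 (k + 1) 0 (k + 1))) := by
  obtain ⟨c, rfl⟩ : ∃ c, a = c + 1 := ⟨a - 1, by omega⟩
  obtain ⟨q, rfl⟩ : ∃ q, b = k + 1 + q := ⟨b - k - 1, by omega⟩
  have h0 := bar_strip c (k + 1) q (k + 1 + q)
  have e1 : k + 1 + c = c + 1 + k := by omega
  have e2 : q + 1 = k + 1 + q - k := by omega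
  rw [e1, e2] at h0
  have h1 : Nonempty (SubQuot (barCycles 1 (k + 1) q (k + 1 + q))
      (barBoundaries 1 (k + 1) q (k + 1 + q)) ≃+
      SubQuot (barCycles 1 (k + 1) 0 (k + 1)) (barBoundaries 1 (k + 1) 0 (k + 1))) := by
    clear h0 e2 hk
    induction q with
    | zero => exact ⟨AddEquiv.refl _⟩
    | succ q ih =>
      obtain ⟨e⟩ := ih
      obtain ⟨e'⟩ := bar_strip 0 (k + 1) q (k + 1 + q)
      exact ⟨e'.trans e⟩
  obtain ⟨e⟩ := h0
  obtain ⟨e'⟩ := h1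
  exact ⟨e.trans e'⟩

/-! ### Bars of a list of letters -/

/-- The number of elements of `B` below `t`. -/
def rk (B : Finset ℕ) (t : ℕ) : ℕ := (B.filter (· < t)).card

/-- The sign attached to removing `t` from `B`, or to adding it. -/
def sgn (B : Finset ℕ) (t : ℕ) : ℤ := (-1) ^ rk B t

/-- The places of the bars between adjacent letters, when a letter occupies as many places as its
degree and the first letter begins at the place `s`. -/
def bars : ℕ → List Letter → Finset ℕ
  | _, [] => ∅
  | _, [_] => ∅
  | s, w :: w' :: L => insert (s + w.deg) (bars (s + w.deg) (w' :: L))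

/-- Multiply the letters number `τ` and `τ + 1`, up to a coefficient. -/
def mergeAt : ℕ → List Letter → List Letter
  | 0, w :: w' :: L => (w.1 + w'.1, w.2 || w'.2) :: L
  | τ + 1, w :: L => w :: mergeAt τ L
  | _, L => L

/-- The coefficient of the product of the letters number `τ` and `τ + 1`. -/
def mergeCoeff : ℕ → List Letter → ℤ
  | 0, w :: w' :: _ => if w.2 && w'.2 then 0 else ((w.1 + w'.1).choose w.1 : ℤ)
  | τ + 1, _ :: L => mergeCoeff τ L
  | _, _ => 0

lemma bars_cons {s : ℕ} {w : Letter} {L : List Letter} (hL : L ≠ []) :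
    bars s (w :: L) = insert (s + w.deg) (bars (s + w.deg) L) := by
  obtain ⟨w', L, rfl⟩ := List.exists_cons_of_ne_nil hL
  rfl

lemma lt_of_mem_bars {s t : ℕ} {L : List Letter} (hL : ∀ w ∈ L, w ≠ (0, false))
    (ht : t ∈ bars s L) : s < t := by
  induction L generalizing s with
  | nil => simp [bars] at ht
  | cons w L ih =>
    rcases L with _ | ⟨w', L⟩
    · simp [bars] at ht
    · rw [bars, Finset.mem_insert] at ht
      have := one_le_deg (hL w (by simp))
      rcases ht with rfl | ht
      · omega
      · have := ih (fun w hw => hL w (by simp [hw])) ht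
        omega

lemma not_mem_bars {s : ℕ} {L : List Letter} (hL : ∀ w ∈ L, w ≠ (0, false)) :
    s ∉ bars s L := fun h => lt_irrefl _ (lt_of_mem_bars hL h)

lemma rk_insert_of_lt {B : Finset ℕ} {t t0 : ℕ} (h0 : t0 ∉ B) (h : t0 < t) :
    rk (insert t0 B) t = rk B t + 1 := by
  rw [rk, rk, Finset.filter_insert, if_pos h, Finset.card_insert_of_notMem]
  simp [h0]

lemma rk_insert_of_ge {B : Finset ℕ} {t t0 : ℕ} (h : t ≤ t0) :
    rk (insert t0 B) t = rk B t := by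
  rw [rk, rk, Finset.filter_insert, if_neg (by omega)]

lemma rk_eq_zero {B : Finset ℕ} {t : ℕ} (h : ∀ s ∈ B, t ≤ s) : rk B t = 0 := by
  rw [rk, Finset.card_eq_zero, Finset.filter_eq_empty_iff]
  intro s hs; have := h s hs; omega

lemma barList_eq_sum (s : ℕ) (L : List Letter) (hL : ∀ w ∈ L, w ≠ (0, false)) :
    barList L = ∑ t ∈ bars s L, sgn (bars s L) t •
      Finsupp.single (mergeAt (rk (bars s L) t) L) (mergeCoeff (rk (bars s L) t) L) := by
  induction L generalizing s with
  | nil => simp [bars, barList]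
  | cons w L ih =>
    rcases L with _ | ⟨w', L⟩
    · simp [bars, barList, mulList]
    · have hL' : ∀ w ∈ w' :: L, w ≠ (0, false) := fun w hw => hL w (by simp [hw])
      have h0 : s + w.deg ∉ bars (s + w.deg) (w' :: L) := not_mem_bars hL'
      rw [barList, ih (s + w.deg) hL', bars, Finset.sum_insert h0, map_sum, sub_eq_add_neg,
        ← Finset.sum_neg_distrib]
      have hlt : ∀ t ∈ bars (s + w.deg) (w' :: L), s + w.deg < t :=
        fun t ht => lt_of_mem_bars hL' ht
      congr 1
      · have : rk (insert (s + w.deg) (bars (s + w.deg) (w' :: L))) (s + w.deg) = 0 := by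
          apply rk_eq_zero
          intro t ht
          rcases Finset.mem_insert.1 ht with rfl | ht
          · exact le_rfl
          · exact (hlt t ht).le
        rw [sgn, this, mergeAt, mergeCoeff, mulList]
        split_ifs <;> simp
      · refine Finset.sum_congr rfl fun t ht => ?_
        rw [sgn, sgn, rk_insert_of_lt h0 (hlt t ht), mergeAt, mergeCoeff, map_smul,
          consHom_single, pow_succ]
        simp

lemma bars_mergeAt {s t : ℕ} {L : List Letter} (hL : ∀ w ∈ L, w ≠ (0, false))
    (ht : t ∈ bars s L) (hc : mergeCoeff (rk (bars s L) t) L ≠ 0) :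
    bars s (mergeAt (rk (bars s L) t) L) = (bars s L).erase t := by
  induction L generalizing s with
  | nil => simp [bars] at ht
  | cons w L ih =>
    rcases L with _ | ⟨w', L⟩
    · simp [bars] at ht
    · have hL' : ∀ w ∈ w' :: L, w ≠ (0, false) := fun w hw => hL w (by simp [hw])
      have h0 : s + w.deg ∉ bars (s + w.deg) (w' :: L) := not_mem_bars hL'
      have hlt : ∀ t ∈ bars (s + w.deg) (w' :: L), s + w.deg < t :=
        fun t ht => lt_of_mem_bars hL' ht
      rw [bars] at ht hc ⊢
      rcases Finset.mem_insert.1 ht with rfl | ht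
      · have : rk (insert (s + w.deg) (bars (s + w.deg) (w' :: L))) (s + w.deg) = 0 := by
          apply rk_eq_zero
          intro t ht
          rcases Finset.mem_insert.1 ht with rfl | ht
          · exact le_rfl
          · exact (hlt t ht).le
        rw [this] at hc ⊢
        rw [Finset.erase_insert h0, mergeAt]
        rw [mergeCoeff] at hc
        have hd : Letter.deg (w.1 + w'.1, w.2 || w'.2) = w.deg + w'.deg := by
          rcases w with ⟨u, _ | _⟩ <;> rcases w' with ⟨u', _ | _⟩ <;>
            simp_all [Letter.deg] <;> omega
        rcases L with _ | ⟨w'', L⟩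
        · simp [bars]
        · rw [bars, bars, hd, add_assoc]
      · rw [rk_insert_of_lt h0 (hlt t ht)] at hc ⊢
        rw [mergeCoeff] at hc
        rw [mergeAt, bars_cons, ih hL' ht hc, Finset.erase_insert_of_ne (hlt t ht).ne]
        cases rk (bars (s + w.deg) (w' :: L)) t with
        | zero => rcases L with _ | ⟨w'', L⟩ <;> simp [mergeAt]
        | succ n => simp [mergeAt]

lemma card_bars {s : ℕ} {L : List Letter} (hL : ∀ w ∈ L, w ≠ (0, false)) (h : L ≠ []) :
    (bars s L).card + 1 = L.length := by
  induction L generalizing s with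
  | nil => simp at h
  | cons w L ih =>
    rcases L with _ | ⟨w', L⟩
    · simp [bars]
    · have hL' : ∀ w ∈ w' :: L, w ≠ (0, false) := fun w hw => hL w (by simp [hw])
      rw [bars, Finset.card_insert_of_notMem (not_mem_bars hL'), ih hL' (by simp)]
      simp

lemma mem_bars_lt {s t : ℕ} {L : List Letter} (hL : ∀ w ∈ L, w ≠ (0, false))
    (ht : t ∈ bars s L) : t < s + (L.map Letter.deg).sum := by
  induction L generalizing s with
  | nil => simp [bars] at ht
  | cons w L ih =>
    rcases L with _ | ⟨w', L⟩
    · simp [bars] at ht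
    · rw [bars, Finset.mem_insert] at ht
      have := one_le_deg (hL w' (by simp))
      rcases ht with rfl | ht
      · simp; omega
      · have := ih (fun w hw => hL w (by simp [hw])) ht
        simp at this ⊢; omega

lemma mem_bars_ge {s t a : ℕ} {L : List Letter} (hL : ∀ w ∈ L, w ≠ (0, false))
    (ha : ∀ w ∈ L.head?, a ≤ w.deg) (ht : t ∈ bars s L) : s + a ≤ t := by
  rcases L with _ | ⟨w, _ | ⟨w', L⟩⟩
  · simp [bars] at ht
  · simp [bars] at ht
  · have h1 := ha w (by simp)
    rw [bars, Finset.mem_insert] at ht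
    rcases ht with rfl | ht
    · omega
    · have := lt_of_mem_bars (fun w hw => hL w (by simp [hw])) ht
      omega

lemma sum_deg_eq {a p q N i : ℕ} {L : List Letter} (hL : L ∈ barIndex a p q N i) :
    (L.map Letter.deg).sum = p + q := by
  obtain ⟨-, h2, h3, -⟩ := hL
  rw [← h2, ← h3]
  clear h2 h3
  induction L with
  | nil => simp
  | cons w L ih =>
    rw [List.map_cons, List.sum_cons, ih, List.map_cons, List.sum_cons, List.countP_cons]
    rcases w with ⟨u, _ | _⟩ <;> simp [Letter.deg] <;> omega

lemma bars_subset {a p q N i : ℕ} {L : List Letter} (hL : L ∈ barIndex a p q N i) :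
    bars 0 L ⊆ Finset.Ico a (p + q) := by
  intro t ht
  have h1 := mem_bars_lt hL.2.2.2.1 ht
  have h2 := mem_bars_ge hL.2.2.2.1 hL.2.2.2.2 ht
  rw [sum_deg_eq hL] at h1
  rw [Finset.mem_Ico]; omega

lemma bars_injective {s : ℕ} {L L' : List Letter} (hL : ∀ w ∈ L, w ≠ (0, false))
    (hL' : ∀ w ∈ L', w ≠ (0, false)) (hy : ∀ w ∈ L, w.2 = false) (hy' : ∀ w ∈ L', w.2 = false)
    (hs : (L.map Letter.deg).sum = (L'.map Letter.deg).sum) (hb : bars s L = bars s L') :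
    L = L' := by
  induction L generalizing s L' with
  | nil =>
    rcases L' with _ | ⟨w', L'⟩
    · rfl
    · have := one_le_deg (hL' w' (by simp))
      simp at hs; omega
  | cons w L ih =>
    rcases L' with _ | ⟨w', L'⟩
    · have := one_le_deg (hL w (by simp))
      simp at hs; omega
    · have hLt : ∀ w ∈ L, w ≠ (0, false) := fun w hw => hL w (by simp [hw])
      have hLt' : ∀ w ∈ L', w ≠ (0, false) := fun w hw => hL' w (by simp [hw])
      have hw : w.deg = w'.deg → w = w' := by
        have h1 := hy w (by simp)
        have h2 := hy' w' (by simp)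
        rcases w with ⟨u, ε⟩; rcases w' with ⟨u', ε'⟩
        simp only at h1 h2
        subst h1 h2
        simp [Letter.deg]
      rcases eq_or_ne L [] with rfl | hn <;> rcases eq_or_ne L' [] with rfl | hn'
      · simp only [List.map_cons, List.map_nil, List.sum_cons, List.sum_nil, add_zero] at hs
        rw [hw hs]
      · rw [bars_cons hn'] at hb
        exact absurd hb.symm (Finset.insert_ne_empty _ _)
      · rw [bars_cons hn] at hb
        exact absurd hb (Finset.insert_ne_empty _ _)
      · rw [bars_cons hn, bars_cons hn'] at hb
        have hd : w.deg = w'.deg := by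
          have h1 : s + w.deg ∈ insert (s + w'.deg) (bars (s + w'.deg) L') := by
            rw [← hb]; simp
          have h2 : s + w'.deg ∈ insert (s + w.deg) (bars (s + w.deg) L) := by
            rw [hb]; simp
          have h3 : s + w'.deg ≤ s + w.deg := by
            rcases Finset.mem_insert.1 h1 with h | h
            · omega
            · exact (lt_of_mem_bars hLt' h).le
          have h4 : s + w.deg ≤ s + w'.deg := by
            rcases Finset.mem_insert.1 h2 with h | h
            · omega
            · exact (lt_of_mem_bars hLt h).le
          omega
        obtain rfl := hw hd
        have hb' : bars (s + w.deg) L = bars (s + w.deg) L' := by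
          rw [← Finset.erase_insert (not_mem_bars hLt), hb, Finset.erase_insert (not_mem_bars hLt')]
        rw [ih hLt hLt' (fun w hw => hy w (by simp [hw])) (fun w hw => hy' w (by simp [hw]))
          (by simpa using hs) hb']

/-- The differential that adds elements of `I` to the argument of a family `m`, with values
transported by the maps `Θ`. -/
def coboundary {N : Type*} [AddCommGroup N] (I : Finset ℕ) (Θ : ℕ → N →ₗ[ℤ] N) :
    (Finset ℕ → N) →ₗ[ℤ] (Finset ℕ → N) where
  toFun m B := ∑ t ∈ I \ B, sgn B t • Θ (rk B t) (m (insert t B))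
  map_add' m m' := by ext B; simp [Finset.sum_add_distrib]
  map_smul' c m := by
    ext B
    simp only [Pi.smul_apply, map_smul, Finset.smul_sum, RingHom.id_apply]
    exact Finset.sum_congr rfl fun t _ => smul_comm _ _ _

lemma coboundary_apply {N : Type*} [AddCommGroup N] (I : Finset ℕ) (Θ : ℕ → N →ₗ[ℤ] N)
    (m : Finset ℕ → N) (B : Finset ℕ) :
    coboundary I Θ m B = ∑ t ∈ I \ B, sgn B t • Θ (rk B t) (m (insert t B)) := rfl

lemma rk_insert_self (B : Finset ℕ) (t : ℕ) : rk (insert t B) t = rk B t := rk_insert_of_ge le_rfl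

lemma coboundary_single {N : Type*} [AddCommGroup N] (I : Finset ℕ) (Θ : ℕ → N →ₗ[ℤ] N)
    {A : Finset ℕ} (hA : A ⊆ I) (m : N) :
    coboundary I Θ (Pi.single A m) =
      ∑ t ∈ A, sgn A t • Pi.single (A.erase t) (Θ (rk A t) m) := by
  ext B
  rw [coboundary_apply, Finset.sum_apply]
  have h1 : ∀ t ∈ I \ B, sgn B t • Θ (rk B t) (Pi.single (M := fun _ => N) A m (insert t B)) =
      if insert t B = A then sgn A t • Θ (rk A t) m else 0 := by
    intro t _
    split_ifs with h
    · subst h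
      rw [Pi.single_eq_same, sgn, sgn, rk_insert_self]
    · rw [Pi.single_eq_of_ne h]; simp
  have h2 : ∀ t ∈ A, (sgn A t • Pi.single (M := fun _ => N) (A.erase t) (Θ (rk A t) m)) B =
      if A.erase t = B then sgn A t • Θ (rk A t) m else 0 := by
    intro t _
    rw [Pi.smul_apply]
    split_ifs with h
    · subst h; rw [Pi.single_eq_same]
    · rw [Pi.single_eq_of_ne (Ne.symm h)]; simp
  rw [Finset.sum_congr rfl h1, Finset.sum_congr rfl h2, ← Finset.sum_filter, ← Finset.sum_filter]
  refine Finset.sum_congr ?_ fun _ _ => rfl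
  ext t
  simp only [Finset.mem_filter, Finset.mem_sdiff]
  constructor
  · rintro ⟨⟨hI, hB⟩, rfl⟩
    exact ⟨Finset.mem_insert_self _ _, Finset.erase_insert hB⟩
  · rintro ⟨htA, rfl⟩
    exact ⟨⟨hA htA, Finset.notMem_erase _ _⟩, Finset.insert_erase htA⟩

/-! ### The bar complex of the divided power algebra in one variable -/

/-- The product of the factorials of the `x`-degrees of the letters. -/
def listFact (L : List Letter) : ℕ := (L.map fun w => (w.1).factorial).prod

lemma listFact_pos (L : List Letter) : 0 < listFact L :=
  List.prod_pos fun x hx => by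
    obtain ⟨w, -, rfl⟩ := List.mem_map.1 hx
    exact Nat.factorial_pos _

lemma mergeCoeff_mul_listFact {τ : ℕ} {L : List Letter} (h : mergeCoeff τ L ≠ 0) :
    mergeCoeff τ L * listFact L = listFact (mergeAt τ L) := by
  induction L generalizing τ with
  | nil => cases τ <;> simp [mergeCoeff] at h
  | cons w L ih =>
    cases τ with
    | zero =>
      rcases L with _ | ⟨w', L⟩
      · simp [mergeCoeff] at h
      · simp only [mergeCoeff, mergeAt] at h ⊢
        split_ifs at h ⊢ with hy
        · simp at h
        · simp only [listFact, List.map_cons, List.prod_cons]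
          rw [← Nat.add_choose_mul_factorial_mul_factorial, Nat.choose_symm_add]
          push_cast; ring
    | succ τ =>
      simp only [mergeCoeff] at h
      simp only [mergeCoeff, mergeAt, listFact, List.map_cons, List.prod_cons] at ih ⊢
      have := ih h
      push_cast at this ⊢
      rw [← this]; ring

/-- Rescaling by factorials turns the bar differential of the divided power algebra into the
differential of a simplex. -/
def rescale : BarMod →ₗ[ℤ] (Finset ℕ → ℚ) :=
  Finsupp.linearCombination ℤ fun L => Pi.single (bars 0 L) (1 / listFact L : ℚ)

/-- The differential of the simplex with vertices `1, …, K - 1`. -/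
abbrev simplexD (K : ℕ) : (Finset ℕ → ℚ) →ₗ[ℤ] (Finset ℕ → ℚ) :=
  coboundary (Finset.Ico 1 K) fun _ => LinearMap.id

lemma rescale_single (L : List Letter) :
    rescale (Finsupp.single L 1) = Pi.single (bars 0 L) (1 / listFact L : ℚ) := by
  simp [rescale]

lemma not_y_of_mem {a p N i : ℕ} {L : List Letter} (hL : L ∈ barIndex a p 0 N i) :
    ∀ w ∈ L, w.2 = false := by
  have := hL.2.2.1
  rw [List.countP_eq_zero] at this
  intro w hw
  simpa using this w hw

lemma mergeCoeff_pos {s t : ℕ} {L : List Letter} (hL : ∀ w ∈ L, w ≠ (0, false))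
    (hy : ∀ w ∈ L, w.2 = false) (ht : t ∈ bars s L) : mergeCoeff (rk (bars s L) t) L ≠ 0 := by
  have hcard : ∀ (L : List Letter) (τ : ℕ), (∀ w ∈ L, w.2 = false) → τ + 1 < L.length →
      mergeCoeff τ L ≠ 0 := by
    intro L
    induction L with
    | nil => intro τ _ h; simp at h
    | cons w L ih =>
      intro τ hy h
      cases τ with
      | zero =>
        rcases L with _ | ⟨w', L⟩
        · simp at h
        · have h1 := hy w (by simp)
          simp only [mergeCoeff, h1]
          simp
          exact_mod_cast (Nat.choose_pos (by omega)).ne'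
      | succ τ =>
        rw [mergeCoeff]
        exact ih τ (fun w hw => hy w (by simp [hw])) (by simpa using h)
  apply hcard L _ hy
  have hne : L ≠ [] := by rintro rfl; simp [bars] at ht
  rw [← card_bars (s := s) hL hne]
  have : rk (bars s L) t < (bars s L).card := by
    apply Finset.card_lt_card
    rw [Finset.ssubset_iff_of_subset (Finset.filter_subset _ _)]
    exact ⟨t, ht, by simp⟩
  omega

lemma rescale_barD {K i : ℕ} {x : BarMod} (hx : x ∈ barPart 1 K 0 K i) :
    rescale (barD x) = simplexD K (rescale x) := by
  rw [barPart, Finsupp.supported_eq_span_single] at hx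
  induction hx using Submodule.span_induction with
  | mem x h =>
    obtain ⟨L, hL, rfl⟩ := h
    have hn := hL.2.2.2.1
    rw [barD_single, barList_eq_sum 0 L hn, rescale_single,
      coboundary_single _ _ (by simpa using bars_subset hL), map_sum]
    refine Finset.sum_congr rfl fun t ht => ?_
    have hc := mergeCoeff_pos hn (not_y_of_mem hL) ht
    rw [map_smul, rescale, Finsupp.linearCombination_single, bars_mergeAt hn ht hc]
    congr 1
    rw [LinearMap.id_apply, ← Pi.single_smul']
    congr 1
    have h1 := mergeCoeff_mul_listFact hc
    have h1' : ((mergeCoeff (rk (bars 0 L) t) L : ℤ) : ℚ) * listFact L =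
      listFact (mergeAt (rk (bars 0 L) t) L) := by exact_mod_cast h1
    have h2 : (listFact L : ℚ) ≠ 0 := by exact_mod_cast (listFact_pos L).ne'
    have h3 : (listFact (mergeAt (rk (bars 0 L) t) L) : ℚ) ≠ 0 := by
      exact_mod_cast (listFact_pos _).ne'
    rw [zsmul_eq_mul, ← h1']
    rw [← h1'] at h3
    have := left_ne_zero_of_mul h3
    field_simp
  | zero => simp
  | add x y _ _ hx hy => simp only [map_add, hx, hy]
  | smul a x _ hx => simp only [map_smul, hx]

lemma rescale_apply {K i : ℕ} {x : BarMod} (hx : x ∈ barPart 1 K 0 K i) {L : List Letter}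
    (hL : L ∈ barIndex 1 K 0 K i) : rescale x (bars 0 L) = x L / listFact L := by
  rw [barPart, Finsupp.supported_eq_span_single] at hx
  induction hx using Submodule.span_induction with
  | mem x h =>
    obtain ⟨L', hL', rfl⟩ := h
    rw [rescale_single]
    by_cases h : L' = L
    · subst h; simp
    · rw [Finsupp.single_eq_of_ne (Ne.symm h), Pi.single_eq_of_ne]
      · simp
      · intro hb
        exact h (bars_injective hL'.2.2.2.1 hL.2.2.2.1 (not_y_of_mem hL') (not_y_of_mem hL)
          (by rw [sum_deg_eq hL, sum_deg_eq hL']) hb.symm)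
  | zero => simp
  | add x y _ _ hx hy =>
    rw [map_add, Pi.add_apply, hx, hy, Finsupp.add_apply]; push_cast; ring
  | smul a x _ hx =>
    rw [map_smul, Pi.smul_apply, hx, Finsupp.smul_apply, zsmul_eq_mul, smul_eq_mul]; push_cast; ring

lemma eq_of_rescale {K i : ℕ} {x y : BarMod} (hx : x ∈ barPart 1 K 0 K i)
    (hy : y ∈ barPart 1 K 0 K i)
    (h : ∀ L ∈ barIndex 1 K 0 K i, rescale x (bars 0 L) = rescale y (bars 0 L)) : x = y := by
  ext L
  by_cases hL : L ∈ barIndex 1 K 0 K i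
  · have := h L hL
    rw [rescale_apply hx hL, rescale_apply hy hL] at this
    have h2 : (listFact L : ℚ) ≠ 0 := by exact_mod_cast (listFact_pos L).ne'
    rw [div_left_inj' h2] at this
    exact_mod_cast this
  · have h1 : x L = 0 := by
      by_contra h; exact hL (hx (Finsupp.mem_support_iff.2 h))
    have h2 : y L = 0 := by
      by_contra h; exact hL (hy (Finsupp.mem_support_iff.2 h))
    rw [h1, h2]

/-! ### Lists with few letters different from `x` -/

/-- The list of `m` letters `x`. -/
def ones (m : ℕ) : List Letter := List.replicate m (1, false)

lemma ones_succ (m : ℕ) : ones (m + 1) = (1, false) :: ones m := rfl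

lemma bars_ones_append (m s : ℕ) {L : List Letter} (hL : L ≠ []) :
    bars s (ones m ++ L) = Finset.Ico (s + 1) (s + m + 1) ∪ bars (s + m) L := by
  induction m generalizing s with
  | zero => simp [ones]
  | succ m ih =>
    rw [ones_succ, List.cons_append, bars_cons (by simp [hL]), ih]
    simp only [Letter.deg, Bool.toNat_false, add_zero]
    rw [show s + 1 + m = s + (m + 1) by ring, ← Finset.insert_union]
    congr 1
    ext t; simp; omega

lemma bars_cons_ones (m s u : ℕ) :
    bars s ((u, false) :: ones m) = Finset.Ico (s + u) (s + u + m) := by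
  induction m generalizing s u with
  | zero => simp [ones, bars]
  | succ m ih =>
    rw [ones_succ, bars_cons (by simp), ih]
    simp only [Letter.deg, Bool.toNat_false, add_zero]
    ext t; simp; omega

lemma mem_barIndex_of {K i : ℕ} {L : List Letter} (h1 : L.length + i = K)
    (h2 : (L.map Prod.fst).sum = K) (hy : ∀ w ∈ L, 1 ≤ w.1 ∧ w.2 = false) :
    L ∈ barIndex 1 K 0 K i := by
  have hn : ∀ w ∈ L, w ≠ (0, false) := by
    rintro w hw rfl
    have := (hy _ hw).1
    simp at this
  refine ⟨h1, h2, ?_, hn, ?_⟩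
  · rw [List.countP_eq_zero]
    intro w hw
    simp [(hy w hw).2]
  · intro w hw
    exact one_le_deg (hn w (List.mem_of_mem_head? hw))

lemma ones_forall (m : ℕ) : ∀ w ∈ ones m, 1 ≤ w.1 ∧ w.2 = false := by
  intro w hw
  rw [ones, List.mem_replicate] at hw
  simp [hw.2]

/-- The list with a letter `x^{(2)}` in the places `j - 1` and `j`. -/
def listOne (K j : ℕ) : List Letter := ones (j - 1) ++ (2, false) :: ones (K - 1 - j)

/-- The list with a letter `x^{(3)}` in the places `j - 1`, `j` and `j + 1`. -/
def listAdj (K j : ℕ) : List Letter := ones (j - 1) ++ (3, false) :: ones (K - 2 - j)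

/-- The list with letters `x^{(2)}` in the places `i - 1` and `i` and in the places `j - 1` and
`j`. -/
def listTwo (K i j : ℕ) : List Letter :=
  ones (i - 1) ++ (2, false) :: (ones (j - i - 2) ++ (2, false) :: ones (K - 1 - j))

lemma listOne_mem {K j : ℕ} (h1 : 1 ≤ j) (h2 : j < K) : listOne K j ∈ barIndex 1 K 0 K 1 := by
  refine mem_barIndex_of ?_ ?_ ?_
  · simp [listOne, ones]; omega
  · simp [listOne, ones]; omega
  · intro w hw
    simp only [listOne, List.mem_append, List.mem_cons] at hw
    rcases hw with h | rfl | h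
    · exact ones_forall _ w h
    · simp
    · exact ones_forall _ w h

lemma listAdj_mem {K j : ℕ} (h1 : 1 ≤ j) (h2 : j + 1 < K) :
    listAdj K j ∈ barIndex 1 K 0 K 2 := by
  refine mem_barIndex_of ?_ ?_ ?_
  · simp [listAdj, ones]; omega
  · simp [listAdj, ones]; omega
  · intro w hw
    simp only [listAdj, List.mem_append, List.mem_cons] at hw
    rcases hw with h | rfl | h
    · exact ones_forall _ w h
    · simp
    · exact ones_forall _ w h

lemma listTwo_mem {K i j : ℕ} (h1 : 1 ≤ i) (h2 : i + 2 ≤ j) (h3 : j < K) :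
    listTwo K i j ∈ barIndex 1 K 0 K 2 := by
  refine mem_barIndex_of ?_ ?_ ?_
  · simp [listTwo, ones]; omega
  · simp [listTwo, ones]; omega
  · intro w hw
    simp only [listTwo, List.mem_append, List.mem_cons] at hw
    rcases hw with h | rfl | h | rfl | h
    · exact ones_forall _ w h
    · simp
    · exact ones_forall _ w h
    · simp
    · exact ones_forall _ w h

lemma bars_listOne {K j : ℕ} (h1 : 1 ≤ j) (h2 : j < K) :
    bars 0 (listOne K j) = Finset.Ico 1 K \ {j} := by
  rw [listOne, bars_ones_append _ _ (by simp), bars_cons_ones]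
  ext t; simp; omega

lemma bars_listAdj {K j : ℕ} (h1 : 1 ≤ j) (h2 : j + 1 < K) :
    bars 0 (listAdj K j) = Finset.Ico 1 K \ {j, j + 1} := by
  rw [listAdj, bars_ones_append _ _ (by simp), bars_cons_ones]
  ext t; simp; omega

lemma bars_listTwo {K i j : ℕ} (h1 : 1 ≤ i) (h2 : i + 2 ≤ j) (h3 : j < K) :
    bars 0 (listTwo K i j) = Finset.Ico 1 K \ {i, j} := by
  rw [listTwo, bars_ones_append _ _ (by simp), bars_cons (by simp),
    bars_ones_append _ _ (by simp), bars_cons_ones]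
  ext t; simp [Letter.deg]; omega

lemma listFact_ones (m : ℕ) : listFact (ones m) = 1 := by simp [listFact, ones]

lemma listFact_append (L L' : List Letter) : listFact (L ++ L') = listFact L * listFact L' := by
  simp [listFact]

lemma listFact_cons (w : Letter) (L : List Letter) :
    listFact (w :: L) = w.1.factorial * listFact L := by
  simp [listFact]

lemma listFact_listOne (K j : ℕ) : listFact (listOne K j) = 2 := by
  simp [listOne, listFact_append, listFact_cons, listFact_ones]

lemma listFact_listAdj (K j : ℕ) : listFact (listAdj K j) = 6 := by
  simp [listAdj, listFact_append, listFact_cons, listFact_ones, Nat.factorial]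

lemma listFact_listTwo (K i j : ℕ) : listFact (listTwo K i j) = 4 := by
  simp [listTwo, listFact_append, listFact_cons, listFact_ones]

lemma card_sdiff_bars {K i : ℕ} (hK : 1 ≤ K) {L : List Letter} (hL : L ∈ barIndex 1 K 0 K i) :
    (Finset.Ico 1 K \ bars 0 L).card = i := by
  have h1 : bars 0 L ⊆ Finset.Ico 1 K := by simpa using bars_subset hL
  have hne : L ≠ [] := by
    rintro rfl
    have := hL.2.1
    simp at this; omega
  have h2 := card_bars (s := 0) hL.2.2.2.1 hne
  have h3 := hL.1
  rw [Finset.card_sdiff_of_subset h1, Nat.card_Ico]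
  omega

lemma exists_pair {K : ℕ} (hK : 1 ≤ K) {L : List Letter} (hL : L ∈ barIndex 1 K 0 K 2) :
    ∃ i j, 1 ≤ i ∧ i < j ∧ j < K ∧ bars 0 L = Finset.Ico 1 K \ {i, j} := by
  have h1 := bars_subset hL
  have h2 := card_sdiff_bars hK hL
  obtain ⟨i, j, hij, hS⟩ := Finset.card_eq_two.1 h2
  have hb : bars 0 L = Finset.Ico 1 K \ {i, j} := by
    rw [← hS, Finset.sdiff_sdiff_eq_self]
    simpa using h1
  have hi : i ∈ Finset.Ico 1 K \ bars 0 L := by rw [hS]; simp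
  have hj : j ∈ Finset.Ico 1 K \ bars 0 L := by rw [hS]; simp
  simp only [Finset.mem_sdiff, Finset.mem_Ico] at hi hj
  rcases Nat.lt_or_gt_of_ne hij with h | h
  · exact ⟨i, j, by omega, h, by omega, hb⟩
  · exact ⟨j, i, by omega, h, by omega, by rw [hb, Finset.pair_comm]⟩

lemma rk_Ico_sdiff {K t : ℕ} {S : Finset ℕ} (h1 : 1 ≤ t) (h2 : t < K) (hS : S ⊆ Finset.Ico 1 K) :
    rk (Finset.Ico 1 K \ S) t + (S.filter (· < t)).card + 1 = t := by
  have h3 : (Finset.Ico 1 K \ S).filter (· < t) = Finset.Ico 1 t \ S.filter (· < t) := by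
    ext s; simp; constructor
    · rintro ⟨⟨⟨a, b⟩, c⟩, d⟩
      exact ⟨⟨a, d⟩, fun h => absurd h c⟩
    · rintro ⟨⟨a, d⟩, h⟩
      exact ⟨⟨⟨a, by omega⟩, fun hs => by have := h hs; omega⟩, d⟩
  have h4 : S.filter (· < t) ⊆ Finset.Ico 1 t := by
    intro s hs
    simp only [Finset.mem_filter] at hs
    have := hS hs.1
    simp at this ⊢; omega
  have h5 := Finset.card_le_card h4
  rw [rk, h3, Finset.card_sdiff_of_subset h4]
  simp only [Nat.card_Ico] at h5 ⊢
  omega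

lemma sgn_pair_left {K i j : ℕ} (h1 : 1 ≤ i) (h2 : i < j) (h3 : j < K) :
    sgn (Finset.Ico 1 K \ {i, j}) i = - (-1) ^ i := by
  have := rk_Ico_sdiff (K := K) (t := i) (S := {i, j}) h1 (by omega) (by
    intro s; simp; omega)
  rw [Finset.filter_insert, if_neg (by omega), Finset.filter_singleton, if_neg (by omega)] at this
  obtain ⟨m, rfl⟩ : ∃ m, i = m + 1 := ⟨i - 1, by omega⟩
  rw [sgn, show rk (Finset.Ico 1 K \ {m + 1, j}) (m + 1) = m by simpa using this, pow_succ]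
  ring

lemma sgn_pair_right {K i j : ℕ} (h1 : 1 ≤ i) (h2 : i < j) (h3 : j < K) :
    sgn (Finset.Ico 1 K \ {i, j}) j = (-1) ^ j := by
  have := rk_Ico_sdiff (K := K) (t := j) (S := {i, j}) (by omega) (by omega) (by
    intro s; simp; omega)
  rw [Finset.filter_insert, if_pos (by omega), Finset.filter_singleton, if_neg (by omega)] at this
  obtain ⟨m, rfl⟩ : ∃ m, j = m + 2 := ⟨j - 2, by omega⟩
  rw [sgn, show rk (Finset.Ico 1 K \ {i, m + 2}) (m + 2) = m by simpa using this, pow_succ,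
      pow_succ]
  ring

lemma simplexD_pair {K i j : ℕ} (h1 : 1 ≤ i) (h2 : i < j) (h3 : j < K) (y : Finset ℕ → ℚ) :
    simplexD K y (Finset.Ico 1 K \ {i, j}) =
      - (-1) ^ i * y (Finset.Ico 1 K \ {j}) + (-1) ^ j * y (Finset.Ico 1 K \ {i}) := by
  have hS : Finset.Ico 1 K \ (Finset.Ico 1 K \ {i, j}) = {i, j} := by
    ext s; simp; omega
  rw [coboundary_apply, hS, Finset.sum_pair h2.ne, sgn_pair_left h1 h2 h3, sgn_pair_right h1 h2 h3]
  have e1 : insert i (Finset.Ico 1 K \ {i, j}) = Finset.Ico 1 K \ {j} := by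
    ext s; simp; omega
  have e2 : insert j (Finset.Ico 1 K \ {i, j}) = Finset.Ico 1 K \ {i} := by
    ext s; simp; omega
  rw [e1, e2]
  simp [zsmul_eq_mul]

lemma simplexD_triple {K i j l : ℕ} (h1 : 1 ≤ i) (h2 : i < j) (h3 : j < l) (h4 : l < K)
    (y : Finset ℕ → ℚ) :
    simplexD K y (Finset.Ico 1 K \ {i, j, l}) =
      - (-1) ^ i * y (Finset.Ico 1 K \ {j, l}) + (-1) ^ j * y (Finset.Ico 1 K \ {i, l}) -
        (-1) ^ l * y (Finset.Ico 1 K \ {i, j}) := by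
  have hsub : ({i, j, l} : Finset ℕ) ⊆ Finset.Ico 1 K := by
    intro s; simp; omega
  have hS : Finset.Ico 1 K \ (Finset.Ico 1 K \ {i, j, l}) = {i, j, l} := by
    rw [Finset.sdiff_sdiff_eq_self hsub]
  have s1 : sgn (Finset.Ico 1 K \ {i, j, l}) i = - (-1) ^ i := by
    have := rk_Ico_sdiff (K := K) (t := i) h1 (by omega) hsub
    rw [Finset.filter_insert, if_neg (by omega), Finset.filter_insert, if_neg (by omega),
      Finset.filter_singleton, if_neg (by omega)] at this
    obtain ⟨m, rfl⟩ : ∃ m, i = m + 1 := ⟨i - 1, by omega⟩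
    rw [sgn, show rk (Finset.Ico 1 K \ {m + 1, j, l}) (m + 1) = m by simpa using this, pow_succ]
    ring
  have s2 : sgn (Finset.Ico 1 K \ {i, j, l}) j = (-1) ^ j := by
    have := rk_Ico_sdiff (K := K) (t := j) (by omega) (by omega) hsub
    rw [Finset.filter_insert, if_pos (by omega), Finset.filter_insert, if_neg (by omega),
      Finset.filter_singleton, if_neg (by omega)] at this
    obtain ⟨m, rfl⟩ : ∃ m, j = m + 2 := ⟨j - 2, by omega⟩
    rw [sgn, show rk (Finset.Ico 1 K \ {i, m + 2, l}) (m + 2) = m by simpa using this, pow_succ,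
      pow_succ]
    ring
  have s3 : sgn (Finset.Ico 1 K \ {i, j, l}) l = - (-1) ^ l := by
    have := rk_Ico_sdiff (K := K) (t := l) (by omega) (by omega) hsub
    rw [Finset.filter_insert, if_pos (by omega), Finset.filter_insert, if_pos (by omega),
      Finset.filter_singleton, if_neg (by omega)] at this
    have hc : (insert i (insert j (∅ : Finset ℕ))).card = 2 := Finset.card_pair h2.ne
    rw [hc] at this
    obtain ⟨m, rfl⟩ : ∃ m, l = m + 3 := ⟨l - 3, by omega⟩
    rw [sgn, show rk (Finset.Ico 1 K \ {i, j, m + 3}) (m + 3) = m by omega, pow_succ,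
      pow_succ, pow_succ]
    ring
  rw [coboundary_apply, hS, Finset.sum_insert (by simp; omega), Finset.sum_pair h3.ne, s1, s2, s3]
  have e1 : insert i (Finset.Ico 1 K \ {i, j, l}) = Finset.Ico 1 K \ {j, l} := by
    ext s; simp; omega
  have e2 : insert j (Finset.Ico 1 K \ {i, j, l}) = Finset.Ico 1 K \ {i, l} := by
    ext s; simp; omega
  have e3 : insert l (Finset.Ico 1 K \ {i, j, l}) = Finset.Ico 1 K \ {i, j} := by
    ext s; simp; omega
  rw [e1, e2, e3]
  simp [zsmul_eq_mul]
  ring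

/-- A cycle is rationally a boundary: up to signs its rescaled coefficients are the differences
of the values of a function on the vertices. -/
lemma exists_potential {K : ℕ} {z : BarMod} (hz : z ∈ barCycles 1 K 0 K) :
    ∃ G : ℕ → ℚ, G 1 = 0 ∧ ∀ i j, 1 ≤ i → i < j → j < K →
      rescale z (Finset.Ico 1 K \ {i, j}) = (-1) ^ (i + j) * (G i - G j) := by
  have h0 : simplexD K (rescale z) = 0 := by
    rw [← rescale_barD hz.1, show barD z = 0 from hz.2, map_zero]
  have hsq : ∀ m : ℕ, ((-1 : ℚ) ^ m) * (-1) ^ m = 1 := by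
    intro m; rw [← mul_pow]; simp
  refine ⟨fun j => if j = 1 then 0 else (-1) ^ j * rescale z (Finset.Ico 1 K \ {1, j}), by simp, ?_⟩
  intro i j h1 h2 h3
  beta_reduce
  rcases Nat.lt_or_ge 1 i with hi | hi
  · have := congrFun h0 (Finset.Ico 1 K \ {1, i, j})
    rw [simplexD_triple le_rfl hi h2 h3] at this
    simp only [pow_one, neg_neg, one_mul, Pi.zero_apply] at this
    rw [if_neg (by omega), if_neg (by omega), pow_add, mul_sub]
    have e1 := hsq i
    have e2 := hsq j
    linear_combination this - (-1) ^ j * rescale z (Finset.Ico 1 K \ {1, i}) * e1 + (-1) ^ i *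
      rescale z (Finset.Ico 1 K \ {1, j}) * e2
  · obtain rfl : i = 1 := by omega
    rw [if_pos rfl, if_neg (by omega), pow_add]
    linear_combination - rescale z (Finset.Ico 1 K \ {1, j}) * hsq j

/-- A cycle is a boundary when its potential takes half-integral values. -/
lemma mem_barBoundaries {K : ℕ} (hK : 1 ≤ K) {z : BarMod} (hz : z ∈ barCycles 1 K 0 K) {G : ℕ → ℚ}
    (hG : ∀ i j, 1 ≤ i → i < j → j < K →
      rescale z (Finset.Ico 1 K \ {i, j}) = (-1) ^ (i + j) * (G i - G j))
    (h2 : ∀ j, 1 ≤ j → j < K → ∃ m : ℤ, 2 * G j = m) : z ∈ barBoundaries 1 K 0 K := by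
  choose! m hm using h2
  let u : BarMod := ∑ j ∈ Finset.Ico 1 K, Finsupp.single (listOne K j) ((-1) ^ j * m j)
  have hu : u ∈ barPart 1 K 0 K 1 := by
    refine sum_mem fun j hj => ?_
    rw [Finset.mem_Ico] at hj
    exact Finsupp.single_mem_supported ℤ _ (listOne_mem hj.1 hj.2)
  have hru : ∀ j, 1 ≤ j → j < K → rescale u (Finset.Ico 1 K \ {j}) = (-1) ^ j * G j := by
    intro j h1 h3
    rw [← bars_listOne h1 h3, rescale_apply hu (listOne_mem h1 h3), listFact_listOne]
    have : u (listOne K j) = (-1) ^ j * m j := by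
      rw [Finsupp.finsetSum_apply, Finset.sum_eq_single j]
      · simp
      · intro l hl hlj
        rw [Finset.mem_Ico] at hl
        rw [Finsupp.single_eq_of_ne]
        intro he
        have := congrArg (bars 0) he
        rw [bars_listOne h1 h3, bars_listOne hl.1 hl.2] at this
        have hj : j ∈ Finset.Ico 1 K \ {l} := by simp; omega
        rw [← this] at hj
        simp at hj
      · intro h; exact absurd (Finset.mem_Ico.2 ⟨h1, h3⟩) h
    rw [this]
    push_cast
    rw [← hm j h1 h3]; ring
  refine ⟨u, hu, eq_of_rescale (barD_mem hu) hz.1 ?_⟩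
  intro L hL
  obtain ⟨i, j, h1, h3, h4, hb⟩ := exists_pair hK hL
  rw [hb, rescale_barD hu, simplexD_pair h1 h3 h4, hru i h1 (by omega), hru j (by omega) h4,
    hG i j h1 h3 h4, pow_add]
  ring

lemma rescale_adj {K i : ℕ} {z : BarMod} (hz : z ∈ barCycles 1 K 0 K) (h1 : 1 ≤ i)
    (h2 : i + 1 < K) : 6 * rescale z (Finset.Ico 1 K \ {i, i + 1}) = z (listAdj K i) := by
  rw [← bars_listAdj h1 h2, rescale_apply hz.1 (listAdj_mem h1 h2), listFact_listAdj]
  push_cast; ring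

lemma rescale_two {K i j : ℕ} {z : BarMod} (hz : z ∈ barCycles 1 K 0 K) (h1 : 1 ≤ i)
    (h2 : i + 2 ≤ j) (h3 : j < K) :
    4 * rescale z (Finset.Ico 1 K \ {i, j}) = z (listTwo K i j) := by
  rw [← bars_listTwo h1 h2 h3, rescale_apply hz.1 (listTwo_mem h1 h2 h3), listFact_listTwo]
  push_cast; ring

lemma int_of_sign_mul {e : ℕ} {x : ℚ} {m : ℤ} (h : (-1) ^ e * x = m) : ∃ m' : ℤ, x = m' := by
  rcases neg_one_pow_eq_or ℚ e with he | he <;> rw [he] at h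
  · exact ⟨m, by linarith⟩
  · exact ⟨-m, by push_cast; linarith⟩

section potential

variable {K : ℕ} {z : BarMod} {G : ℕ → ℚ} (hz : z ∈ barCycles 1 K 0 K)
  (hG : ∀ i j, 1 ≤ i → i < j → j < K →
    rescale z (Finset.Ico 1 K \ {i, j}) = (-1) ^ (i + j) * (G i - G j)) (hG1 : G 1 = 0)
include hz hG

lemma potential_adj {i : ℕ} (h1 : 1 ≤ i) (h2 : i + 1 < K) : ∃ m : ℤ, 6 * (G i - G (i + 1)) = m := by
  have := rescale_adj hz h1 h2
  rw [hG i (i + 1) h1 (by omega) h2] at this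
  exact int_of_sign_mul (e := i + (i + 1)) (by rw [← this]; ring)

lemma potential_two {i j : ℕ} (h1 : 1 ≤ i) (h2 : i + 2 ≤ j) (h3 : j < K) :
    ∃ m : ℤ, 4 * (G i - G j) = m := by
  have := rescale_two hz h1 h2 h3
  rw [hG i j h1 (by omega) h3] at this
  exact int_of_sign_mul (e := i + j) (by rw [← this]; ring)

lemma potential_six {i j : ℕ} (h1 : 1 ≤ i) (h2 : i ≤ j) (h3 : j < K) :
    ∃ m : ℤ, 6 * (G i - G j) = m := by
  induction j, h2 using Nat.le_induction with
  | base => exact ⟨0, by simp⟩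
  | succ j hj ih =>
    obtain ⟨m, hm⟩ := ih (by omega)
    obtain ⟨m', hm'⟩ := potential_adj hz hG (i := j) (by omega) h3
    exact ⟨m + m', by push_cast; rw [← hm, ← hm']; ring⟩

/-- Differences of the potential at vertices that are not neighbours are half-integral, since
`1/4 ℤ ∩ 1/6 ℤ = 1/2 ℤ`. -/
lemma potential_half {i j : ℕ} (h1 : 1 ≤ i) (h2 : i + 2 ≤ j) (h3 : j < K) :
    ∃ m : ℤ, 2 * (G i - G j) = m := by
  obtain ⟨m, hm⟩ := potential_two hz hG h1 h2 h3
  obtain ⟨m', hm'⟩ := potential_six hz hG h1 (by omega : i ≤ j) h3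
  exact ⟨m' - m, by push_cast; rw [← hm, ← hm']; ring⟩

include hG1

lemma mem_barBoundaries_of_two (hK : 1 ≤ K) (h2 : 2 < K → ∃ m : ℤ, 2 * G 2 = m) :
    z ∈ barBoundaries 1 K 0 K := by
  refine mem_barBoundaries hK hz hG fun j h1 h3 => ?_
  rcases (by omega : j = 1 ∨ j = 2 ∨ 3 ≤ j) with rfl | rfl | h
  · exact ⟨0, by simp [hG1]⟩
  · exact h2 h3
  · obtain ⟨m, hm⟩ := potential_half hz hG le_rfl (by omega : 1 + 2 ≤ j) h3
    refine ⟨-m, ?_⟩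
    push_cast
    rw [← hm, hG1]; ring

end potential

/-- For `K ≠ 3, 4` every cycle is a boundary: no two neighbouring vertices exist, or any two
vertices are connected by a path whose consecutive vertices are not neighbours. -/
theorem bar_divided_subsingleton {K : ℕ} (hK : 1 ≤ K) (h3 : K ≠ 3) (h4 : K ≠ 4) :
    Subsingleton (SubQuot (barCycles 1 K 0 K) (barBoundaries 1 K 0 K)) := by
  rw [Submodule.Quotient.subsingleton_iff, Submodule.submoduleOf_eq_top]
  intro z hz
  obtain ⟨G, hG1, hG⟩ := exists_potential hz
  refine mem_barBoundaries_of_two hz hG hG1 hK fun h => ?_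
  obtain ⟨m, hm⟩ := potential_half hz hG le_rfl (by omega : 1 + 2 ≤ 4) (by omega)
  obtain ⟨m', hm'⟩ := potential_half hz hG (by omega : 1 ≤ 2) (by omega : 2 + 2 ≤ 4) (by omega)
  refine ⟨m' - m, ?_⟩
  push_cast
  rw [← hm, ← hm', hG1]; ring

lemma listAdj_mem_barBoundaries_iff {K : ℕ} (h3 : 3 ≤ K) {z : BarMod}
    (hz : z ∈ barCycles 1 K 0 K) : z ∈ barBoundaries 1 K 0 K ↔ (3 : ℤ) ∣ z (listAdj K 1) := by
  have hadj := rescale_adj hz le_rfl (by omega : 1 + 1 < K)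
  constructor
  · rintro ⟨u, hu, rfl⟩
    rw [rescale_barD hu, simplexD_pair le_rfl (by omega) (by omega),
      ← bars_listOne (by omega) (by omega : 1 + 1 < K),
      ← bars_listOne (by omega) (by omega : 1 < K),
      rescale_apply hu (listOne_mem (by omega) (by omega)),
      rescale_apply hu (listOne_mem (by omega) (by omega)), listFact_listOne,
          listFact_listOne] at hadj
    refine ⟨u (listOne K (1 + 1)) + u (listOne K 1), ?_⟩
    have : ((barD u (listAdj K 1) : ℤ) : ℚ) =
        ((3 * (u (listOne K (1 + 1)) + u (listOne K 1)) : ℤ) : ℚ) := by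
      rw [← hadj]; push_cast; ring
    exact_mod_cast this
  · rintro ⟨m, hm⟩
    obtain ⟨G, hG1, hG⟩ := exists_potential hz
    refine mem_barBoundaries_of_two hz hG hG1 (by omega) fun h => ?_
    refine ⟨m, ?_⟩
    rw [hG 1 (1 + 1) le_rfl (by omega) (by omega), hm, hG1] at hadj
    push_cast at hadj
    norm_num at hadj
    linarith

/-- For `K = 3, 4` the coefficient of `x^{(3)}` in the first place detects the homology. -/
theorem bar_divided_zmod {K : ℕ} (h : K = 3 ∨ K = 4) :
    Nonempty (SubQuot (barCycles 1 K 0 K) (barBoundaries 1 K 0 K) ≃+ ZMod 3) := by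
  have h3 : 3 ≤ K := by omega
  let f : barCycles 1 K 0 K →ₗ[ℤ] ZMod 3 :=
    (Int.castAddHom (ZMod 3)).toIntLinearMap ∘ₗ Finsupp.lapply (listAdj K 1) ∘ₗ
      (barCycles 1 K 0 K).subtype
  have hf : ∀ z, f z = ((z.1 (listAdj K 1) : ℤ) : ZMod 3) := fun z => rfl
  have hker : (barBoundaries 1 K 0 K).submoduleOf (barCycles 1 K 0 K) = LinearMap.ker f := by
    ext z
    rw [LinearMap.mem_ker, hf, ZMod.intCast_zmod_eq_zero_iff_dvd]
    exact listAdj_mem_barBoundaries_iff h3 z.2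
  have hone : ∃ z ∈ barCycles 1 K 0 K, z (listAdj K 1) = 1 := by
    rcases h with rfl | rfl
    · refine ⟨Finsupp.single (listAdj 3 1) 1,
        ⟨Finsupp.single_mem_supported ℤ _ (listAdj_mem le_rfl (by omega)), ?_⟩, by simp⟩
      change barD _ = 0
      rw [barD_single]
      simp [listAdj, ones, barList, mulList]
    · refine ⟨Finsupp.single (listAdj 4 1) 1 - Finsupp.single (listAdj 4 2) 1,
        ⟨sub_mem (Finsupp.single_mem_supported ℤ _ (listAdj_mem le_rfl (by omega)))
          (Finsupp.single_mem_supported ℤ _ (listAdj_mem (by omega) (by omega))), ?_⟩, ?_⟩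
      · change barD _ = 0
        rw [map_sub, barD_single, barD_single]
        simp [listAdj, ones, barList, mulList, Nat.choose]
      · rw [Finsupp.sub_apply, Finsupp.single_eq_same, Finsupp.single_eq_of_ne, sub_zero]
        simp [listAdj, ones]
  have hsurj : Function.Surjective f := by
    obtain ⟨z, hz, hz1⟩ := hone
    intro c
    refine ⟨(c.val : ℤ) • ⟨z, hz⟩, ?_⟩
    rw [map_smul, hf, hz1]
    simp
  exact ⟨((Submodule.quotEquivOfEq _ _ hker).trans
    (LinearMap.quotKerEquivOfSurjective f hsurj)).toAddEquiv⟩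

/-! ### Tensor space and the Schur algebra in terms of words -/

section words

variable {n r : ℕ}

/-- Words of length `r` in `n` letters; they index the standard basis of tensor space. -/
abbrev TWord (n r : ℕ) : Type := Fin r → Fin n

/-- The standard basis of tensor space. -/
def wordBasis (n r : ℕ) : Module.Basis (TWord n r) ℤ (TensorSpace n r) :=
  Basis.piTensorProduct fun _ => Pi.basisFun ℤ (Fin n)

/-- The coefficient of a tensor at a word. -/
def co (x : TensorSpace n r) (w : TWord n r) : ℤ := (wordBasis n r).repr x w

lemma wordBasis_apply (w : TWord n r) :
    wordBasis n r w = PiTensorProduct.tprod ℤ fun i => (Pi.single (w i) 1 : NatMod n) := by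
  simp [wordBasis]

@[simp] lemma co_sub (x y : TensorSpace n r) (w : TWord n r) : co (x - y) w = co x w - co y w := by
  simp [co]

@[simp] lemma co_zero (w : TWord n r) : co (0 : TensorSpace n r) w = 0 := by
  simp [co]

@[simp] lemma co_smul (c : ℤ) (x : TensorSpace n r) (w : TWord n r) :
    co (c • x) w = c * co x w := by
  rw [co, map_smul, Finsupp.smul_apply, smul_eq_mul, co]

@[simp] lemma co_sum {ι : Type*} (s : Finset ι) (f : ι → TensorSpace n r) (w : TWord n r) :
    co (∑ i ∈ s, f i) w = ∑ i ∈ s, co (f i) w := by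
  simp [co]

lemma co_wordBasis (v w : TWord n r) : co (wordBasis n r v) w = if v = w then 1 else 0 := by
  rw [co, Module.Basis.repr_self, Finsupp.single_apply]

lemma co_ext {x y : TensorSpace n r} (h : ∀ w, co x w = co y w) : x = y :=
  (wordBasis n r).ext_elem h

lemma sum_co (x : TensorSpace n r) : ∑ w, co x w • wordBasis n r w = x :=
  (wordBasis n r).sum_repr x

lemma placePerm_wordBasis (σ : Equiv.Perm (Fin r)) (w : TWord n r) :
    placePerm n σ (wordBasis n r w) = wordBasis n r (w ∘ σ.symm) := by
  rw [wordBasis_apply, wordBasis_apply, placePerm, LinearEquiv.coe_coe]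
  exact PiTensorProduct.reindex_tprod σ _

lemma co_placePerm (σ : Equiv.Perm (Fin r)) (x : TensorSpace n r) (w : TWord n r) :
    co (placePerm n σ x) w = co x (w ∘ σ) := by
  conv_lhs => rw [← sum_co x]
  rw [map_sum, co_sum]
  simp only [map_smul, placePerm_wordBasis, co_smul, co_wordBasis]
  rw [Finset.sum_eq_single (w ∘ σ)]
  · rw [if_pos, mul_one]
    ext i; simp
  · intro v _ hv
    rw [if_neg, mul_zero]
    rintro rfl
    apply hv; ext i; simp
  · simp

lemma placePerm_mul (σ τ : Equiv.Perm (Fin r)) (x : TensorSpace n r) :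
    placePerm n (σ * τ) x = placePerm n σ (placePerm n τ x) := by
  apply co_ext; intro w
  rw [co_placePerm, co_placePerm, co_placePerm]; rfl

lemma placePerm_one (x : TensorSpace n r) : placePerm n (1 : Equiv.Perm (Fin r)) x = x := by
  apply co_ext; intro w
  rw [co_placePerm]; rfl

/-- An endomorphism commuting with place permutations, as an element of the Schur algebra. -/
def mkSchur (f : Module.End ℤ (TensorSpace n r))
    (hf : ∀ σ x, f (placePerm n σ x) = placePerm n σ (f x)) : schurAlgebra n r :=
  ⟨f, by
    rw [schurAlgebra, Subalgebra.mem_centralizer_iff]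
    rintro _ ⟨σ, rfl⟩
    exact LinearMap.ext fun x => (hf σ x).symm⟩

lemma mkSchur_smul (f : Module.End ℤ (TensorSpace n r))
    (hf : ∀ σ x, f (placePerm n σ x) = placePerm n σ (f x)) (x : TensorSpace n r) :
    mkSchur f hf • x = f x := rfl

lemma placePerm_smul (σ : Equiv.Perm (Fin r)) (c : schurAlgebra n r) (x : TensorSpace n r) :
    placePerm n σ (c • x) = c • placePerm n σ x := by
  have h := (Subalgebra.mem_centralizer_iff ℤ).1 c.2 (placePerm n σ) ⟨σ, rfl⟩
  exact LinearMap.congr_fun h x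

lemma placePerm_zsmul (σ : Equiv.Perm (Fin r)) (c : ℤ) (x : TensorSpace n r) :
    placePerm n σ (c • x) = c • placePerm n σ x := map_smul _ _ _

lemma schur_ext {c c' : schurAlgebra n r}
    (h : ∀ w, c • wordBasis n r w = c' • wordBasis n r w) : c = c' :=
  Subtype.ext ((wordBasis n r).ext h)

/-- The tensors fixed by all place permutations that preserve the colouring `κ` of the places. -/
def invariants (n : ℕ) {r : ℕ} (κ : Fin r → ℕ) :
    Submodule (schurAlgebra n r) (TensorSpace n r) where
  carrier := {x | ∀ σ : Equiv.Perm (Fin r), κ ∘ σ = κ → placePerm n σ x = x}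
  add_mem' := by
    intro x y hx hy σ hσ
    rw [map_add, hx σ hσ, hy σ hσ]
  zero_mem' := fun σ _ => map_zero _
  smul_mem' := by
    intro c x hx σ hσ
    rw [placePerm_smul, hx σ hσ]

lemma mem_invariants {κ : Fin r → ℕ} {x : TensorSpace n r} :
    x ∈ invariants n κ ↔ ∀ σ : Equiv.Perm (Fin r), κ ∘ σ = κ → placePerm n σ x = x := Iff.rfl

lemma mem_invariants_iff_co {κ : Fin r → ℕ} {x : TensorSpace n r} :
    x ∈ invariants n κ ↔ ∀ σ : Equiv.Perm (Fin r), κ ∘ σ = κ → ∀ w, co x (w ∘ σ) = co x w := by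
  rw [mem_invariants]
  refine forall_congr' fun σ => imp_congr_right fun _ => ⟨fun h w => ?_, fun h => ?_⟩
  · rw [← co_placePerm, h]
  · apply co_ext; intro w; rw [co_placePerm, h]

/-- Two words are related if they differ by a place permutation preserving the colouring `κ`. -/
def Rel (κ : Fin r → ℕ) (v u : TWord n r) : Prop :=
  ∃ σ : Equiv.Perm (Fin r), κ ∘ σ = κ ∧ u = v ∘ σ

lemma Rel.refl (κ : Fin r → ℕ) (v : TWord n r) : Rel κ v v := ⟨1, rfl, rfl⟩

lemma Rel.symm {κ : Fin r → ℕ} {v u : TWord n r} (h : Rel κ v u) : Rel κ u v := by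
  obtain ⟨σ, hσ, rfl⟩ := h
  refine ⟨σ⁻¹, ?_, ?_⟩
  · conv_lhs => rw [← hσ]
    ext i; simp
  · ext i; simp

lemma Rel.trans {κ : Fin r → ℕ} {v u t : TWord n r} (h : Rel κ v u) (h' : Rel κ u t) :
    Rel κ v t := by
  obtain ⟨σ, hσ, rfl⟩ := h
  obtain ⟨τ, hτ, rfl⟩ := h'
  refine ⟨σ * τ, ?_, rfl⟩
  rw [Equiv.Perm.coe_mul, ← Function.comp_assoc, hσ, hτ]

lemma co_eq_of_rel {κ : Fin r → ℕ} {x : TensorSpace n r} (hx : x ∈ invariants n κ)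
    {v u : TWord n r} (h : Rel κ v u) : co x u = co x v := by
  obtain ⟨σ, hσ, rfl⟩ := h
  exact mem_invariants_iff_co.1 hx σ hσ v

open Classical in
/-- The sum of all words related to `v`. -/
def orb (κ : Fin r → ℕ) (v : TWord n r) : TensorSpace n r :=
  ∑ u with Rel κ v u, wordBasis n r u

open Classical in
lemma co_orb (κ : Fin r → ℕ) (v u : TWord n r) :
    co (orb κ v) u = if Rel κ v u then 1 else 0 := by
  rw [orb, co_sum]
  simp only [co_wordBasis]
  rw [Finset.sum_ite_eq']
  simp

lemma orb_mem (κ : Fin r → ℕ) (v : TWord n r) : orb κ v ∈ invariants n κ := by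
  classical
  rw [mem_invariants_iff_co]
  intro σ hσ w
  rw [co_orb, co_orb]
  have h : Rel κ w (w ∘ σ) := ⟨σ, hσ, rfl⟩
  have : Rel κ v (w ∘ σ) ↔ Rel κ v w := ⟨fun h' => h'.trans h.symm, fun h' => h'.trans h⟩
  simp only [this]

lemma orb_eq_of_rel {κ : Fin r → ℕ} {v u : TWord n r} (h : Rel κ v u) : orb κ u = orb κ v := by
  classical
  apply co_ext; intro w
  rw [co_orb, co_orb]
  have : Rel κ u w ↔ Rel κ v w := ⟨fun h' => h.trans h', fun h' => h.symm.trans h'⟩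
  simp only [this]

lemma mem_span_orb {κ : Fin r → ℕ} {x : TensorSpace n r} (hx : x ∈ invariants n κ) :
    x ∈ Submodule.span ℤ (orb κ '' {v | co x v ≠ 0}) := by
  classical
  induction hm : (Finset.univ.filter fun v => co x v ≠ 0).card using Nat.strong_induction_on
    generalizing x with
  | _ m ih =>
    by_cases h0 : x = 0
    · rw [h0]; exact zero_mem _
    obtain ⟨v, hv⟩ : ∃ v, co x v ≠ 0 := by
      by_contra! h
      exact h0 (co_ext fun w => by rw [h, co_zero])
    have hx' : x - co x v • orb κ v ∈ invariants n κ := by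
      rw [mem_invariants]
      intro σ hσ
      rw [map_sub, placePerm_zsmul, mem_invariants.1 hx σ hσ,
        mem_invariants.1 (orb_mem κ v) σ hσ]
    have hco : ∀ u, co (x - co x v • orb κ v) u = if Rel κ v u then 0 else co x u := by
      intro u
      rw [co_sub, co_smul, co_orb]
      split_ifs with h
      · rw [co_eq_of_rel hx h]; ring
      · ring
    have hsub : ∀ u, co (x - co x v • orb κ v) u ≠ 0 → co x u ≠ 0 := by
      intro u hu
      rw [hco] at hu
      split_ifs at hu with h
      · exact absurd rfl hu
      · exact hu
    have key := ih _ ?_ hx' rfl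
    · have h1 : x - co x v • orb κ v ∈ Submodule.span ℤ (orb κ '' {v | co x v ≠ 0}) :=
        Submodule.span_mono (Set.image_mono hsub) key
      have h2 : co x v • orb κ v ∈ Submodule.span ℤ (orb κ '' {v | co x v ≠ 0}) :=
        Submodule.smul_mem _ _ (Submodule.subset_span ⟨v, hv, rfl⟩)
      simpa using add_mem h1 h2
    · rw [← hm]
      apply Finset.card_lt_card
      rw [Finset.ssubset_iff_of_subset]
      · refine ⟨v, by simpa using hv, ?_⟩
        rw [Finset.mem_filter, hco, if_pos (Rel.refl κ v)]
        simp
      · intro u hu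
        simp only [Finset.mem_filter, Finset.mem_univ, true_and] at hu ⊢
        exact hsub u hu

lemma exists_perm_of_card_fiber {α β : Type*} [Fintype α] [DecidableEq β] (f g : α → β)
    (h : ∀ c, (Finset.univ.filter fun i => f i = c).card =
      (Finset.univ.filter fun i => g i = c).card) : ∃ σ : Equiv.Perm α, g = f ∘ σ := by
  have h' : ∀ c, Nonempty ({i // g i = c} ≃ {i // f i = c}) := by
    intro c
    rw [← Fintype.card_eq, Fintype.card_subtype, Fintype.card_subtype, h]
  let e : ∀ c, {i // g i = c} ≃ {i // f i = c} := fun c => (h' c).some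
  refine ⟨((Equiv.sigmaFiberEquiv g).symm.trans (Equiv.sigmaCongrRight e)).trans
    (Equiv.sigmaFiberEquiv f), ?_⟩
  ext1 i
  exact ((e (g i)) ⟨i, rfl⟩).2.symm

/-- Words are related if they have the same number of occurrences of each letter in each colour. -/
lemma rel_of_card {κ : Fin r → ℕ} {v u : TWord n r}
    (h : ∀ c t, (Finset.univ.filter fun i => κ i = c ∧ v i = t).card =
      (Finset.univ.filter fun i => κ i = c ∧ u i = t).card) : Rel κ v u := by
  obtain ⟨σ, hσ⟩ := exists_perm_of_card_fiber (fun i => (κ i, v i)) (fun i => (κ i, u i)) (by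
    rintro ⟨c, t⟩
    simpa only [Prod.mk.injEq] using h c t)
  refine ⟨σ, ?_, ?_⟩
  · ext1 i; exact (congrArg Prod.fst (congrFun hσ i)).symm
  · ext1 i; exact congrArg Prod.snd (congrFun hσ i)

lemma Rel.card_eq {κ : Fin r → ℕ} {v u : TWord n r} (h : Rel κ v u) (c : ℕ) (t : Fin n) :
    (Finset.univ.filter fun i => κ i = c ∧ v i = t).card =
      (Finset.univ.filter fun i => κ i = c ∧ u i = t).card := by
  obtain ⟨σ, hσ, rfl⟩ := h
  symm
  refine Finset.card_bij (fun i _ => σ i) ?_ ?_ ?_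
  · intro i hi
    simp only [Finset.mem_filter, Finset.mem_univ, true_and, Function.comp] at hi ⊢
    exact ⟨(congrFun hσ i).trans hi.1, hi.2⟩
  · intro i _ j _ hij; exact σ.injective hij
  · intro j hj
    simp only [Finset.mem_filter, Finset.mem_univ, true_and, Function.comp] at hj ⊢
    refine ⟨σ.symm j, ⟨?_, by simpa using hj.2⟩, by simp⟩
    rw [← hj.1, ← congrFun hσ (σ.symm j)]; simp

/-! ### Endomorphisms of tensor space attached to invariants -/

/-- The colouring of the places by the letters of a word. -/
def wordCol (w : TWord n r) : Fin r → ℕ := fun i => w i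

lemma wordCol_comp_iff {w : TWord n r} {σ : Equiv.Perm (Fin r)} :
    wordCol w ∘ σ = wordCol w ↔ w ∘ σ = w := by
  constructor
  · intro h; ext i; exact congrFun h i
  · intro h; ext i; exact congrArg Fin.val (congrFun h i)

lemma wordBasis_mem_invariants (π : Fin n → Fin n) (w : TWord n r) :
    wordBasis n r (π ∘ w) ∈ invariants n (wordCol w) := by
  intro σ hσ
  rw [placePerm_wordBasis]
  rw [wordCol_comp_iff] at hσ
  congr 1
  conv_lhs => rw [← hσ]
  ext i; simp

open Classical in
/-- For `x` invariant under the stabilizer of the word `w`, the endomorphism of tensor space that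
sends `w` to `x`, commutes with place permutations and kills the words that are not permutations
of `w`. -/
def transferFun (w : TWord n r) (x : TensorSpace n r) : Module.End ℤ (TensorSpace n r) :=
  (wordBasis n r).constr ℤ fun u =>
    if h : ∃ σ : Equiv.Perm (Fin r), u = w ∘ σ then placePerm n h.choose.symm x else 0

lemma transferFun_of_not {w u : TWord n r} (h : ¬ ∃ σ : Equiv.Perm (Fin r), u = w ∘ σ)
    (x : TensorSpace n r) : transferFun w x (wordBasis n r u) = 0 := by
  rw [transferFun, Module.Basis.constr_basis, dif_neg h]

lemma transferFun_apply {w : TWord n r} {x : TensorSpace n r} (hx : x ∈ invariants n (wordCol w))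
    (σ : Equiv.Perm (Fin r)) :
    transferFun w x (wordBasis n r (w ∘ σ)) = placePerm n σ.symm x := by
  have h : ∃ τ : Equiv.Perm (Fin r), w ∘ σ = w ∘ τ := ⟨σ, rfl⟩
  rw [transferFun, Module.Basis.constr_basis, dif_pos h]
  have h' := h.choose_spec
  set τ := h.choose
  have h1 : wordCol w ∘ (σ * τ⁻¹ : Equiv.Perm (Fin r)) = wordCol w := by
    rw [wordCol_comp_iff, Equiv.Perm.coe_mul, ← Function.comp_assoc, h']
    ext i; simp
  conv_rhs => rw [← hx _ h1, ← placePerm_mul]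
  have : τ⁻¹ = σ⁻¹ * (σ * τ⁻¹) := by group
  exact congrArg (fun ρ => placePerm n ρ x) this

lemma transferFun_comm {w : TWord n r} {x : TensorSpace n r} (hx : x ∈ invariants n (wordCol w))
    (σ : Equiv.Perm (Fin r)) (y : TensorSpace n r) :
    transferFun w x (placePerm n σ y) = placePerm n σ (transferFun w x y) := by
  suffices transferFun w x ∘ₗ placePerm n σ = placePerm n σ ∘ₗ transferFun w x from
    LinearMap.congr_fun this y
  refine (wordBasis n r).ext fun u => ?_
  rw [LinearMap.comp_apply, LinearMap.comp_apply, placePerm_wordBasis]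
  by_cases h : ∃ τ : Equiv.Perm (Fin r), u = w ∘ τ
  · obtain ⟨τ, rfl⟩ := h
    rw [transferFun_apply hx, Function.comp_assoc]
    have := transferFun_apply hx (τ * σ.symm)
    rw [Equiv.Perm.coe_mul] at this
    rw [this, ← placePerm_mul]
    rfl
  · rw [transferFun_of_not h, transferFun_of_not, map_zero]
    rintro ⟨τ, hτ⟩
    apply h
    refine ⟨τ * σ, ?_⟩
    rw [Equiv.Perm.coe_mul, ← Function.comp_assoc, ← hτ]
    ext i; simp

/-- The endomorphisms `transferFun` as a linear map to the Schur algebra. -/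
def transfer (w : TWord n r) : invariants n (wordCol w) →ₗ[schurAlgebra n r] schurAlgebra n r where
  toFun x := mkSchur (transferFun w x) (transferFun_comm x.2)
  map_add' x y := by
    apply schur_ext; intro u
    rw [add_smul, mkSchur_smul, mkSchur_smul, mkSchur_smul]
    by_cases h : ∃ τ : Equiv.Perm (Fin r), u = w ∘ τ
    · obtain ⟨τ, rfl⟩ := h
      rw [transferFun_apply x.2, transferFun_apply y.2, transferFun_apply (x + y).2,
        Submodule.coe_add, map_add]
    · rw [transferFun_of_not h, transferFun_of_not h, transferFun_of_not h, add_zero]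
  map_smul' c x := by
    apply schur_ext; intro u
    rw [RingHom.id_apply, smul_eq_mul, mul_smul, mkSchur_smul, mkSchur_smul]
    by_cases h : ∃ τ : Equiv.Perm (Fin r), u = w ∘ τ
    · obtain ⟨τ, rfl⟩ := h
      rw [transferFun_apply x.2, transferFun_apply (c • x).2, Submodule.coe_smul, placePerm_smul]
    · rw [transferFun_of_not h, transferFun_of_not h, smul_zero]

lemma transfer_smul_comp {w : TWord n r} (x : invariants n (wordCol w)) (σ : Equiv.Perm (Fin r)) :
    transfer w x • wordBasis n r (w ∘ σ) = placePerm n σ.symm x := transferFun_apply x.2 σ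

lemma transfer_smul_self {w : TWord n r} (x : invariants n (wordCol w)) :
    transfer w x • wordBasis n r w = x := by
  have := transfer_smul_comp x 1
  rw [show (1 : Equiv.Perm (Fin r)).symm = 1 from rfl, placePerm_one] at this
  exact this

lemma transfer_smul_of_not {w u : TWord n r} (h : ¬ ∃ σ : Equiv.Perm (Fin r), u = w ∘ σ)
    (x : invariants n (wordCol w)) : transfer w x • wordBasis n r u = 0 :=
  transferFun_of_not h x

/-- The word `w` as an element of the module of invariants of its stabilizer. -/
def wordGen (w : TWord n r) : invariants n (wordCol w) :=
  ⟨wordBasis n r w, wordBasis_mem_invariants id w⟩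

/-- The projection of tensor space to the span of the permutations of the word `w`. -/
def weightIdem (w : TWord n r) : schurAlgebra n r := transfer w (wordGen w)

open Classical in
lemma weightIdem_wordBasis (w u : TWord n r) : weightIdem w • wordBasis n r u =
    if ∃ σ : Equiv.Perm (Fin r), u = w ∘ σ then wordBasis n r u else 0 := by
  split_ifs with h
  · obtain ⟨σ, rfl⟩ := h
    rw [weightIdem, transfer_smul_comp]
    exact placePerm_wordBasis σ.symm w
  · exact transfer_smul_of_not h _

open Classical in
lemma co_weightIdem (w u : TWord n r) (x : TensorSpace n r) : co (weightIdem w • x) u =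
    if ∃ σ : Equiv.Perm (Fin r), u = w ∘ σ then co x u else 0 := by
  conv_lhs => rw [← sum_co x]
  rw [Finset.smul_sum, co_sum]
  simp only [smul_comm (weightIdem w) _ (wordBasis n r _), weightIdem_wordBasis, co_smul]
  rw [Finset.sum_eq_single u]
  · split_ifs <;> simp [co_wordBasis]
  · intro v _ hv
    split_ifs <;> simp [co_wordBasis, hv]
  · simp

/-- The element of the Schur algebra induced by the endomorphism of the natural module that
permutes or identifies the basis vectors according to `π`. -/
def subst (r : ℕ) (π : Fin n → Fin n) : schurAlgebra n r :=
  mkSchur ((wordBasis n r).constr ℤ fun w => wordBasis n r (π ∘ w)) (by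
    intro σ y
    suffices ((wordBasis n r).constr ℤ fun w => wordBasis n r (π ∘ w)) ∘ₗ placePerm n σ =
        placePerm n σ ∘ₗ (wordBasis n r).constr ℤ fun w => wordBasis n r (π ∘ w) from
      LinearMap.congr_fun this y
    refine (wordBasis n r).ext fun u => ?_
    simp only [LinearMap.comp_apply, placePerm_wordBasis, Module.Basis.constr_basis]
    rfl)

lemma subst_wordBasis (π : Fin n → Fin n) (w : TWord n r) :
    subst r π • wordBasis n r w = wordBasis n r (π ∘ w) := by
  rw [subst, mkSchur_smul, Module.Basis.constr_basis]

lemma transfer_subst (π : Fin n → Fin n) (w : TWord n r) :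
    transfer w ⟨wordBasis n r (π ∘ w), wordBasis_mem_invariants π w⟩ =
      subst r π * weightIdem w := by
  classical
  apply schur_ext; intro u
  rw [mul_smul, weightIdem_wordBasis]
  split_ifs with h
  · obtain ⟨σ, rfl⟩ := h
    rw [transfer_smul_comp, subst_wordBasis]
    exact placePerm_wordBasis σ.symm (π ∘ w)
  · rw [transfer_smul_of_not h, smul_zero]

end words

/-! ### The boundary operator on families indexed by sets of bars -/

section boundary

lemma sgn_mul_self (B : Finset ℕ) (t : ℕ) : sgn B t * sgn B t = 1 := by
  rw [sgn, ← mul_pow]; simp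

lemma sgn_insert_of_lt {B : Finset ℕ} {t t0 : ℕ} (h0 : t0 ∉ B) (h : t0 < t) :
    sgn (insert t0 B) t = - sgn B t := by
  rw [sgn, sgn, rk_insert_of_lt h0 h, pow_succ]; ring

lemma sgn_insert_of_ge {B : Finset ℕ} {t t0 : ℕ} (h : t ≤ t0) :
    sgn (insert t0 B) t = sgn B t := by
  rw [sgn, sgn, rk_insert_of_ge h]

lemma sgn_erase_of_lt {B : Finset ℕ} {t t0 : ℕ} (h0 : t0 ∈ B) (h : t0 < t) :
    sgn (B.erase t0) t = - sgn B t := by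
  conv_rhs => rw [← Finset.insert_erase h0, sgn_insert_of_lt (Finset.notMem_erase _ _) h]
  ring

lemma sgn_erase_of_ge {B : Finset ℕ} {t t0 : ℕ} (h : t ≤ t0) :
    sgn (B.erase t0) t = sgn B t := by
  by_cases h0 : t0 ∈ B
  · conv_rhs => rw [← Finset.insert_erase h0, sgn_insert_of_ge h]
  · rw [Finset.erase_eq_of_notMem h0]

/-- The boundary operator removing elements of `I` from the argument of a family. -/
def bdry (R : Type*) [Ring R] {N : Type*} [AddCommGroup N] [Module R N] (I : Finset ℕ) :
    (Finset ℕ → N) →ₗ[R] (Finset ℕ → N) where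
  toFun x B := ∑ t ∈ B ∩ I, sgn B t • x (B.erase t)
  map_add' x y := by ext B; simp [Finset.sum_add_distrib]
  map_smul' c x := by
    ext B
    simp only [Pi.smul_apply, Finset.smul_sum, RingHom.id_apply]
    exact Finset.sum_congr rfl fun t _ => smul_comm _ _ _

lemma bdry_apply {R : Type*} [Ring R] {N : Type*} [AddCommGroup N] [Module R N] (I : Finset ℕ)
    (x : Finset ℕ → N) (B : Finset ℕ) :
    bdry R I x B = ∑ t ∈ B ∩ I, sgn B t • x (B.erase t) := rfl

lemma bdry_bdry (I : Finset ℕ) (c : Finset ℕ → ℤ) : bdry ℤ I (bdry ℤ I c) = 0 := by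
  ext B
  rw [bdry_apply, Pi.zero_apply]
  have h1 : ∀ t ∈ B ∩ I, sgn B t • bdry ℤ I c (B.erase t) = ∑ s ∈ B ∩ I,
      if s = t then 0 else sgn B t * sgn (B.erase t) s * c ((B.erase t).erase s) := by
    intro t ht
    rw [bdry_apply, smul_eq_mul, Finset.mul_sum, Finset.erase_inter,
      ← Finset.sum_erase (s := B ∩ I) (a := t)]
    · refine Finset.sum_congr rfl fun s hs => ?_
      rw [if_neg (Finset.ne_of_mem_erase hs), smul_eq_mul]; ring
    · simp
  rw [Finset.sum_congr rfl h1]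
  set F : ℕ → ℕ → ℤ := fun t s =>
    if s = t then 0 else sgn B t * sgn (B.erase t) s * c ((B.erase t).erase s) with hF
  have h2 : ∀ t ∈ B ∩ I, ∀ s ∈ B ∩ I, F s t = - F t s := by
    intro t ht s hs
    simp only [Finset.mem_inter] at ht hs
    by_cases hst : s = t
    · simp [hF, hst]
    · simp only [hF, if_neg hst, if_neg (Ne.symm hst), Finset.erase_right_comm (a := t) (b := s)]
      rcases Nat.lt_or_gt_of_ne hst with h | h
      · rw [sgn_erase_of_lt hs.1 h, sgn_erase_of_ge h.le]; ring
      · rw [sgn_erase_of_lt ht.1 h, sgn_erase_of_ge h.le]; ring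
  have h3 : ∑ t ∈ B ∩ I, ∑ s ∈ B ∩ I, F t s = - ∑ t ∈ B ∩ I, ∑ s ∈ B ∩ I, F t s := by
    conv_lhs => rw [Finset.sum_comm]
    rw [← Finset.sum_neg_distrib]
    refine Finset.sum_congr rfl fun t ht => ?_
    rw [← Finset.sum_neg_distrib]
    exact Finset.sum_congr rfl fun s hs => h2 t ht s hs
  exact self_eq_neg.1 h3

/-- The cone operator with apex `t0`, adding `t0` to the argument of a family. -/
def cone (t0 : ℕ) (c : Finset ℕ → ℤ) (B : Finset ℕ) : ℤ :=
  if t0 ∈ B then 0 else sgn B t0 * c (insert t0 B)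

lemma bdry_cone {I : Finset ℕ} {t0 : ℕ} (h0 : t0 ∈ I) (c : Finset ℕ → ℤ) (B : Finset ℕ) :
    bdry ℤ I (cone t0 c) B + cone t0 (bdry ℤ I c) B = c B := by
  by_cases hB : t0 ∈ B
  · rw [cone, if_pos hB, add_zero, bdry_apply, Finset.sum_eq_single t0]
    · rw [cone, if_neg (Finset.notMem_erase _ _), Finset.insert_erase hB, sgn_erase_of_ge le_rfl,
        smul_eq_mul, ← mul_assoc, sgn_mul_self, one_mul]
    · intro t _ ht
      rw [cone, if_pos, smul_zero]
      rw [Finset.mem_erase]; exact ⟨ht.symm, hB⟩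
    · intro h; exact absurd (Finset.mem_inter.2 ⟨hB, h0⟩) h
  · rw [cone, if_neg hB, bdry_apply, bdry_apply, Finset.insert_inter_of_mem h0,
      Finset.sum_insert (by simp [hB]), Finset.erase_insert hB, sgn_insert_of_ge le_rfl,
      smul_eq_mul, mul_add, ← mul_assoc, sgn_mul_self, one_mul, add_left_comm,
      Finset.mul_sum, ← Finset.sum_add_distrib, Finset.sum_eq_zero, add_zero]
    intro t ht
    have htB := (Finset.mem_inter.1 ht).1
    have hne : t ≠ t0 := by rintro rfl; exact hB htB
    rw [cone, if_neg (fun h => hB (Finset.mem_of_mem_erase h)),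
      Finset.erase_insert_of_ne hne.symm, smul_eq_mul, smul_eq_mul]
    rcases Nat.lt_or_gt_of_ne hne with h | h
    · rw [sgn_erase_of_lt htB h, sgn_insert_of_ge h.le]; ring
    · rw [sgn_erase_of_ge h.le, sgn_insert_of_lt hB h]; ring

end boundary

/-! ### Leading words -/

section leading

variable {n r : ℕ}

/-- The number of the block containing the place `i`, when the blocks begin at the elements
of `B`. -/
def blockIdx (B : Finset ℕ) (i : ℕ) : ℕ := (B.filter (· ≤ i)).card

/-- The colouring of the places by blocks. -/
def blockCol (r : ℕ) (B : Finset ℕ) : Fin r → ℕ := fun i => blockIdx B i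

lemma blockIdx_mono (B : Finset ℕ) : Monotone (blockIdx B) := by
  intro i j hij
  apply Finset.card_le_card
  intro t ht
  simp only [Finset.mem_filter] at ht ⊢
  exact ⟨ht.1, ht.2.trans hij⟩

lemma blockIdx_succ_of_notMem {B : Finset ℕ} {i : ℕ} (h : i + 1 ∉ B) :
    blockIdx B (i + 1) = blockIdx B i := by
  rw [blockIdx, blockIdx]
  congr 1
  ext t
  simp only [Finset.mem_filter]
  refine and_congr_right fun ht => ?_
  have : t ≠ i + 1 := by rintro rfl; exact h ht
  omega

lemma blockIdx_lt_of_mem {B : Finset ℕ} {i t : ℕ} (h : t ∈ B) (hi : i < t) :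
    blockIdx B i < blockIdx B t := by
  apply Finset.card_lt_card
  rw [Finset.ssubset_iff_of_subset]
  · exact ⟨t, by simp [h], by simp [hi]⟩
  · intro s hs
    simp only [Finset.mem_filter] at hs ⊢
    exact ⟨hs.1, by omega⟩

lemma rk_lt_blockIdx_iff {B : Finset ℕ} {t i : ℕ} (ht : t ∈ B) : rk B t < blockIdx B i ↔ t ≤ i := by
  constructor
  · intro h
    by_contra hi
    apply absurd h
    rw [not_lt]
    apply Finset.card_le_card
    intro s hs
    simp only [Finset.mem_filter] at hs ⊢
    exact ⟨hs.1, by omega⟩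
  · intro h
    apply Finset.card_lt_card
    rw [Finset.ssubset_iff_of_subset]
    · exact ⟨t, by simp [ht, h], by simp⟩
    · intro s hs
      simp only [Finset.mem_filter] at hs ⊢
      exact ⟨hs.1, by omega⟩

/-- Identify the letters `τ` and `τ + 1`, and shift the higher letters. -/
def collapse (τ x : ℕ) : ℕ := if τ < x then x - 1 else x

lemma blockIdx_erase {B : Finset ℕ} {t : ℕ} (ht : t ∈ B) (i : ℕ) :
    blockIdx (B.erase t) i = collapse (rk B t) (blockIdx B i) := by
  rw [collapse]
  simp only [rk_lt_blockIdx_iff ht]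
  rw [blockIdx, Finset.filter_erase]
  split_ifs with h
  · rw [Finset.card_erase_of_mem (by simp [ht, h])]; rfl
  · rw [Finset.erase_eq_of_notMem (by simp [h])]; rfl

lemma invariants_erase_le {B : Finset ℕ} {t : ℕ} (ht : t ∈ B) :
    invariants n (blockCol r (B.erase t)) ≤ invariants n (blockCol r B) := by
  intro x hx σ hσ
  apply hx σ
  ext1 i
  have : blockIdx B (σ i) = blockIdx B i := congrFun hσ i
  change blockIdx (B.erase t) (σ i) = blockIdx (B.erase t) i
  rw [blockIdx_erase ht, blockIdx_erase ht, this]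

open Classical in
/-- The number of lexicographically smaller words. -/
def lexRank (v : TWord n r) : ℕ :=
  (Finset.univ.filter fun u : TWord n r => toLex u < toLex v).card

lemma lexRank_lt_iff {u v : TWord n r} : lexRank u < lexRank v ↔ toLex u < toLex v := by
  classical
  have key : ∀ {u v : TWord n r}, toLex u ≤ toLex v → lexRank u ≤ lexRank v := by
    intro u v h
    apply Finset.card_le_card
    intro w hw
    simp only [Finset.mem_filter] at hw ⊢
    exact ⟨hw.1, hw.2.trans_le h⟩
  constructor
  · intro h
    by_contra h'
    have := key (not_lt.1 h')
    omega
  · intro h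
    apply Finset.card_lt_card
    rw [Finset.ssubset_iff_of_subset]
    · exact ⟨u, Finset.mem_filter.2 ⟨Finset.mem_univ _, h⟩,
        fun h' => lt_irrefl _ (Finset.mem_filter.1 h').2⟩
    · intro w hw
      simp only [Finset.mem_filter] at hw ⊢
      exact ⟨hw.1, hw.2.trans h⟩

lemma lexRank_injective : Function.Injective (lexRank (n := n) (r := r)) := by
  intro u v h
  rcases lt_trichotomy (toLex u) (toLex v) with h' | h' | h'
  · have := lexRank_lt_iff.2 h'; omega
  · exact toLex.injective h'
  · have := lexRank_lt_iff.2 h'; omega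

lemma lexRank_le_iff {u v : TWord n r} : lexRank u ≤ lexRank v ↔ toLex u ≤ toLex v := by
  rw [← not_lt, lexRank_lt_iff]
  exact not_lt

lemma lexRank_lt_card (u : TWord n r) : lexRank u < Fintype.card (TWord n r) := by
  classical
  rw [lexRank, ← Finset.card_univ]
  apply Finset.card_lt_card
  rw [Finset.ssubset_iff_of_subset (Finset.subset_univ _)]
  exact ⟨u, Finset.mem_univ _, fun h => lt_irrefl _ (Finset.mem_filter.1 h).2⟩

/-- The word `v` does not ascend from the place `t - 1` to the place `t`. -/
def DescAt (v : TWord n r) (t : ℕ) : Prop :=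
  ∀ i j : Fin r, (j : ℕ) = i + 1 → (j : ℕ) = t → v j ≤ v i

/-- The leading word of a tensor that is symmetric in the blocks is weakly decreasing on the
blocks. -/
lemma descAt_of_leading {B : Finset ℕ} {x : TensorSpace n r}
    (hx : x ∈ invariants n (blockCol r B)) {v : TWord n r} (hv : co x v ≠ 0)
    (hmax : ∀ u, co x u ≠ 0 → lexRank u ≤ lexRank v) {t : ℕ} (ht : t ∉ B) : DescAt v t := by
  intro i j hij hjt
  by_contra hlt
  rw [not_le] at hlt
  have hb : blockCol r B i = blockCol r B j := by
    change blockIdx B i = blockIdx B j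
    rw [hij, blockIdx_succ_of_notMem]
    rw [← hij, hjt]; exact ht
  have hrel : Rel (blockCol r B) v (v ∘ Equiv.swap i j) := by
    refine ⟨Equiv.swap i j, ?_, rfl⟩
    ext1 k
    rw [Function.comp_apply]
    by_cases h1 : k = i
    · rw [h1, Equiv.swap_apply_left, hb]
    · by_cases h2 : k = j
      · rw [h2, Equiv.swap_apply_right, hb]
      · rw [Equiv.swap_apply_of_ne_of_ne h1 h2]
  have h1 := hmax (v ∘ Equiv.swap i j) (by rw [co_eq_of_rel hx hrel]; exact hv)
  rw [lexRank_le_iff, ← not_lt] at h1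
  apply h1
  refine ⟨i, ?_, ?_⟩
  · intro k hk
    have hk1 : k ≠ i := hk.ne
    have hk2 : k ≠ j := by
      rintro rfl
      have : (k : ℕ) < i := hk
      omega
    change v k = v (Equiv.swap i j k)
    rw [Equiv.swap_apply_of_ne_of_ne hk1 hk2]
  · change v i < v (Equiv.swap i j i)
    rw [Equiv.swap_apply_left]; exact hlt

lemma antitone_of_descAt {B : Finset ℕ} {v : TWord n r} (hd : ∀ t, t ∉ B → DescAt v t)
    {i j : Fin r} (hij : i ≤ j) (hb : blockIdx B i = blockIdx B j) : v j ≤ v i := by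
  obtain ⟨j, hj⟩ := j
  have hij' : (i : ℕ) ≤ j := hij
  change blockIdx B i = blockIdx B j at hb
  clear hij
  induction j, hij' using Nat.le_induction with
  | base => exact le_rfl
  | succ j hj' ih =>
    have h1 := blockIdx_mono B hj'
    have h2 := blockIdx_mono B (Nat.le_add_right j 1)
    have h3 : blockIdx B i = blockIdx B j := by omega
    have h4 : j + 1 ∉ B := by
      intro h
      have := blockIdx_lt_of_mem h (Nat.lt_succ_self j)
      omega
    exact (hd _ h4 ⟨j, by omega⟩ ⟨j + 1, hj⟩ rfl rfl).trans (ih (by omega) h3)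

/-- A word that is weakly decreasing on the blocks is the largest one in its orbit. -/
lemma lexRank_le_of_rel {B : Finset ℕ} {v u : TWord n r} (hd : ∀ t, t ∉ B → DescAt v t)
    (h : Rel (blockCol r B) v u) : lexRank u ≤ lexRank v := by
  rw [lexRank_le_iff, ← not_lt]
  rintro ⟨j, hj1, hj2⟩
  obtain ⟨σ, hσ, rfl⟩ := h
  change ∀ i < j, v i = v (σ i) at hj1
  change v j < v (σ j) at hj2
  have hσ' : ∀ i, blockIdx B (σ i) = blockIdx B i := fun i => congrFun hσ i
  -- The permutation maps the places of the block of `j` with an entry larger than `v j`, and also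
  -- `j` itself, into the former set.
  let X : Finset (Fin r) := Finset.univ.filter fun t => blockIdx B t = blockIdx B j ∧ v j < v t
  have hX : ∀ t ∈ X, t < j := by
    intro t ht
    simp only [X, Finset.mem_filter, Finset.mem_univ, true_and] at ht
    by_contra hlt
    exact absurd (antitone_of_descAt hd (not_lt.1 hlt) ht.1.symm) (not_le.2 ht.2)
  have hjX : j ∉ X := fun h => lt_irrefl _ (hX j h)
  have hcard := Finset.card_le_card_of_injOn (s := insert j X) (t := X) σ (by
    intro t ht
    rcases Finset.mem_insert.1 ht with rfl | ht
    · simp only [X, Finset.coe_filter, Finset.mem_univ, true_and, Set.mem_ofPred_eq]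
      exact ⟨hσ' _, hj2⟩
    · have h1 := hX t ht
      simp only [X, Finset.mem_filter, Finset.mem_univ, true_and] at ht
      simp only [X, Finset.coe_filter, Finset.mem_univ, true_and, Set.mem_ofPred_eq]
      exact ⟨(hσ' _).trans ht.1, by rw [← hj1 t h1]; exact ht.2⟩) σ.injective.injOn
  rw [Finset.card_insert_of_notMem hjX] at hcard
  omega

end leading

/-! ### Exactness of the complex of symmetric tensors -/

section exactness

variable {n r : ℕ}

/-- The term of homological degree `q` of the resolution: families of tensors indexed by the
sets `B ⊆ I` with `|I| - q` elements, symmetric in the blocks beginning at the elements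
of `B`. -/
def resPart (n r : ℕ) (I : Finset ℕ) (q : ℕ) :
    Submodule (schurAlgebra n r) (Finset ℕ → TensorSpace n r) where
  carrier := {x | (∀ B, x B ∈ invariants n (blockCol r B)) ∧
    ∀ B, x B ≠ 0 → B ⊆ I ∧ B.card + q = I.card}
  add_mem' := by
    rintro x y ⟨hx, hx'⟩ ⟨hy, hy'⟩
    refine ⟨fun B => add_mem (hx B) (hy B), fun B hB => ?_⟩
    by_cases h : x B = 0
    · exact hy' B (by simpa [h] using hB)
    · exact hx' B h
  zero_mem' := ⟨fun B => zero_mem _, fun B h => absurd rfl h⟩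
  smul_mem' := by
    rintro c x ⟨hx, hx'⟩
    refine ⟨fun B => Submodule.smul_mem _ _ (hx B), fun B hB => hx' B ?_⟩
    intro h
    rw [Pi.smul_apply, h, smul_zero] at hB
    exact hB rfl

lemma bdry_mem {I : Finset ℕ} {q : ℕ} {x : Finset ℕ → TensorSpace n r}
    (hx : x ∈ resPart n r I (q + 1)) : bdry (schurAlgebra n r) I x ∈ resPart n r I q := by
  refine ⟨fun B => ?_, fun B hB => ?_⟩
  · rw [bdry_apply]
    refine sum_mem fun t ht => zsmul_mem ?_ _
    exact invariants_erase_le (Finset.mem_inter.1 ht).1 (hx.1 _)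
  · rw [bdry_apply] at hB
    obtain ⟨t, ht, hne⟩ := Finset.exists_ne_zero_of_sum_ne_zero hB
    have hne' : x (B.erase t) ≠ 0 := by
      intro h; rw [h, smul_zero] at hne; exact hne rfl
    obtain ⟨h1, h2⟩ := hx.2 _ hne'
    rw [Finset.mem_inter] at ht
    constructor
    · intro s hs
      by_cases hst : s = t
      · rw [hst]; exact ht.2
      · exact h1 (Finset.mem_erase.2 ⟨hst, hs⟩)
    · have := Finset.card_erase_add_one ht.1
      omega

lemma co_bdry (I : Finset ℕ) (x : Finset ℕ → TensorSpace n r) (B : Finset ℕ) (u : TWord n r) :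
    co (bdry (schurAlgebra n r) I x B) u = bdry ℤ I (fun B => co (x B) u) B := by
  rw [bdry_apply, bdry_apply, co_sum]
  exact Finset.sum_congr rfl fun t _ => by rw [co_smul, smul_eq_mul]

lemma schur_bdry_bdry (I : Finset ℕ) (x : Finset ℕ → TensorSpace n r) :
    bdry (schurAlgebra n r) I (bdry (schurAlgebra n r) I x) = 0 := by
  ext1 B
  apply co_ext
  intro u
  rw [co_bdry]
  simp only [co_bdry]
  have := congrFun (bdry_bdry I fun B => co (x B) u) B
  rw [Pi.zero_apply, co_zero]
  exact this

/-- The leading coefficients of a cycle form a cycle of a simplex; contracting the simplex to the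
apex `t0` gives a boundary with the same leading coefficients. -/
lemma exists_leading_boundary {I : Finset ℕ} {q : ℕ} {x : Finset ℕ → TensorSpace n r}
    (hx : x ∈ resPart n r I q) (h0 : bdry (schurAlgebra n r) I x = 0) {v : TWord n r}
    (hmax : ∀ B u, co (x B) u ≠ 0 → lexRank u ≤ lexRank v) {t0 : ℕ} (ht0 : t0 ∈ I)
    (hdt0 : DescAt v t0) :
    ∃ y ∈ resPart n r I (q + 1),
      (∀ B, co (bdry (schurAlgebra n r) I y B) v = co (x B) v) ∧
      ∀ B u, co (bdry (schurAlgebra n r) I y B) u ≠ 0 → lexRank u ≤ lexRank v := by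
  have hdesc : ∀ B, co (x B) v ≠ 0 → ∀ t, t ∉ B → DescAt v t := fun B hB t ht =>
    descAt_of_leading (hx.1 B) hB (fun u hu => hmax B u hu) ht
  obtain ⟨c, hcdef⟩ : ∃ c : Finset ℕ → ℤ, ∀ B, c B = co (x B) v := ⟨_, fun _ => rfl⟩
  have hcone : ∀ B, cone t0 c B ≠ 0 → t0 ∉ B ∧ co (x (insert t0 B)) v ≠ 0 := by
    intro B hB
    rw [cone] at hB
    split_ifs at hB with h
    · exact absurd rfl hB
    · exact ⟨h, by rw [← hcdef]; exact right_ne_zero_of_mul hB⟩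
  have hconedesc : ∀ B, cone t0 c B ≠ 0 → ∀ t, t ∉ B → DescAt v t := by
    intro B hB t ht
    by_cases h : t = t0
    · rw [h]; exact hdt0
    · refine hdesc _ (hcone B hB).2 t fun h' => ?_
      rcases Finset.mem_insert.1 h' with h' | h'
      · exact h h'
      · exact ht h'
  obtain ⟨y, hydef⟩ : ∃ y : Finset ℕ → TensorSpace n r,
      ∀ B, y B = cone t0 c B • orb (blockCol r B) v := ⟨_, fun _ => rfl⟩
  have hcoy : ∀ B u, co (y B) u = cone t0 c B * co (orb (blockCol r B) v) u := by
    intro B u; rw [hydef, co_smul]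
  refine ⟨y, ⟨fun B => ?_, fun B hB => ?_⟩, fun B => ?_, fun B u hu => ?_⟩
  · rw [hydef]; exact zsmul_mem (orb_mem _ _) _
  · have h1 : cone t0 c B ≠ 0 := by
      intro h; apply hB; rw [hydef, h, zero_smul]
    obtain ⟨h2, h3⟩ := hcone B h1
    have h4 : x (insert t0 B) ≠ 0 := by
      intro h; apply h3; rw [h, co_zero]
    obtain ⟨h5, h6⟩ := hx.2 _ h4
    rw [Finset.card_insert_of_notMem h2] at h6
    exact ⟨(Finset.subset_insert _ _).trans h5, by omega⟩
  · have h1 : (fun B => co (y B) v) = cone t0 c := by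
      ext1 B
      rw [hcoy, co_orb, if_pos (Rel.refl _ v), mul_one]
    have h3 : bdry ℤ I c = 0 := by
      have h4 : c = fun B => co (x B) v := funext hcdef
      ext1 B
      rw [h4, ← co_bdry, h0, Pi.zero_apply, co_zero]; rfl
    have h2 := bdry_cone ht0 c B
    rw [h3, ← h1, ← co_bdry] at h2
    have h4 : cone t0 (0 : Finset ℕ → ℤ) B = 0 := by
      rw [cone, Pi.zero_apply, mul_zero, ite_self]
    rw [h4, add_zero, hcdef] at h2
    exact h2
  · rw [co_bdry, bdry_apply] at hu
    obtain ⟨t, ht, hne⟩ := Finset.exists_ne_zero_of_sum_ne_zero hu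
    have h1 : co (y (B.erase t)) u ≠ 0 := by
      intro h; rw [h, smul_zero] at hne; exact hne rfl
    rw [hcoy, co_orb] at h1
    have hr : Rel (blockCol r (B.erase t)) v u := by
      by_contra hr
      rw [if_neg hr, mul_zero] at h1
      exact h1 rfl
    exact lexRank_le_of_rel (hconedesc _ (left_ne_zero_of_mul h1)) hr

/-- Exactness in positive degrees: the leading coefficients of a cycle are those of a boundary,
so that subtracting boundaries lowers the leading word. -/
theorem resPart_exact {I : Finset ℕ} {q : ℕ} (hq : 1 ≤ q) {x : Finset ℕ → TensorSpace n r}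
    (hx : x ∈ resPart n r I q) (h0 : bdry (schurAlgebra n r) I x = 0) :
    ∃ y ∈ resPart n r I (q + 1), bdry (schurAlgebra n r) I y = x := by
  suffices H : ∀ N : ℕ, ∀ x ∈ resPart n r I q, bdry (schurAlgebra n r) I x = 0 →
      (∀ B u, co (x B) u ≠ 0 → lexRank u < N) →
      ∃ y ∈ resPart n r I (q + 1), bdry (schurAlgebra n r) I y = x from
    H (Fintype.card (TWord n r)) x hx h0 fun B u _ => lexRank_lt_card u
  clear x hx h0
  intro N
  induction N with
  | zero =>
    intro x _ _ hN
    refine ⟨0, zero_mem _, ?_⟩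
    rw [map_zero]
    ext1 B
    apply co_ext; intro u
    by_contra h
    have := hN B u (by rw [Pi.zero_apply, co_zero] at h; exact Ne.symm h)
    omega
  | succ N ih =>
    intro x hx h0 hN
    by_cases hc : ∃ B v, co (x B) v ≠ 0 ∧ lexRank v = N
    swap
    · refine ih x hx h0 fun B u hu => ?_
      have h1 := hN B u hu
      have h2 : lexRank u ≠ N := fun h => hc ⟨B, u, hu, h⟩
      omega
    obtain ⟨B0, v, hv, rfl⟩ := hc
    have hmax : ∀ B u, co (x B) u ≠ 0 → lexRank u ≤ lexRank v := fun B u hu =>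
      Nat.lt_succ_iff.1 (hN B u hu)
    have hne0 : x B0 ≠ 0 := by
      intro h; rw [h, co_zero] at hv; exact hv rfl
    obtain ⟨hB0, hcard0⟩ := hx.2 B0 hne0
    obtain ⟨t0, ht0, ht0'⟩ : ∃ t0 ∈ I, t0 ∉ B0 := by
      by_contra! h
      have : I.card ≤ B0.card := Finset.card_le_card h
      omega
    obtain ⟨y, hy, hyv, hyu⟩ := exists_leading_boundary hx h0 hmax ht0
      (descAt_of_leading (hx.1 B0) hv (fun u hu => hmax B0 u hu) ht0')
    obtain ⟨y', hy', hyy'⟩ := ih (x - bdry (schurAlgebra n r) I y) (sub_mem hx (bdry_mem hy))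
      (by rw [map_sub, h0, schur_bdry_bdry, sub_zero]) (by
        intro B u hu
        rw [Pi.sub_apply, co_sub] at hu
        have h1 : lexRank u ≤ lexRank v := by
          by_cases h : co (x B) u = 0
          · exact hyu B u (by intro h'; rw [h, h', sub_zero] at hu; exact hu rfl)
          · exact hmax B u h
        have h2 : lexRank u ≠ lexRank v := by
          intro h
          rw [lexRank_injective h, hyv, sub_self] at hu
          exact hu rfl
        omega)
    exact ⟨y' + y, add_mem hy' hy, by rw [map_add, hyy', sub_add_cancel]⟩

end exactness

/-! ### Alternating relations -/

section alternating

variable {n r : ℕ} {B : Set (Fin r)}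

lemma tprod_mem_altRelations {v : Fin r → NatMod n} {i j : Fin r} (hi : i ∈ B) (hj : j ∈ B)
    (hij : i ≠ j) (h : v i = v j) : PiTensorProduct.tprod ℤ v ∈ altRelations n r B :=
  Submodule.subset_span ⟨v, ⟨i, hi, j, hj, hij, h⟩, rfl⟩

lemma wordBasis_mem_altRelations {w : TWord n r} {i j : Fin r} (hi : i ∈ B) (hj : j ∈ B)
    (hij : i ≠ j) (h : w i = w j) : wordBasis n r w ∈ altRelations n r B := by
  rw [wordBasis_apply]
  exact tprod_mem_altRelations hi hj hij (by rw [h])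

lemma wordBasis_add_swap_mem (w : TWord n r) {i j : Fin r} (hi : i ∈ B) (hj : j ∈ B)
    (hij : i ≠ j) :
    wordBasis n r w + wordBasis n r (w ∘ Equiv.swap i j) ∈ altRelations n r B := by
  classical
  let e : Fin r → NatMod n := fun i => Pi.single (w i) 1
  let f : NatMod n → NatMod n → TensorSpace n r := fun x y =>
    PiTensorProduct.tprod ℤ (Function.update (Function.update e i x) j y)
  have hf : ∀ x, f x x ∈ altRelations n r B := by
    intro x
    refine tprod_mem_altRelations hi hj hij ?_
    rw [Function.update_self, Function.update_of_ne hij, Function.update_self]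
  have hadd1 : ∀ x y z, f (x + y) z = f x z + f y z := by
    intro x y z
    simp only [f, Function.update_comm hij]
    exact MultilinearMap.map_update_add _ _ _ _ _
  have hadd2 : ∀ x y z, f x (y + z) = f x y + f x z := fun x y z =>
    MultilinearMap.map_update_add _ _ _ _ _
  have h1 : wordBasis n r w = f (e i) (e j) := by
    rw [wordBasis_apply]
    simp only [f]
    rw [Function.update_eq_self, Function.update_eq_self]
  have h2 : wordBasis n r (w ∘ Equiv.swap i j) = f (e j) (e i) := by
    rw [wordBasis_apply]
    simp only [f]
    congr 1
    ext1 k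
    by_cases hk : k = j
    · rw [hk, Function.update_self, Function.comp_apply, Equiv.swap_apply_right]
    · rw [Function.update_of_ne hk]
      by_cases hk' : k = i
      · rw [hk', Function.update_self, Function.comp_apply, Equiv.swap_apply_left]
      · rw [Function.update_of_ne hk', Function.comp_apply, Equiv.swap_apply_of_ne_of_ne hk' hk]
  have h3 := sub_mem (sub_mem (hf (e i + e j)) (hf (e i))) (hf (e j))
  rw [hadd1, hadd2, hadd2] at h3
  rw [h1, h2]
  convert h3 using 1
  abel

/-- A tensor fixed by a transposition of alternating places is a sum of words with equal letters
at these places and of sums of two words differing by the transposition. -/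
lemma mem_altRelations_of_swap {x : TensorSpace n r} {i j : Fin r} (hi : i ∈ B) (hj : j ∈ B)
    (hij : i ≠ j) (hx : placePerm n (Equiv.swap i j) x = x) : x ∈ altRelations n r B := by
  classical
  have hco : ∀ w, co x (w ∘ Equiv.swap i j) = co x w := by
    intro w; rw [← co_placePerm, hx]
  rw [← sum_co x, ← Finset.sum_filter_add_sum_filter_not Finset.univ (fun w => w i = w j)]
  refine add_mem (sum_mem fun w hw => zsmul_mem
    (wordBasis_mem_altRelations hi hj hij (Finset.mem_filter.1 hw).2) _) ?_
  rw [← Finset.sum_filter_add_sum_filter_not (Finset.univ.filter fun w : TWord n r => ¬ w i = w j)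
    (fun w => w i < w j), Finset.filter_filter, Finset.filter_filter]
  have h : ∑ w with ¬ w i = w j ∧ ¬ w i < w j, co x w • wordBasis n r w =
      ∑ w with ¬ w i = w j ∧ w i < w j,
        co x w • wordBasis n r (w ∘ Equiv.swap i j) := by
    refine Finset.sum_nbij' (fun w => w ∘ Equiv.swap i j) (fun w => w ∘ Equiv.swap i j)
      ?_ ?_ ?_ ?_ ?_
    · intro w hw
      simp only [Finset.mem_filter, Finset.mem_univ, true_and, Function.comp_apply,
        Equiv.swap_apply_left, Equiv.swap_apply_right] at hw ⊢
      omega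
    · intro w hw
      simp only [Finset.mem_filter, Finset.mem_univ, true_and, Function.comp_apply,
        Equiv.swap_apply_left, Equiv.swap_apply_right] at hw ⊢
      omega
    · intro w _; ext k; simp
    · intro w _; ext k; simp
    · intro w _
      rw [hco, Function.comp_assoc]
      congr 2; ext k; simp
  rw [h, ← Finset.sum_add_distrib]
  refine sum_mem fun w _ => ?_
  rw [← smul_add]
  exact zsmul_mem (wordBasis_add_swap_mem w hi hj hij) _

lemma add_placePerm_swap_mem (x : TensorSpace n r) {i j : Fin r} (hi : i ∈ B) (hj : j ∈ B)
    (hij : i ≠ j) : x + placePerm n (Equiv.swap i j) x ∈ altRelations n r B := by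
  refine mem_altRelations_of_swap hi hj hij ?_
  rw [map_add, ← placePerm_mul, Equiv.swap_mul_self, placePerm_one, add_comm]

open Classical in
/-- The antisymmetrizer of the places from `B`. -/
def antisymm (B : Set (Fin r)) (x : TensorSpace n r) : TensorSpace n r :=
  ∑ π : Equiv.Perm (Fin r) with ∀ i, i ∉ B → π i = i,
    ((Equiv.Perm.sign π : ℤˣ) : ℤ) • placePerm n π x

open Classical in
lemma co_antisymm (x : TensorSpace n r) (u : TWord n r) : co (antisymm B x) u =
    ∑ π : Equiv.Perm (Fin r) with ∀ i, i ∉ B → π i = i,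
      ((Equiv.Perm.sign π : ℤˣ) : ℤ) * co x (u ∘ π) := by
  rw [antisymm, co_sum]
  exact Finset.sum_congr rfl fun π _ => by rw [co_smul, co_placePerm]

lemma antisymm_eq_zero {x : TensorSpace n r} (hx : x ∈ altRelations n r B) : antisymm B x = 0 := by
  classical
  induction hx using Submodule.span_induction with
  | mem x hx =>
    obtain ⟨v, ⟨i, hi, j, hj, hij, hv⟩, rfl⟩ := hx
    have hfix : placePerm n (Equiv.swap i j) (PiTensorProduct.tprod ℤ v) =
        PiTensorProduct.tprod ℤ v := by
      rw [placePerm, LinearEquiv.coe_coe]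
      refine (PiTensorProduct.reindex_tprod _ v).trans ?_
      congr 1
      ext1 k
      rw [Equiv.symm_swap]
      by_cases hk : k = i
      · rw [hk, Equiv.swap_apply_left, hv]
      · by_cases hk' : k = j
        · rw [hk', Equiv.swap_apply_right, hv]
        · rw [Equiv.swap_apply_of_ne_of_ne hk hk']
    refine Finset.sum_involution (fun π _ => π * Equiv.swap i j) ?_ ?_ ?_ ?_
    · intro π _
      rw [placePerm_mul, hfix, Equiv.Perm.sign_mul, Equiv.Perm.sign_swap hij, mul_neg_one,
        Units.val_neg, neg_smul, add_neg_cancel]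
    · intro π _ _ h
      have h1 : Equiv.swap i j = 1 := by simpa using h
      exact hij (Equiv.swap_eq_one_iff.1 h1)
    · intro π hπ
      simp only [Finset.mem_filter, Finset.mem_univ, true_and] at hπ ⊢
      intro k hk
      rw [Equiv.Perm.mul_apply, Equiv.swap_apply_of_ne_of_ne, hπ k hk]
      · rintro rfl; exact hk hi
      · rintro rfl; exact hk hj
    · intro π _
      simp
  | zero => simp [antisymm]
  | add x y _ _ hx hy =>
    have h : antisymm B (x + y) = antisymm B x + antisymm B y := by
      simp only [antisymm, map_add, smul_add, Finset.sum_add_distrib]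
    rw [h, hx, hy, add_zero]
  | smul c x _ hx =>
    have h : antisymm B (c • x) = c • antisymm B x := by
      rw [antisymm, antisymm, Finset.smul_sum]
      refine Finset.sum_congr rfl fun π _ => ?_
      rw [placePerm_smul, smul_comm]
    rw [h, hx, smul_zero]

end alternating

/-! ### The hook Weyl module as a cokernel -/

section hook

variable {n r a : ℕ}

/-- The places of the first column of the hook. -/
abbrev hookColumn (r a : ℕ) : Set (Fin r) := {i | (i : ℕ) = 0 ∨ a ≤ (i : ℕ)}

lemma bdry_eq_zero_of_resPart_zero {I : Finset ℕ} {x : Finset ℕ → TensorSpace n r}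
    (hx : x ∈ resPart n r I 0) : bdry (schurAlgebra n r) I x = 0 := by
  ext1 B
  rw [bdry_apply]
  refine Finset.sum_eq_zero fun t ht => ?_
  by_contra h
  have h1 : x (B.erase t) ≠ 0 := by
    intro h'; rw [h', smul_zero] at h; exact h rfl
  obtain ⟨h2, h3⟩ := hx.2 _ h1
  have h4 := Finset.eq_of_subset_of_card_le h2 (by omega)
  have h5 := (Finset.mem_inter.1 ht).2
  rw [← h4] at h5
  exact Finset.notMem_erase _ _ h5

lemma placePerm_swap_of_invariants {κ : Fin r → ℕ} {x : TensorSpace n r}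
    (hx : x ∈ invariants n κ) {i j : Fin r} (h : κ i = κ j) :
    placePerm n (Equiv.swap i j) x = x := by
  apply hx
  ext1 k
  rw [Function.comp_apply]
  by_cases h1 : k = i
  · rw [h1, Equiv.swap_apply_left, h]
  · by_cases h2 : k = j
    · rw [h2, Equiv.swap_apply_right, h]
    · rw [Equiv.swap_apply_of_ne_of_ne h1 h2]

lemma blockIdx_Ico_eq_zero {c d i : ℕ} (h : i < c) : blockIdx (Finset.Ico c d) i = 0 := by
  rw [blockIdx, Finset.card_eq_zero, Finset.filter_eq_empty_iff]
  intro t ht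
  rw [Finset.mem_Ico] at ht
  omega

/-- The boundaries in degree zero vanish in the Weyl module of the hook: merging two blocks of
places makes the tensor symmetric in two places of the column. -/
lemma bdry_mem_altRelations (ha : 1 ≤ a) {y : Finset ℕ → TensorSpace n r}
    (hy : y ∈ resPart n r (Finset.Ico a r) 1) (B : Finset ℕ) :
    bdry (schurAlgebra n r) (Finset.Ico a r) y B ∈ altRelations n r (hookColumn r a) := by
  have hmem := bdry_mem hy
  by_cases hB0 : bdry (schurAlgebra n r) (Finset.Ico a r) y B = 0
  · rw [hB0]; exact zero_mem _
  obtain ⟨h1, h2⟩ := hmem.2 B hB0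
  have hB := Finset.eq_of_subset_of_card_le h1 (by omega)
  rw [hB, bdry_apply]
  refine sum_mem fun t ht => zsmul_mem ?_ _
  rw [Finset.inter_self, Finset.mem_Ico] at ht
  have hinv := hy.1 ((Finset.Ico a r).erase t)
  by_cases hta : t = a
  · subst hta
    refine mem_altRelations_of_swap (i := ⟨0, by omega⟩) (j := ⟨t, ht.2⟩) (Or.inl rfl)
      (Or.inr ht.1) (by rw [Ne, Fin.mk.injEq]; omega) (placePerm_swap_of_invariants hinv ?_)
    have : (Finset.Ico t r).erase t = Finset.Ico (t + 1) r := by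
      ext s; simp only [Finset.mem_erase, Finset.mem_Ico]; omega
    change blockIdx _ 0 = blockIdx _ t
    rw [this, blockIdx_Ico_eq_zero (by omega), blockIdx_Ico_eq_zero (by omega)]
  · refine mem_altRelations_of_swap (i := ⟨t - 1, by omega⟩) (j := ⟨t, ht.2⟩)
      (Or.inr (by change a ≤ t - 1; omega))
      (Or.inr ht.1) (by rw [Ne, Fin.mk.injEq]; omega) (placePerm_swap_of_invariants hinv ?_)
    change blockIdx _ (t - 1) = blockIdx _ t
    obtain ⟨t, rfl⟩ : ∃ t', t = t' + 1 := ⟨t - 1, by omega⟩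
    rw [Nat.add_sub_cancel, blockIdx_succ_of_notMem (Finset.notMem_erase _ _)]

/-- A word that is strictly increasing from the place `c` on is lexicographically minimal among its
rearrangements of these places. -/
lemma eq_one_of_lexRank_le {v : TWord n r} {c : ℕ}
    (hv : ∀ i j : Fin r, c ≤ (i : ℕ) → i < j → v i < v j) {ρ : Equiv.Perm (Fin r)}
    (hρ : ∀ i : Fin r, (i : ℕ) < c → ρ i = i) (h : lexRank (v ∘ ρ) ≤ lexRank v) : ρ = 1 := by
  by_contra hne
  have hex : ∃ k, ∃ h : k < r, ρ ⟨k, h⟩ ≠ ⟨k, h⟩ := by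
    by_contra! h'
    exact hne (Equiv.ext fun i => h' i i.2)
  classical
  obtain ⟨hk, hk'⟩ := Nat.find_spec hex
  have hmin : ∀ m : Fin r, m < (⟨Nat.find hex, hk⟩ : Fin r) → ρ m = m := by
    intro m hm
    by_contra h'
    exact Nat.find_min hex hm ⟨m.2, h'⟩
  set i : Fin r := ⟨Nat.find hex, hk⟩ with hi
  have hci : c ≤ (i : ℕ) := by
    by_contra h'
    exact hk' (hρ i (by omega))
  have hlt : i < ρ i := by
    rcases lt_trichotomy i (ρ i) with h' | h' | h'
    · exact h'
    · exact absurd h'.symm hk'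
    · exact absurd (ρ.injective (hmin _ h')) hk'
  rw [lexRank_le_iff, ← not_lt] at h
  apply h
  refine ⟨i, fun m hm => ?_, hv i _ hci hlt⟩
  change v m = v (ρ m)
  rw [hmin m hm]

/-- A word that is strictly increasing from the last place of the row on is not the leading word of
a tensor that is symmetric in the row and vanishes in the Weyl module of the hook. The reason is
that the coefficient of its antisymmetrization at the word with the ends of the row exchanged is
the leading coefficient. -/
lemma exists_descAt_of_leading (ha : 1 ≤ a) (har : a ≤ r) {x : TensorSpace n r}
    (hx : x ∈ invariants n (blockCol r (Finset.Ico a r)))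
    (hx' : x ∈ altRelations n r (hookColumn r a)) {v : TWord n r} (hv : co x v ≠ 0)
    (hmax : ∀ u, co x u ≠ 0 → lexRank u ≤ lexRank v) :
    ∃ t ∈ Finset.Ico a r, DescAt v t := by
  classical
  by_contra! hd
  have hstep : ∀ (m : ℕ) (hm : m + 1 < r), a ≤ m + 1 →
      v ⟨m, by omega⟩ < v ⟨m + 1, hm⟩ := by
    intro m hm ham
    have := hd (m + 1) (Finset.mem_Ico.2 ⟨ham, hm⟩)
    rw [DescAt] at this
    push Not at this
    obtain ⟨i, j, h1, h2, h3⟩ := this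
    have hi : i = ⟨m, by omega⟩ := Fin.ext (by change (i : ℕ) = m; omega)
    have hj : j = ⟨m + 1, hm⟩ := Fin.ext h2
    have h4 := congrArg v hi
    have h5 := congrArg v hj
    rw [← h4, ← h5]
    exact h3
  have hmono : ∀ i j : Fin r, a - 1 ≤ (i : ℕ) → i < j → v i < v j := by
    rintro i ⟨j, hj⟩ hi hij
    have hij' : (i : ℕ) + 1 ≤ j := hij
    clear hij
    induction j, hij' using Nat.le_induction with
    | base => exact hstep i hj (by omega)
    | succ j hj' ih => exact (ih (by omega)).trans (hstep j hj (by omega))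
  let p0 : Fin r := ⟨0, by omega⟩
  let p1 : Fin r := ⟨a - 1, by omega⟩
  let s : Equiv.Perm (Fin r) := Equiv.swap p0 p1
  have hs : blockCol r (Finset.Ico a r) ∘ s = blockCol r (Finset.Ico a r) := by
    have h01 : blockCol r (Finset.Ico a r) p0 = blockCol r (Finset.Ico a r) p1 := by
      change blockIdx _ 0 = blockIdx _ (a - 1)
      rw [blockIdx_Ico_eq_zero (by omega), blockIdx_Ico_eq_zero (by omega)]
    ext1 k
    rw [Function.comp_apply]
    by_cases h1 : k = p0
    · rw [h1, Equiv.swap_apply_left, h01]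
    · by_cases h2 : k = p1
      · rw [h2, Equiv.swap_apply_right, h01]
      · rw [Equiv.swap_apply_of_ne_of_ne h1 h2]
  have hss : ∀ k, s (s k) = k := fun k => Equiv.swap_apply_self _ _ k
  have key := co_antisymm (B := hookColumn r a) x (v ∘ s)
  rw [antisymm_eq_zero hx', co_zero, Finset.sum_eq_single 1] at key
  · apply hv
    rw [Equiv.Perm.sign_one, Units.val_one, one_mul] at key
    rw [key]
    exact (mem_invariants_iff_co.1 hx s hs v).symm
  · intro π hπ hπ1
    simp only [Finset.mem_filter, Finset.mem_univ, true_and] at hπ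
    rw [← mem_invariants_iff_co.1 hx s hs]
    by_contra h
    have h1 : co x (v ∘ (s * π * s : Equiv.Perm (Fin r))) ≠ 0 := by
      intro h'
      apply h
      rw [show ((v ∘ s) ∘ π) ∘ s = v ∘ (s * π * s : Equiv.Perm (Fin r)) from rfl, h', mul_zero]
    have h2 := eq_one_of_lexRank_le (c := a - 1) hmono (ρ := s * π * s) (by
      intro i hi
      rw [Equiv.Perm.mul_apply, Equiv.Perm.mul_apply]
      by_cases hi0 : i = p0
      · have h3 : π p1 = p1 := by
          apply hπ
          rintro (h4 | h4)
          · change a - 1 = 0 at h4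
            omega
          · change a ≤ a - 1 at h4
            omega
        rw [hi0, show s p0 = p1 from Equiv.swap_apply_left _ _, h3]
        exact Equiv.swap_apply_right _ _
      · have hi1 : i ≠ p1 := by
          rintro rfl
          exact lt_irrefl _ hi
        have h3 : s i = i := Equiv.swap_apply_of_ne_of_ne hi0 hi1
        rw [h3, hπ, h3]
        rintro (h4 | h4)
        · exact hi0 (Fin.ext h4)
        · omega) (hmax _ h1)
    apply hπ1
    ext1 k
    have h3 := Equiv.congr_fun h2 (s k)
    rw [Equiv.Perm.mul_apply, Equiv.Perm.mul_apply, hss, Equiv.Perm.one_apply] at h3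
    exact s.injective h3
  · intro h
    refine absurd ?_ h
    simp only [Finset.mem_filter, Finset.mem_univ, true_and]
    exact fun _ _ => rfl

/-- The kernel of the projection to the Weyl module of the hook consists of boundaries. -/
theorem exists_bdry_of_mem_altRelations (ha : 1 ≤ a) (har : a ≤ r) {x : Finset ℕ → TensorSpace n r}
    (hx : x ∈ resPart n r (Finset.Ico a r) 0)
    (h0 : ∀ B, x B ∈ altRelations n r (hookColumn r a)) :
    ∃ y ∈ resPart n r (Finset.Ico a r) 1, bdry (schurAlgebra n r) (Finset.Ico a r) y = x := by
  suffices H : ∀ N : ℕ, ∀ x ∈ resPart n r (Finset.Ico a r) 0,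
      (∀ B, x B ∈ altRelations n r (hookColumn r a)) →
      (∀ B u, co (x B) u ≠ 0 → lexRank u < N) →
      ∃ y ∈ resPart n r (Finset.Ico a r) 1, bdry (schurAlgebra n r) (Finset.Ico a r) y = x from
    H (Fintype.card (TWord n r)) x hx h0 fun B u _ => lexRank_lt_card u
  clear x hx h0
  intro N
  induction N with
  | zero =>
    intro x _ _ hN
    refine ⟨0, zero_mem _, ?_⟩
    rw [map_zero]
    ext1 B
    apply co_ext; intro u
    by_contra h
    have := hN B u (by rw [Pi.zero_apply, co_zero] at h; exact Ne.symm h)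
    omega
  | succ N ih =>
    intro x hx h0 hN
    by_cases hc : ∃ B v, co (x B) v ≠ 0 ∧ lexRank v = N
    swap
    · refine ih x hx h0 fun B u hu => ?_
      have h1 := hN B u hu
      have h2 : lexRank u ≠ N := fun h => hc ⟨B, u, hu, h⟩
      omega
    obtain ⟨B0, v, hv, rfl⟩ := hc
    have hmax : ∀ B u, co (x B) u ≠ 0 → lexRank u ≤ lexRank v := fun B u hu =>
      Nat.lt_succ_iff.1 (hN B u hu)
    have hne0 : x B0 ≠ 0 := by
      intro h; rw [h, co_zero] at hv; exact hv rfl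
    obtain ⟨hB0, hcard0⟩ := hx.2 B0 hne0
    have hBI : B0 = Finset.Ico a r := Finset.eq_of_subset_of_card_le hB0 (by omega)
    obtain ⟨t0, ht0, hd⟩ := exists_descAt_of_leading ha har (hBI ▸ hx.1 B0) (h0 B0) hv
      (fun u hu => hmax B0 u hu)
    obtain ⟨y, hy, hyv, hyu⟩ := exists_leading_boundary hx (bdry_eq_zero_of_resPart_zero hx) hmax
      ht0 hd
    obtain ⟨y', hy', hyy'⟩ := ih (x - bdry (schurAlgebra n r) (Finset.Ico a r) y)
      (sub_mem hx (bdry_mem hy))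
      (fun B => sub_mem (h0 B) (bdry_mem_altRelations ha hy B)) (by
        intro B u hu
        rw [Pi.sub_apply, co_sub] at hu
        have h1 : lexRank u ≤ lexRank v := by
          by_cases h : co (x B) u = 0
          · exact hyu B u (by intro h'; rw [h, h', sub_zero] at hu; exact hu rfl)
          · exact hmax B u h
        have h2 : lexRank u ≠ lexRank v := by
          intro h
          rw [lexRank_injective h, hyv, sub_self] at hu
          exact hu rfl
        omega)
    exact ⟨y' + y, add_mem hy' hy, by rw [map_add, hyy', sub_add_cancel]⟩

end hook

/-! ### The second extension group from the start of a projective resolution -/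

section extTwo

open CategoryTheory CategoryTheory.Abelian

/-- Dimension shifting along `0 → S₁ → S₂ → S₃ → 0` with projective `S₂`. -/
lemma exists_addEquiv_of_projective {R : Type} [Ring R] {S : ShortComplex (ModuleCat.{0} R)}
    (hS : S.ShortExact) [Projective S.X₂] (M : ModuleCat.{0} R) :
    Nonempty (Ext.{0} S.X₁ M 1 ≃+ Ext.{0} S.X₃ M 2) := by
  refine ⟨AddEquiv.ofBijective (hS.extClass.precomp M (show 1 + 1 = 2 from rfl)) ⟨?_, ?_⟩⟩
  · rw [injective_iff_map_eq_zero]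
    intro x hx
    obtain ⟨x₂, rfl⟩ := Ext.contravariant_sequence_exact₁ hS M x (show 1 + 1 = 2 from rfl) hx
    rw [Ext.eq_zero_of_projective x₂, Ext.comp_zero]
  · intro x
    exact Ext.contravariant_sequence_exact₃ hS M x (Ext.eq_zero_of_projective (n := 1) _)
      (show 1 + 1 = 2 from rfl)

/-- The first extension group of the cokernel of `S₁ → S₂` with projective `S₂`. -/
lemma exists_addMonoidHom_of_projective {R : Type} [Ring R] {S : ShortComplex (ModuleCat.{0} R)}
    (hS : S.ShortExact) [Projective S.X₂] (M : ModuleCat.{0} R) :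
    ∃ Φ : (S.X₁ →ₗ[R] M) →+ Ext.{0} S.X₃ M 1, Function.Surjective Φ ∧
      ∀ f, Φ f = 0 ↔ ∃ g : S.X₂ →ₗ[R] M, f = g ∘ₗ S.f.hom := by
  let e : (S.X₁ →ₗ[R] M) ≃+ (S.X₁ ⟶ M) := ModuleCat.homAddEquiv.symm
  refine ⟨(hS.extClass.precomp M (show 1 + 0 = 1 from rfl)).comp
    (e.trans Ext.addEquiv₀.symm).toAddMonoidHom, ?_, fun f => ⟨fun h => ?_, ?_⟩⟩
  · intro x
    obtain ⟨y, hy⟩ := Ext.contravariant_sequence_exact₃ hS M x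
      (Ext.eq_zero_of_projective (n := 0) _) (show 1 + 0 = 1 from rfl)
    refine ⟨(e.trans Ext.addEquiv₀.symm).symm y, ?_⟩
    refine Eq.trans ?_ hy
    exact congrArg (hS.extClass.precomp M (show 1 + 0 = 1 from rfl))
      ((e.trans Ext.addEquiv₀.symm).apply_symm_apply y)
  · obtain ⟨x₂, hx₂⟩ := Ext.contravariant_sequence_exact₁ hS M (Ext.addEquiv₀.symm (e f))
      (show 1 + 0 = 1 from rfl) h
    refine ⟨(Ext.addEquiv₀ x₂).hom, ?_⟩
    have h1 : Ext.mk₀ (S.f ≫ Ext.addEquiv₀ x₂) = Ext.mk₀ (e f) := by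
      rw [← Ext.mk₀_comp_mk₀, Ext.mk₀_addEquiv₀_apply]
      exact hx₂
    have h2 := (Ext.mk₀_bijective _ _).1 h1
    exact (congrArg ModuleCat.Hom.hom h2).symm
  · rintro ⟨g, rfl⟩
    have h1 : Ext.addEquiv₀.symm (e (g ∘ₗ S.f.hom)) =
        (Ext.mk₀ S.f).comp (Ext.mk₀ (ModuleCat.ofHom g)) (zero_add 0) := by
      rw [Ext.mk₀_comp_mk₀]; rfl
    change hS.extClass.comp (Ext.addEquiv₀.symm (e (g ∘ₗ S.f.hom)))
      (show 1 + 0 = 1 from rfl) = 0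
    rw [h1, ShortComplex.ShortExact.extClass_comp_assoc]

/-- The second extension group as classes of cocycles. -/
theorem exists_extTwo_hom {R : Type} [Ring R] {P0 P1 P2 P3 X M : Type}
    [AddCommGroup P0] [AddCommGroup P1] [AddCommGroup P2] [AddCommGroup P3] [AddCommGroup X]
    [AddCommGroup M] [Module R P0] [Module R P1] [Module R P2] [Module R P3] [Module R X]
    [Module R M] [Module.Projective R P0] [Module.Projective R P1]
    {ε : P0 →ₗ[R] X} {d1 : P1 →ₗ[R] P0} {d2 : P2 →ₗ[R] P1} {d3 : P3 →ₗ[R] P2}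
    (hε : Function.Surjective ε) (h1 : ∀ x, ε x = 0 ↔ ∃ y, d1 y = x)
    (h2 : ∀ x, d1 x = 0 ↔ ∃ y, d2 y = x) (h3 : ∀ x, d2 x = 0 ↔ ∃ y, d3 y = x) :
    ∃ Φ : (LinearMap.lcomp ℤ M d3).ker →+ Ext.{0} (ModuleCat.of R X) (ModuleCat.of R M) 2,
      Function.Surjective Φ ∧ ∀ f, Φ f = 0 ↔ ∃ g : P1 →ₗ[R] M, (f : P2 →ₗ[R] M) = g ∘ₗ d2 := by
  have hproj0 : Projective ε.shortComplexKer.X₂ := inferInstanceAs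
    (Projective (ModuleCat.of R P0))
  let d1' : P1 →ₗ[R] ε.ker := d1.codRestrict _ fun x => (h1 _).2 ⟨x, rfl⟩
  have hd1' : Function.Surjective d1' := by
    rintro ⟨x, hx⟩
    obtain ⟨y, rfl⟩ := (h1 x).1 hx
    exact ⟨y, rfl⟩
  have hproj1 : Projective d1'.shortComplexKer.X₂ := inferInstanceAs
    (Projective (ModuleCat.of R P1))
  let d2' : P2 →ₗ[R] d1'.ker := d2.codRestrict _ fun x => by
    rw [LinearMap.mem_ker]
    exact Subtype.ext ((h2 _).2 ⟨x, rfl⟩)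
  have hd2' : Function.Surjective d2' := by
    rintro ⟨x, hx⟩
    obtain ⟨y, rfl⟩ := (h2 x).1 (congrArg Subtype.val hx)
    exact ⟨y, rfl⟩
  obtain ⟨Θ⟩ := exists_addEquiv_of_projective (LinearMap.shortExact_shortComplexKer hε)
    (ModuleCat.of R M)
  obtain ⟨Φ, hΦ, hΦ'⟩ := exists_addMonoidHom_of_projective
    (LinearMap.shortExact_shortComplexKer hd1') (ModuleCat.of R M)
  let c : (d1'.ker →ₗ[R] M) →+ (LinearMap.lcomp ℤ M d3).ker :=
    { toFun := fun f => ⟨f ∘ₗ d2', by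
        rw [LinearMap.mem_ker]
        ext1 x
        have : d2' (d3 x) = 0 := Subtype.ext ((h3 _).2 ⟨x, rfl⟩)
        change f (d2' (d3 x)) = 0
        rw [this, map_zero]⟩
      map_zero' := rfl
      map_add' := fun _ _ => rfl }
  have hc : Function.Bijective c := by
    constructor
    · intro f g hfg
      ext1 x
      obtain ⟨y, rfl⟩ := hd2' x
      exact LinearMap.congr_fun (congrArg Subtype.val hfg) y
    · rintro ⟨f, hf⟩
      have hker : d2'.ker ≤ f.ker := by
        intro x hx
        obtain ⟨y, rfl⟩ := (h3 x).1 (congrArg Subtype.val hx)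
        exact LinearMap.congr_fun hf y
      refine ⟨(d2'.ker.liftQ f hker) ∘ₗ (d2'.quotKerEquivOfSurjective hd2').symm.toLinearMap, ?_⟩
      apply Subtype.ext
      ext1 x
      change d2'.ker.liftQ f hker ((d2'.quotKerEquivOfSurjective hd2').symm (d2' x)) = f x
      have : (d2'.quotKerEquivOfSurjective hd2').symm (d2' x) = d2'.ker.mkQ x := by
        rw [LinearEquiv.symm_apply_eq]; rfl
      rw [this, Submodule.mkQ_apply, Submodule.liftQ_apply]
  let ce := AddEquiv.ofBijective c hc
  refine ⟨Θ.toAddMonoidHom.comp (Φ.comp ce.symm.toAddMonoidHom), ?_, fun f => ?_⟩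
  · exact Θ.surjective.comp (hΦ.comp ce.symm.surjective)
  · obtain ⟨f', rfl⟩ := ce.surjective f
    change Θ (Φ (ce.symm (ce f'))) = 0 ↔ _
    rw [ce.symm_apply_apply, EmbeddingLike.map_eq_zero_iff, hΦ']
    refine exists_congr fun g => ⟨fun h => ?_, fun h => ?_⟩
    · rw [h]; rfl
    · ext1 x
      obtain ⟨y, rfl⟩ := hd2' x
      exact LinearMap.congr_fun h y

end extTwo

/-! ### Homomorphisms from the terms of the resolution -/

section homFamilies

variable {n r : ℕ} [NeZero n]

/-- The word with the letter `i` at all places of the block number `i`. -/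
def blockWord (n r : ℕ) [NeZero n] (B : Finset ℕ) : TWord n r := fun i => Fin.ofNat n (blockIdx B i)

lemma blockIdx_le_card (B : Finset ℕ) (i : ℕ) : blockIdx B i ≤ B.card :=
  Finset.card_le_card (Finset.filter_subset _ _)

lemma wordCol_blockWord {B : Finset ℕ} (h : B.card < n) :
    wordCol (blockWord n r B) = blockCol r B := by
  ext1 i
  exact Nat.mod_eq_of_lt ((blockIdx_le_card B i).trans_lt h)

/-- The map `collapse τ` on the letters of the natural module. -/
def collapseFin (n τ : ℕ) (x : Fin n) : Fin n :=
  ⟨collapse τ x, lt_of_le_of_lt (by rw [collapse]; split_ifs <;> omega) x.2⟩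

lemma blockWord_erase {B : Finset ℕ} (h : B.card < n) {t : ℕ} (ht : t ∈ B) :
    blockWord n r (B.erase t) = collapseFin n (rk B t) ∘ blockWord n r B := by
  ext1 i
  apply Fin.ext
  have h1 := (blockIdx_le_card B i).trans_lt h
  have h2 := (blockIdx_le_card (B.erase t) i).trans_lt
    ((Finset.card_le_card (Finset.erase_subset t B)).trans_lt h)
  change blockIdx (B.erase t) i % n = collapse (rk B t) (blockIdx B i % n)
  rw [Nat.mod_eq_of_lt h1, Nat.mod_eq_of_lt h2, blockIdx_erase ht]

/-- Shortcut instance: the general search is slow. -/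
instance resPartModule (I : Finset ℕ) (q : ℕ) :
    Module (schurAlgebra n r) (resPart n r I q) := Submodule.module _

/-- Shortcut instance: the general search is slow. -/
instance resPartSMul (I : Finset ℕ) (q : ℕ) :
    SMul (schurAlgebra n r) (resPart n r I q) := (resPartModule I q).toSMul

/-- The coordinate of a family at `B` with respect to the generator `blockWord B` of the module of
tensors symmetric in the blocks (zero if there are not enough letters). -/
def blockTransfer (I : Finset ℕ) (q : ℕ) (B : Finset ℕ) :
    resPart n r I q →ₗ[schurAlgebra n r] schurAlgebra n r :=
  if h : B.card < n then
    (transfer (blockWord n r B)).comp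
      (((LinearMap.proj B).comp (resPart n r I q).subtype).codRestrict
        (invariants n (wordCol (blockWord n r B)))
        fun x => by rw [wordCol_blockWord h]; exact x.2.1 B)
  else 0

lemma blockTransfer_smul {I : Finset ℕ} {q : ℕ} {B : Finset ℕ} (h : B.card < n)
    (x : resPart n r I q) :
    blockTransfer I q B x • wordBasis n r (blockWord n r B) = x.1 B := by
  rw [blockTransfer, dif_pos h]
  exact transfer_smul_self _

lemma blockTransfer_eq_subst {I : Finset ℕ} {q : ℕ} {B : Finset ℕ} (h : B.card < n)
    {x : resPart n r I q} {π : Fin n → Fin n} (hx : x.1 B = wordBasis n r (π ∘ blockWord n r B)) :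
    blockTransfer I q B x = subst r π * weightIdem (blockWord n r B) := by
  rw [← transfer_subst, blockTransfer, dif_pos h]
  exact congrArg (transfer (blockWord n r B)) (Subtype.ext hx)

lemma blockTransfer_eq_zero {I : Finset ℕ} {q : ℕ} {B : Finset ℕ} {x : resPart n r I q}
    (hx : x.1 B = 0) : blockTransfer I q B x = 0 := by
  rw [blockTransfer]
  split_ifs with h
  · exact (congrArg (transfer (blockWord n r B)) (Subtype.ext hx)).trans (map_zero _)
  · rfl

open Classical in
/-- The generator of a term of the resolution indexed by `B` (zero unless `B` is an index of the
term). -/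
def blockGen (n r : ℕ) [NeZero n] (I : Finset ℕ) (q : ℕ) (B : Finset ℕ) : resPart n r I q :=
  if h : B.card < n ∧ B ⊆ I ∧ B.card + q = I.card then
    ⟨Pi.single B (wordBasis n r (blockWord n r B)), by
      refine ⟨fun B' => ?_, fun B' hB' => ?_⟩
      · by_cases hB : B' = B
        · subst hB
          rw [Pi.single_eq_same, ← wordCol_blockWord h.1]
          exact wordBasis_mem_invariants id _
        · rw [Pi.single_eq_of_ne hB]
          exact zero_mem _
      · by_cases hB : B' = B
        · rw [hB]; exact h.2
        · rw [Pi.single_eq_of_ne hB] at hB'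
          exact absurd rfl hB'⟩
  else 0

lemma blockGen_val {I : Finset ℕ} {q : ℕ} {B : Finset ℕ}
    (h : B.card < n ∧ B ⊆ I ∧ B.card + q = I.card) :
    (blockGen n r I q B).1 = Pi.single B (wordBasis n r (blockWord n r B)) := by
  rw [blockGen, dif_pos h]

lemma blockGen_eq_zero {I : Finset ℕ} {q : ℕ} {B : Finset ℕ}
    (h : ¬ (B.card < n ∧ B ⊆ I ∧ B.card + q = I.card)) : blockGen n r I q B = 0 := by
  rw [blockGen, dif_neg h]

lemma blockGen_apply_of_ne {I : Finset ℕ} {q : ℕ} {B B' : Finset ℕ} (h : B' ≠ B) :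
    (blockGen n r I q B).1 B' = 0 := by
  by_cases hB : B.card < n ∧ B ⊆ I ∧ B.card + q = I.card
  · rw [blockGen_val hB, Pi.single_eq_of_ne h]
  · rw [blockGen_eq_zero hB]; rfl

lemma sum_blockTransfer_smul {I : Finset ℕ} (hI : I.card < n) {q : ℕ} (x : resPart n r I q) :
    ∑ B ∈ I.powerset, blockTransfer I q B x • blockGen n r I q B = x := by
  apply Subtype.ext
  rw [AddSubmonoidClass.coe_finsetSum]
  ext1 B
  rw [Finset.sum_apply]
  by_cases h : B ⊆ I ∧ B.card + q = I.card
  · have hB : B.card < n := (Finset.card_le_card h.1).trans_lt hI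
    rw [Finset.sum_eq_single B]
    · rw [Submodule.coe_smul, Pi.smul_apply, blockGen_val ⟨hB, h⟩, Pi.single_eq_same,
        blockTransfer_smul hB]
    · intro B' _ hne
      rw [Submodule.coe_smul, Pi.smul_apply, blockGen_apply_of_ne hne.symm, smul_zero]
    · intro h'
      exact absurd (Finset.mem_powerset.2 h.1) h'
  · rw [Finset.sum_eq_zero]
    · by_contra h'
      exact h (x.2.2 B (Ne.symm h'))
    · intro B' _
      rw [Submodule.coe_smul, Pi.smul_apply]
      by_cases hne : B = B'
      · rw [blockGen_eq_zero fun h' => h (hne ▸ h'.2)]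
        exact smul_zero _
      · rw [blockGen_apply_of_ne hne, smul_zero]

lemma projective_resPart {I : Finset ℕ} (hI : I.card < n) (q : ℕ) :
    Module.Projective (schurAlgebra n r) (resPart n r I q) := by
  refine Module.Projective.of_split
    (LinearMap.pi fun B : I.powerset => blockTransfer I q (B : Finset ℕ))
    (Fintype.linearCombination (schurAlgebra n r)
      fun B : I.powerset => blockGen n r I q (B : Finset ℕ)) ?_
  ext1 x
  rw [LinearMap.comp_apply, Fintype.linearCombination_apply, LinearMap.id_apply]
  conv_rhs => rw [← sum_blockTransfer_smul hI x]
  exact Finset.sum_coe_sort I.powerset fun B => blockTransfer I q B x • blockGen n r I q B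

variable {M : Type} [AddCommGroup M] [Module (schurAlgebra n r) M]

/-- The effect on a module over the Schur algebra of identifying the letters `τ` and `τ + 1`. -/
def letterMap (n r : ℕ) (M : Type) [AddCommGroup M] [Module (schurAlgebra n r) M] (τ : ℕ) :
    M →ₗ[ℤ] M :=
  (DistribSMul.toAddMonoidHom M (subst r (collapseFin n τ) : schurAlgebra n r)).toIntLinearMap

/-- The families of weight vectors that describe the homomorphisms to `M` from the term of degree
`q` of the resolution. -/
def famPart (n r : ℕ) [NeZero n] (M : Type) [AddCommGroup M] [Module (schurAlgebra n r) M]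
    (I : Finset ℕ) (q : ℕ) : Submodule ℤ (Finset ℕ → M) where
  carrier := {m | (∀ B, weightIdem (blockWord n r B) • m B = m B) ∧
    ∀ B, m B ≠ 0 → B ⊆ I ∧ B.card + q = I.card}
  add_mem' := by
    rintro x y ⟨hx, hx'⟩ ⟨hy, hy'⟩
    refine ⟨fun B => ?_, fun B hB => ?_⟩
    · rw [Pi.add_apply, smul_add, hx, hy]
    · by_cases h : x B = 0
      · exact hy' B (by simpa [h] using hB)
      · exact hx' B h
  zero_mem' := ⟨fun B => smul_zero _, fun B h => absurd rfl h⟩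
  smul_mem' := by
    rintro c x ⟨hx, hx'⟩
    refine ⟨fun B => ?_, fun B hB => hx' B fun h => hB ?_⟩
    · rw [Pi.smul_apply, smul_comm, hx]
    · rw [Pi.smul_apply, h, smul_zero]

/-- The homomorphism described by a family. -/
def famHom (I : Finset ℕ) (q : ℕ) :
    (Finset ℕ → M) →+ (resPart n r I q →ₗ[schurAlgebra n r] M) where
  toFun m := ∑ B ∈ I.powerset,
    (LinearMap.toSpanSingleton (schurAlgebra n r) M (m B)).comp (blockTransfer I q B)
  map_zero' := by
    ext1 x
    rw [LinearMap.sum_apply]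
    exact Finset.sum_eq_zero fun B _ => smul_zero _
  map_add' m m' := by
    ext1 x
    rw [LinearMap.add_apply, LinearMap.sum_apply, LinearMap.sum_apply, LinearMap.sum_apply,
      ← Finset.sum_add_distrib]
    exact Finset.sum_congr rfl fun B _ => smul_add _ _ _

lemma famHom_apply {I : Finset ℕ} {q : ℕ} (m : Finset ℕ → M) (x : resPart n r I q) :
    famHom I q m x = ∑ B ∈ I.powerset, blockTransfer I q B x • m B := LinearMap.sum_apply _ _ _

lemma blockTransfer_blockGen {I : Finset ℕ} {q : ℕ} {B : Finset ℕ}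
    (h : B.card < n ∧ B ⊆ I ∧ B.card + q = I.card) :
    blockTransfer I q B (blockGen n r I q B) = weightIdem (blockWord n r B) := by
  have h1 : subst r (id : Fin n → Fin n) = 1 := by
    apply schur_ext
    intro w
    rw [subst_wordBasis, one_smul]; rfl
  rw [blockTransfer_eq_subst h.1 (π := id), h1, one_mul]
  rw [blockGen_val h, Pi.single_eq_same]; rfl

lemma famHom_blockGen {I : Finset ℕ} {q : ℕ} {B : Finset ℕ}
    (h : B.card < n ∧ B ⊆ I ∧ B.card + q = I.card) {m : Finset ℕ → M}
    (hm : m ∈ famPart n r M I q) : famHom I q m (blockGen n r I q B) = m B := by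
  rw [famHom_apply, Finset.sum_eq_single B, blockTransfer_blockGen h, hm.1]
  · intro B' _ hne
    rw [blockTransfer_eq_zero (blockGen_apply_of_ne hne), zero_smul]
  · intro h'
    exact absurd (Finset.mem_powerset.2 h.2.1) h'

lemma famHom_injOn {I : Finset ℕ} (hI : I.card < n) {q : ℕ} {m : Finset ℕ → M}
    (hm : m ∈ famPart n r M I q) (h0 : famHom (n := n) (r := r) I q m = 0) : m = 0 := by
  ext1 B
  by_contra h
  have h1 := hm.2 B h
  rw [← famHom_blockGen ⟨(Finset.card_le_card h1.1).trans_lt hI, h1⟩ hm, h0] at h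
  exact h rfl

lemma exists_famHom_eq {I : Finset ℕ} (hI : I.card < n) {q : ℕ}
    (f : resPart n r I q →ₗ[schurAlgebra n r] M) : ∃ m ∈ famPart n r M I q, famHom I q m = f := by
  refine ⟨fun B => f (blockGen n r I q B), ⟨fun B => ?_, fun B hB => ?_⟩, ?_⟩
  · beta_reduce
    rw [← map_smul]
    by_cases h : B.card < n ∧ B ⊆ I ∧ B.card + q = I.card
    · congr 1
      apply Subtype.ext
      ext1 B'
      rw [Submodule.coe_smul, Pi.smul_apply]
      by_cases hne : B' = B
      · classical
        rw [hne, blockGen_val h, Pi.single_eq_same, weightIdem_wordBasis, if_pos]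
        exact ⟨1, rfl⟩
      · rw [blockGen_apply_of_ne hne, smul_zero]
    · rw [blockGen_eq_zero h, smul_zero]
  · by_contra h
    apply hB
    beta_reduce
    rw [blockGen_eq_zero fun h' => h h'.2, map_zero]
  · ext1 x
    rw [famHom_apply]
    conv_rhs => rw [← sum_blockTransfer_smul hI x, map_sum]
    exact Finset.sum_congr rfl fun B _ => (map_smul f _ _).symm

/-- The differential of the resolution. -/
def resD (n r : ℕ) (I : Finset ℕ) (q : ℕ) :
    resPart n r I (q + 1) →ₗ[schurAlgebra n r] resPart n r I q :=
  ((bdry (schurAlgebra n r) I).comp (resPart n r I (q + 1)).subtype).codRestrict _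
    fun x => bdry_mem x.2

lemma resD_blockGen_apply {I : Finset ℕ} {q : ℕ} {B : Finset ℕ}
    (h : B.card < n ∧ B ⊆ I ∧ B.card + (q + 1) = I.card) (B' : Finset ℕ) :
    (resD n r I q (blockGen n r I (q + 1) B)).1 B' =
      ∑ t ∈ I \ B, if insert t B = B' then sgn B t • wordBasis n r (blockWord n r B) else 0 := by
  change bdry (schurAlgebra n r) I (blockGen n r I (q + 1) B).1 B' = _
  rw [bdry_apply, blockGen_val h]
  symm
  rw [← Finset.sum_filter]
  refine Finset.sum_subset_zero_on_sdiff (fun t ht => ?_) (fun t ht => ?_) fun t ht => ?_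
  · rw [Finset.mem_filter, Finset.mem_sdiff] at ht
    rw [Finset.mem_inter, ← ht.2]
    exact ⟨Finset.mem_insert_self _ _, ht.1.1⟩
  · rw [Finset.mem_sdiff, Finset.mem_inter, Finset.mem_filter, Finset.mem_sdiff] at ht
    rw [Pi.single_eq_of_ne, smul_zero]
    intro hB
    apply ht.2
    rw [← hB]
    exact ⟨⟨ht.1.2, Finset.notMem_erase _ _⟩, Finset.insert_erase ht.1.1⟩
  · rw [Finset.mem_filter, Finset.mem_sdiff] at ht
    rw [← ht.2, Finset.erase_insert ht.1.2, Pi.single_eq_same, sgn_insert_of_ge le_rfl]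

/-- Composition with the differential of the resolution is the coboundary operator on families. -/
lemma famHom_comp_resD {I : Finset ℕ} (hI : I.card < n) {q : ℕ} {m : Finset ℕ → M}
    (hm : m ∈ famPart n r M I q) :
    coboundary I (letterMap n r M) m ∈ famPart n r M I (q + 1) ∧
      famHom I (q + 1) (coboundary I (letterMap n r M) m) = famHom I q m ∘ₗ resD n r I q := by
  obtain ⟨m', hm', hmm'⟩ := exists_famHom_eq hI (famHom I q m ∘ₗ resD n r I q)
  suffices h : coboundary I (letterMap n r M) m = m' by
    rw [h]; exact ⟨hm', hmm'⟩
  ext1 B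
  rw [coboundary_apply]
  by_cases h : B ⊆ I ∧ B.card + (q + 1) = I.card
  · have hB : B.card < n := (Finset.card_le_card h.1).trans_lt hI
    rw [← famHom_blockGen ⟨hB, h⟩ hm', hmm', LinearMap.comp_apply, famHom_apply]
    have hsub : ∀ t ∈ I \ B, insert t B ⊆ I := by
      intro t ht
      rw [Finset.mem_sdiff] at ht
      exact Finset.insert_subset ht.1 h.1
    have hinj : ∀ t ∈ I \ B, ∀ t' ∈ I \ B, insert t B = insert t' B → t = t' := by
      intro t ht t' _ htt
      have h1 : t ∈ insert t' B := htt ▸ Finset.mem_insert_self t B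
      rcases Finset.mem_insert.1 h1 with h2 | h2
      · exact h2
      · exact absurd h2 (Finset.mem_sdiff.1 ht).2
    have key : ∀ B' ∈ I.powerset,
        blockTransfer I q B' (resD n r I q (blockGen n r I (q + 1) B)) • m B' =
          ∑ t ∈ I \ B, if insert t B = B' then
            sgn B t • letterMap n r M (rk B t) (m (insert t B)) else 0 := by
      intro B' _
      by_cases hex : ∃ t ∈ I \ B, insert t B = B'
      · obtain ⟨t, ht, rfl⟩ := hex
        have htB := (Finset.mem_sdiff.1 ht).2
        have hcard : (insert t B).card < n := (Finset.card_le_card (hsub t ht)).trans_lt hI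
        have h1 : (resD n r I q (blockGen n r I (q + 1) B)).1 (insert t B) =
            sgn B t • wordBasis n r (blockWord n r B) := by
          rw [resD_blockGen_apply ⟨hB, h⟩, Finset.sum_eq_single t]
          · rw [if_pos rfl]
          · intro t' ht' hne
            rw [if_neg fun h' => hne (hinj t' ht' t ht h')]
          · intro h'; exact absurd ht h'
        rw [Finset.sum_eq_single t, if_pos rfl]
        · have h2 : blockWord n r B =
              collapseFin n (rk B t) ∘ blockWord n r (insert t B) := by
            have := blockWord_erase (r := r) hcard (Finset.mem_insert_self t B)
            rwa [Finset.erase_insert htB, rk_insert_self] at this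
          have h3 : blockTransfer I q (insert t B)
              (sgn B t • resD n r I q (blockGen n r I (q + 1) B)) =
              subst r (collapseFin n (rk B t)) * weightIdem (blockWord n r (insert t B)) := by
            refine blockTransfer_eq_subst hcard ?_
            rw [← h2]
            change sgn B t • (resD n r I q (blockGen n r I (q + 1) B)).1 (insert t B) = _
            rw [h1, ← mul_smul, sgn_mul_self, one_smul]
          have h4 : blockTransfer I q (insert t B) (resD n r I q (blockGen n r I (q + 1) B)) =
              sgn B t • (subst r (collapseFin n (rk B t)) *
                weightIdem (blockWord n r (insert t B))) := by
            have h5 := map_zsmul (blockTransfer I q (insert t B)) (sgn B t)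
              (resD n r I q (blockGen n r I (q + 1) B))
            rw [h3] at h5
            rw [h5, ← mul_smul, sgn_mul_self, one_smul]
          rw [h4, smul_assoc, mul_smul, hm.1]
          rfl
        · intro t' ht' hne
          rw [if_neg fun h' => hne (hinj t' ht' t ht h')]
        · intro h'; exact absurd ht h'
      · have hne : ∀ t ∈ I \ B, ¬ insert t B = B' := fun t ht h' => hex ⟨t, ht, h'⟩
        rw [blockTransfer_eq_zero, zero_smul]
        · exact (Finset.sum_eq_zero fun t ht => if_neg (hne t ht)).symm
        · rw [resD_blockGen_apply ⟨hB, h⟩]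
          exact Finset.sum_eq_zero fun t ht => if_neg (hne t ht)
    rw [Finset.sum_congr rfl key, Finset.sum_comm]
    refine Finset.sum_congr rfl fun t ht => ?_
    rw [Finset.sum_ite_eq, if_pos (Finset.mem_powerset.2 (hsub t ht))]
  · have h1 : m' B = 0 := by
      by_contra h'
      exact h (hm'.2 B h')
    rw [h1]
    refine Finset.sum_eq_zero fun t ht => ?_
    rw [Finset.mem_sdiff] at ht
    have h2 : m (insert t B) = 0 := by
      by_contra h'
      obtain ⟨h3, h4⟩ := hm.2 _ h'
      rw [Finset.card_insert_of_notMem ht.2] at h4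
      exact h ⟨(Finset.subset_insert t B).trans h3, by omega⟩
    rw [h2, map_zero, smul_zero]

end homFamilies

/-! ### Words attached to lists of letters -/

section listWords

/-- The divided power part of a list of letters: the letter number `c` contributes `u` entries `c`
if it is `x^{(u)} y^ε`; the numbering begins at `s`. -/
def xEntries : ℕ → List Letter → List ℕ
  | _, [] => []
  | s, w :: L => List.replicate w.1 s ++ xEntries (s + 1) L

/-- The exterior part of a list of letters: the letter number `c` contributes `ε` entries `c`
if it is `x^{(u)} y^ε`; the numbering begins at `s`. -/
def yEntries : ℕ → List Letter → List ℕ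
  | _, [] => []
  | s, w :: L => (if w.2 then [s] else []) ++ yEntries (s + 1) L

lemma length_xEntries (s : ℕ) (L : List Letter) :
    (xEntries s L).length = (L.map Prod.fst).sum := by
  induction L generalizing s with
  | nil => rfl
  | cons w L ih => simp [xEntries, ih]

lemma length_yEntries (s : ℕ) (L : List Letter) : (yEntries s L).length = L.countP (·.2) := by
  induction L generalizing s with
  | nil => rfl
  | cons w L ih =>
    rw [yEntries, List.length_append, ih, List.countP_cons]
    split_ifs <;> simp [add_comm]

lemma mem_xEntries {s c : ℕ} {L : List Letter} (h : c ∈ xEntries s L) :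
    s ≤ c ∧ c < s + L.length := by
  induction L generalizing s with
  | nil => simp [xEntries] at h
  | cons w L ih =>
    rw [xEntries, List.mem_append] at h
    rw [List.length_cons]
    rcases h with h | h
    · have := List.eq_of_mem_replicate h; omega
    · have := ih h; omega

lemma mem_yEntries {s c : ℕ} {L : List Letter} (h : c ∈ yEntries s L) :
    s ≤ c ∧ c < s + L.length := by
  induction L generalizing s with
  | nil => simp [yEntries] at h
  | cons w L ih =>
    rw [yEntries, List.mem_append] at h
    rw [List.length_cons]
    rcases h with h | h
    · split_ifs at h
      · rw [List.mem_singleton] at h; omega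
      · simp at h
    · have := ih h; omega

lemma count_xEntries (s c : ℕ) (L : List Letter) :
    (xEntries s L).count (s + c) = (L.getD c (0, false)).1 := by
  induction L generalizing s c with
  | nil => simp [xEntries]
  | cons w L ih =>
    rw [xEntries, List.count_append]
    cases c with
    | zero =>
      rw [add_zero, List.count_replicate_self, List.getD_cons_zero, List.count_eq_zero.2, add_zero]
      intro h
      have := mem_xEntries h; omega
    | succ c =>
      rw [List.count_replicate, if_neg (by simp), zero_add, List.getD_cons_succ, ← ih (s + 1) c]
      congr 1; omega

lemma count_yEntries (s c : ℕ) (L : List Letter) :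
    (yEntries s L).count (s + c) = (L.getD c (0, false)).2.toNat := by
  induction L generalizing s c with
  | nil => simp [yEntries]
  | cons w L ih =>
    rw [yEntries, List.count_append]
    cases c with
    | zero =>
      have h0 : (yEntries (s + 1) L).count s = 0 := by
        rw [List.count_eq_zero]
        intro h
        have := mem_yEntries h; omega
      rw [add_zero, List.getD_cons_zero, h0, add_zero]
      cases w.2 <;> simp
    | succ c =>
      rw [List.getD_cons_succ, ← ih (s + 1) c, List.count_eq_zero.2, zero_add]
      · congr 1; omega
      · split_ifs <;> simp

lemma pairwise_yEntries (s : ℕ) (L : List Letter) : (yEntries s L).Pairwise (· < ·) := by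
  induction L generalizing s with
  | nil => exact List.Pairwise.nil
  | cons w L ih =>
    rw [yEntries, List.pairwise_append]
    refine ⟨by split_ifs <;> simp, ih _, fun x hx y hy => ?_⟩
    have h1 := mem_yEntries hy
    split_ifs at hx
    · rw [List.mem_singleton] at hx; omega
    · simp at hx

lemma map_collapse_xEntries {s t : ℕ} (h : t ≤ s) (L : List Letter) :
    (xEntries (s + 1) L).map (collapse t) = xEntries s L := by
  induction L generalizing s with
  | nil => rfl
  | cons w L ih =>
    rw [xEntries, xEntries, List.map_append, ih (by omega), List.map_replicate]
    simp [collapse, Nat.lt_succ_of_le h]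

lemma map_collapse_yEntries {s t : ℕ} (h : t ≤ s) (L : List Letter) :
    (yEntries (s + 1) L).map (collapse t) = yEntries s L := by
  induction L generalizing s with
  | nil => rfl
  | cons w L ih =>
    rw [yEntries, yEntries, List.map_append, ih (by omega)]
    split_ifs <;> simp [collapse, Nat.lt_succ_of_le h]

lemma xEntries_mergeAt {s τ : ℕ} {L : List Letter} (h : τ + 1 < L.length) :
    xEntries s (mergeAt τ L) = (xEntries s L).map (collapse (s + τ)) := by
  induction L generalizing s τ with
  | nil => simp at h
  | cons w L ih =>
    cases τ with
    | zero =>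
      rcases L with _ | ⟨w', L⟩
      · simp at h
      · rw [mergeAt, xEntries, xEntries, xEntries, List.map_append, List.map_append,
          map_collapse_xEntries (by omega), List.map_replicate, List.map_replicate]
        simp [collapse, ← List.append_assoc]
    | succ τ =>
      rw [mergeAt, xEntries, xEntries, ih (by simpa using h), List.map_append,
        List.map_replicate]
      have : collapse (s + (τ + 1)) s = s := by rw [collapse, if_neg (by omega)]
      rw [this, show s + 1 + τ = s + (τ + 1) by omega]

lemma mergeCoeff_eq {τ : ℕ} {L : List Letter} (h : τ + 1 < L.length) :
    mergeCoeff τ L = if (L.getD τ (0, false)).2 && (L.getD (τ + 1) (0, false)).2 then 0 else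
      (((L.getD τ (0, false)).1 + (L.getD (τ + 1) (0, false)).1).choose
        (L.getD τ (0, false)).1 : ℤ) := by
  induction L generalizing τ with
  | nil => simp at h
  | cons w L ih =>
    cases τ with
    | zero =>
      rcases L with _ | ⟨w', L⟩
      · simp at h
      · rfl
    | succ τ =>
      rw [mergeCoeff, ih (by simpa using h), List.getD_cons_succ, List.getD_cons_succ]

lemma yEntries_mergeAt {s τ : ℕ} {L : List Letter} (h : τ + 1 < L.length)
    (hy : ((L.getD τ (0, false)).2 && (L.getD (τ + 1) (0, false)).2) = false) :
    yEntries s (mergeAt τ L) = (yEntries s L).map (collapse (s + τ)) := by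
  induction L generalizing s τ with
  | nil => simp at h
  | cons w L ih =>
    cases τ with
    | zero =>
      rcases L with _ | ⟨w', L⟩
      · simp at h
      · rw [mergeAt, yEntries, yEntries, yEntries, List.map_append, List.map_append,
          map_collapse_yEntries (by omega)]
        rcases w with ⟨u, _ | _⟩ <;> rcases w' with ⟨u', _ | _⟩ <;> simp_all [collapse]
    | succ τ =>
      rw [mergeAt, yEntries, yEntries, ih (by simpa using h) (by simpa using hy), List.map_append]
      have : collapse (s + (τ + 1)) s = s := by rw [collapse, if_neg (by omega)]
      rw [show s + 1 + τ = s + (τ + 1) by omega]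
      split_ifs <;> simp [this]

lemma card_fin_filter (r : ℕ) (P : ℕ → Prop) [DecidablePred P] :
    (Finset.univ.filter fun i : Fin r => P i).card = Nat.count P r := by
  rw [Nat.count_eq_card_filter_range]
  refine Finset.card_bij (fun i _ => (i : ℕ)) ?_ ?_ ?_
  · intro i hi
    simpa using hi
  · intro i _ j _ h
    exact Fin.ext h
  · intro j hj
    rw [Finset.mem_filter, Finset.mem_range] at hj
    exact ⟨⟨j, hj.1⟩, by simpa using hj.2, rfl⟩

lemma count_getD_append (l l' : List ℕ) (c : ℕ) {r : ℕ} (h : l.length ≤ r) :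
    Nat.count (fun i => i < l.length ∧ (l ++ l').getD i 0 = c) r = l.count c := by
  induction l generalizing r with
  | nil => simp
  | cons x l ih =>
    obtain ⟨r, rfl⟩ : ∃ r', r = r' + 1 := ⟨r - 1, by simp at h; omega⟩
    rw [Nat.count_succ', List.count_cons]
    simp only [List.length_cons, Nat.add_lt_add_iff_right, List.cons_append, List.getD_cons_succ,
      List.getD_cons_zero, Nat.zero_lt_succ, true_and, beq_iff_eq]
    rw [ih (by simpa using h)]

lemma count_getD (l : List ℕ) (c : ℕ) :
    Nat.count (fun i => l.getD i 0 = c) l.length = l.count c := by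
  induction l with
  | nil => simp
  | cons x l ih =>
    rw [List.length_cons, Nat.count_succ', List.count_cons]
    simp only [List.getD_cons_succ, List.getD_cons_zero, beq_iff_eq]
    rw [ih]

lemma count_blockIdx_bars (s c : ℕ) {L : List Letter} (hL : ∀ w ∈ L, w ≠ (0, false)) :
    Nat.count (fun i => blockIdx (bars s L) (s + i) = c) (L.map Letter.deg).sum =
      (L.getD c (0, false)).deg := by
  induction L generalizing s c with
  | nil => simp [Letter.deg]
  | cons w L ih =>
    have hL' : ∀ w ∈ L, w ≠ (0, false) := fun w hw => hL w (by simp [hw])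
    have hlow : ∀ i < w.deg, blockIdx (bars s (w :: L)) (s + i) = 0 := by
      intro i hi
      rw [blockIdx, Finset.card_eq_zero, Finset.filter_eq_empty_iff]
      intro t ht
      rcases L with _ | ⟨w', L⟩
      · simp [bars] at ht
      · rw [bars, Finset.mem_insert] at ht
        rcases ht with rfl | ht
        · omega
        · have := lt_of_mem_bars hL' ht
          omega
    rw [List.map_cons, List.sum_cons, Nat.count_add]
    have h1 : Nat.count (fun i => blockIdx (bars s (w :: L)) (s + i) = c) w.deg =
        if c = 0 then w.deg else 0 := by
      rw [Nat.count_eq_card_filter_range]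
      split_ifs with hc
      · rw [Finset.filter_true_of_mem, Finset.card_range]
        intro i hi
        rw [hlow i (Finset.mem_range.1 hi), hc]
      · rw [Finset.filter_false_of_mem, Finset.card_empty]
        intro i hi
        rw [hlow i (Finset.mem_range.1 hi)]
        exact Ne.symm hc
    rw [h1]
    rcases L with _ | ⟨w', L⟩
    · cases c <;> simp [Letter.deg]
    · have hhigh : ∀ j, blockIdx (bars s (w :: w' :: L)) (s + (w.deg + j)) =
          blockIdx (bars (s + w.deg) (w' :: L)) (s + w.deg + j) + 1 := by
        intro j
        rw [bars, blockIdx, blockIdx, Finset.filter_insert, if_pos (by omega),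
          Finset.card_insert_of_notMem, add_assoc]
        intro h
        exact not_mem_bars hL' (Finset.mem_filter.1 h).1
      simp only [hhigh]
      cases c with
      | zero => simp
      | succ c =>
        simp only [Nat.add_right_cancel_iff, List.getD_cons_succ]
        rw [ih _ _ hL']
        simp

variable {n r : ℕ} [NeZero n]

/-- The word attached to a list of letters: the divided power part followed by the exterior
part. -/
def listWord (n r : ℕ) [NeZero n] (L : List Letter) : TWord n r :=
  fun i => Fin.ofNat n ((xEntries 0 L ++ yEntries 0 L).getD i 0)

lemma listWord_val {L : List Letter} (hL : L.length ≤ n) (i : Fin r) :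
    (listWord n r L i : ℕ) = (xEntries 0 L ++ yEntries 0 L).getD i 0 := by
  refine Nat.mod_eq_of_lt ?_
  by_cases h : (i : ℕ) < (xEntries 0 L ++ yEntries 0 L).length
  · rw [List.getD_eq_getElem _ _ h]
    have h1 := List.getElem_mem h
    rw [List.mem_append] at h1
    rcases h1 with h1 | h1
    · have := mem_xEntries h1; omega
    · have := mem_yEntries h1; omega
  · rw [List.getD_eq_default _ _ (by omega)]
    exact Nat.pos_of_ne_zero (NeZero.ne n)

variable {a p q N i : ℕ} {L : List Letter}

lemma card_listWord_row (hL : L ∈ barIndex a p q N i) (hn : L.length ≤ n) (hr : r = p + q)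
    (c : ℕ) : (Finset.univ.filter fun j : Fin r => (j : ℕ) < p ∧ (listWord n r L j : ℕ) = c).card =
      (L.getD c (0, false)).1 := by
  simp only [listWord_val hn]
  have hp : p = (xEntries 0 L).length := by rw [length_xEntries, hL.2.1]
  rw [card_fin_filter r fun j => j < p ∧ (xEntries 0 L ++ yEntries 0 L).getD j 0 = c]
  conv_lhs => rw [hp]
  rw [count_getD_append _ _ _ (by omega), ← count_xEntries 0 c L, zero_add]

lemma card_listWord (hL : L ∈ barIndex a p q N i) (hn : L.length ≤ n) (hr : r = p + q)
    (c : ℕ) : (Finset.univ.filter fun j : Fin r => (listWord n r L j : ℕ) = c).card =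
      (L.getD c (0, false)).deg := by
  simp only [listWord_val hn]
  have hp : p = (xEntries 0 L).length := by rw [length_xEntries, hL.2.1]
  have hq : q = (yEntries 0 L).length := by rw [length_yEntries, hL.2.2.1]
  rw [card_fin_filter r fun j => (xEntries 0 L ++ yEntries 0 L).getD j 0 = c, hr]
  have h := count_getD (xEntries 0 L ++ yEntries 0 L) c
  rw [List.length_append, ← hp, ← hq] at h
  rw [h, List.count_append, Letter.deg, ← count_xEntries 0 c L, ← count_yEntries 0 c L, zero_add]

lemma card_listWord_tail (hL : L ∈ barIndex a p q N i) (hn : L.length ≤ n) (hr : r = p + q)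
    (c : ℕ) : (Finset.univ.filter fun j : Fin r => p ≤ (j : ℕ) ∧ (listWord n r L j : ℕ) = c).card =
      (L.getD c (0, false)).2.toNat := by
  have h1 := card_listWord hL hn hr c
  have h2 := card_listWord_row hL hn hr c
  rw [← Finset.card_filter_add_card_filter_not (p := fun j : Fin r => (j : ℕ) < p),
    Finset.filter_filter, Finset.filter_filter] at h1
  have h3 : (Finset.univ.filter fun j : Fin r => (listWord n r L j : ℕ) = c ∧ (j : ℕ) < p) =
      Finset.univ.filter fun j : Fin r => (j : ℕ) < p ∧ (listWord n r L j : ℕ) = c := by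
    ext j; simp only [Finset.mem_filter]; tauto
  have h4 : (Finset.univ.filter fun j : Fin r => (listWord n r L j : ℕ) = c ∧ ¬ (j : ℕ) < p) =
      Finset.univ.filter fun j : Fin r => p ≤ (j : ℕ) ∧ (listWord n r L j : ℕ) = c := by
    ext j; simp only [Finset.mem_filter, not_lt]; tauto
  rw [h3, h4, h2, Letter.deg] at h1
  omega

lemma listWord_lt_listWord (hL : L ∈ barIndex a p q N i) (hn : L.length ≤ n) (hr : r = p + q)
    {j k : Fin r} (hj : p ≤ (j : ℕ)) (hjk : j < k) : listWord n r L j < listWord n r L k := by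
  have hp : p = (xEntries 0 L).length := by rw [length_xEntries, hL.2.1]
  have hq : q = (yEntries 0 L).length := by rw [length_yEntries, hL.2.2.1]
  have hjk' : (j : ℕ) < k := hjk
  have hk := k.2
  rw [Fin.lt_def, listWord_val hn, listWord_val hn, List.getD_append_right _ _ _ _ (by omega),
    List.getD_append_right _ _ _ _ (by omega), List.getD_eq_getElem _ _ (by omega),
    List.getD_eq_getElem _ _ (by omega)]
  exact List.pairwise_iff_getElem.1 (pairwise_yEntries 0 L) _ _ _ _ (by omega)

lemma listWord_mergeAt {τ : ℕ} (hn : L.length ≤ n) (h : τ + 1 < L.length)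
    (hy : ((L.getD τ (0, false)).2 && (L.getD (τ + 1) (0, false)).2) = false) :
    listWord n r (mergeAt τ L) = collapseFin n τ ∘ listWord n r L := by
  have hlen : (mergeAt τ L).length ≤ n := by
    refine le_trans ?_ hn
    clear hn hy
    induction L generalizing τ with
    | nil => simp at h
    | cons w L ih =>
      cases τ with
      | zero =>
        rcases L with _ | ⟨w', L⟩
        · simp at h
        · simp [mergeAt]
      | succ τ =>
        rw [mergeAt, List.length_cons, List.length_cons]
        exact Nat.succ_le_succ (ih (by simpa using h))
  ext1 j
  apply Fin.ext
  change _ = collapse τ (listWord n r L j : ℕ)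
  rw [listWord_val hlen, listWord_val hn, xEntries_mergeAt h, yEntries_mergeAt h hy, zero_add,
    ← List.map_append]
  have h0 : collapse τ 0 = 0 := by simp [collapse]
  conv_lhs => rw [← h0]
  exact List.getD_map ..

lemma card_blockIdx_bars (hL : L ∈ barIndex a p q N i) (hr : r = p + q) (c : ℕ) :
    (Finset.univ.filter fun j : Fin r => blockIdx (bars 0 L) j = c).card =
      (L.getD c (0, false)).deg := by
  rw [card_fin_filter r fun j => blockIdx (bars 0 L) j = c, hr, ← sum_deg_eq hL,
    ← count_blockIdx_bars 0 c hL.2.2.2.1]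
  simp only [zero_add]

lemma blockWord_val {B : Finset ℕ} (h : B.card < n) (j : Fin r) :
    (blockWord n r B j : ℕ) = blockIdx B j := congrFun (wordCol_blockWord h) j

/-- The word of a list is a rearrangement of the word that fills the blocks. -/
lemma exists_listWord_eq (hL : L ∈ barIndex a p q N i) (hn : L.length ≤ n) (hr : r = p + q)
    (hb : (bars 0 L).card < n) :
    ∃ σ : Equiv.Perm (Fin r), listWord n r L = blockWord n r (bars 0 L) ∘ σ := by
  refine exists_perm_of_card_fiber _ _ fun c => ?_
  simp only [Fin.ext_iff, blockWord_val hb]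
  rw [card_blockIdx_bars hL hr, card_listWord hL hn hr]

end listWords

/-! ### Orbit sums symmetric in a row -/

section rowOrbits

variable {n r p : ℕ}

lemma blockIdx_Ico {c d i : ℕ} (hi : i < d) : blockIdx (Finset.Ico c d) i = i + 1 - c := by
  rw [blockIdx]
  have : (Finset.Ico c d).filter (· ≤ i) = Finset.Ico c (i + 1) := by
    ext t; simp only [Finset.mem_filter, Finset.mem_Ico]; omega
  rw [this, Nat.card_Ico]

/-- The colouring of the places in which the first `p` places have the same colour and the other
places have different colours. -/
abbrev rowCol (r p : ℕ) : Fin r → ℕ := blockCol r (Finset.Ico p r)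

lemma rowCol_apply (i : Fin r) : rowCol r p i = i + 1 - p := blockIdx_Ico i.2

lemma rowCol_eq_zero_iff (i : Fin r) : rowCol r p i = 0 ↔ (i : ℕ) < p := by
  rw [rowCol_apply]; omega

lemma rowCol_comp_iff {σ : Equiv.Perm (Fin r)} :
    rowCol r p ∘ σ = rowCol r p ↔ ∀ i : Fin r, p ≤ (i : ℕ) → σ i = i := by
  constructor
  · intro h i hi
    have h1 := congrFun h i
    rw [Function.comp_apply, rowCol_apply, rowCol_apply] at h1
    exact Fin.ext (by omega)
  · intro h
    ext1 i
    rw [Function.comp_apply]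
    by_cases hi : p ≤ (i : ℕ)
    · rw [h i hi]
    · have h1 : ¬ p ≤ (σ i : ℕ) := by
        intro h'
        have := σ.injective (h _ h')
        rw [this] at h'
        exact hi h'
      rw [(rowCol_eq_zero_iff _).2 (by omega), (rowCol_eq_zero_iff _).2 (by omega)]

lemma symTensors_row (n r p : ℕ) :
    symTensors n r {i | (i : ℕ) < p} = invariants n (rowCol r p) := by
  ext x
  rw [mem_invariants]
  refine forall_congr' fun σ => ?_
  rw [rowCol_comp_iff]
  refine imp_congr_left (forall_congr' fun i => ?_)
  rw [Set.mem_ofPred_eq, not_lt]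

lemma rel_row_iff {v u : TWord n r} : Rel (rowCol r p) v u ↔
    (∀ i : Fin r, p ≤ (i : ℕ) → v i = u i) ∧
      ∀ t, (Finset.univ.filter fun i : Fin r => (i : ℕ) < p ∧ v i = t).card =
        (Finset.univ.filter fun i : Fin r => (i : ℕ) < p ∧ u i = t).card := by
  constructor
  · intro h
    refine ⟨?_, fun t => ?_⟩
    · obtain ⟨σ, hσ, rfl⟩ := h
      intro i hi
      rw [Function.comp_apply, rowCol_comp_iff.1 hσ i hi]
    · have := h.card_eq 0 t
      simpa only [rowCol_eq_zero_iff] using this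
  · rintro ⟨h1, h2⟩
    refine rel_of_card fun c t => ?_
    cases c with
    | zero => simpa only [rowCol_eq_zero_iff] using h2 t
    | succ c =>
      congr 1
      ext i
      simp only [Finset.mem_filter, Finset.mem_univ, true_and]
      refine and_congr_right fun hi => ?_
      rw [rowCol_apply] at hi
      rw [h1 i (by omega)]

lemma co_subst (π : Fin n → Fin n) (x : TensorSpace n r) (w : TWord n r) :
    co (subst r π • x) w = ∑ u with π ∘ u = w, co x u := by
  conv_lhs => rw [← sum_co x]
  rw [Finset.smul_sum, co_sum, Finset.sum_filter]
  refine Finset.sum_congr rfl fun u _ => ?_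
  rw [smul_comm, subst_wordBasis, co_smul, co_wordBasis, mul_ite, mul_one, mul_zero]

open Classical in
/-- Identifying letters maps an orbit sum to a multiple of an orbit sum. -/
lemma subst_smul_orb (π : Fin n → Fin n) (κ : Fin r → ℕ) (v : TWord n r) :
    subst r π • orb κ v =
      ((Finset.univ.filter fun u => Rel κ v u ∧ π ∘ u = π ∘ v).card : ℤ) • orb κ (π ∘ v) := by
  apply co_ext
  intro w
  rw [co_subst, co_smul, co_orb]
  simp only [co_orb]
  rw [Finset.sum_boole, Finset.filter_filter]
  by_cases h : Rel κ (π ∘ v) w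
  · rw [if_pos h, mul_one]
    obtain ⟨σ, hσ, rfl⟩ := h
    have hrel : ∀ u : TWord n r, Rel κ u (u ∘ σ) := fun u => ⟨σ, hσ, rfl⟩
    rw [Nat.cast_inj]
    symm
    refine Finset.card_bij (fun u _ => u ∘ σ) ?_ ?_ ?_
    · intro u hu
      simp only [Finset.mem_filter, Finset.mem_univ, true_and] at hu ⊢
      exact ⟨by rw [← Function.comp_assoc, hu.2], hu.1.trans (hrel u)⟩
    · intro u _ u' _ huu
      exact σ.surjective.injective_comp_right huu
    · intro u hu
      simp only [Finset.mem_filter, Finset.mem_univ, true_and] at hu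
      have h1 : (u ∘ σ.symm) ∘ σ = u := by ext1 k; simp
      refine ⟨u ∘ σ.symm, ?_, h1⟩
      simp only [Finset.mem_filter, Finset.mem_univ, true_and]
      constructor
      · have := (hrel (u ∘ σ.symm)).symm
        rw [h1] at this
        exact hu.2.trans this
      · rw [← Function.comp_assoc, hu.1]
        ext1 k; simp
  · rw [if_neg h, mul_zero, Finset.filter_false_of_mem, Finset.card_empty, Nat.cast_zero]
    rintro u - ⟨rfl, σ, hσ, rfl⟩
    exact h ⟨σ, hσ, rfl⟩

lemma collapse_eq_collapse {τ x y : ℕ} : collapse τ x = collapse τ y ↔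
    x = y ∨ ((x = τ ∨ x = τ + 1) ∧ (y = τ ∨ y = τ + 1)) := by
  rw [collapse, collapse]
  split_ifs <;> omega

open Classical in
/-- The words that become equal to `v` when the letters `τ` and `τ + 1` are identified are
determined by the places of the letter `τ` among the places of both letters. -/
lemma card_rel_collapse {τ : ℕ} (hτ : τ + 1 < n) (v : TWord n r) :
    (Finset.univ.filter fun u => Rel (rowCol r p) v u ∧
      collapseFin n τ ∘ u = collapseFin n τ ∘ v).card =
    ((Finset.univ.filter fun i : Fin r => (i : ℕ) < p ∧ (v i : ℕ) = τ).card +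
      (Finset.univ.filter fun i : Fin r => (i : ℕ) < p ∧ (v i : ℕ) = τ + 1).card).choose
      (Finset.univ.filter fun i : Fin r => (i : ℕ) < p ∧ (v i : ℕ) = τ).card := by
  set X0 := Finset.univ.filter fun i : Fin r => (i : ℕ) < p ∧ (v i : ℕ) = τ with hX0
  set X1 := Finset.univ.filter fun i : Fin r => (i : ℕ) < p ∧ (v i : ℕ) = τ + 1 with hX1
  have hm0 : ∀ i, i ∈ X0 ↔ (i : ℕ) < p ∧ (v i : ℕ) = τ := fun i => by simp [hX0]
  have hm1 : ∀ i, i ∈ X1 ↔ (i : ℕ) < p ∧ (v i : ℕ) = τ + 1 := fun i => by simp [hX1]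
  have hdisj : Disjoint X0 X1 := by
    rw [Finset.disjoint_left]
    intro i h0 h1
    rw [hm0] at h0
    rw [hm1] at h1
    omega
  rw [← Finset.card_union_of_disjoint hdisj, ← Finset.card_powersetCard]
  set P := X0 ∪ X1 with hP
  have hmP : ∀ i, i ∈ P ↔ (i : ℕ) < p ∧ ((v i : ℕ) = τ ∨ (v i : ℕ) = τ + 1) := by
    intro i
    rw [hP, Finset.mem_union, hm0, hm1]
    tauto
  have hcoll : ∀ u w : TWord n r, collapseFin n τ ∘ u = collapseFin n τ ∘ w ↔
      ∀ i, (u i : ℕ) = w i ∨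
        (((u i : ℕ) = τ ∨ (u i : ℕ) = τ + 1) ∧ ((w i : ℕ) = τ ∨ (w i : ℕ) = τ + 1)) := by
    intro u w
    rw [funext_iff]
    refine forall_congr' fun i => ?_
    rw [Function.comp_apply, Function.comp_apply, Fin.ext_iff]
    exact collapse_eq_collapse
  obtain ⟨f, hf⟩ : ∃ f : Finset (Fin r) → TWord n r, ∀ S i, (f S i : ℕ) =
      if i ∈ P then (if i ∈ S then τ else τ + 1) else (v i : ℕ) := by
    refine ⟨fun S i => if i ∈ P then (if i ∈ S then ⟨τ, by omega⟩ else ⟨τ + 1, hτ⟩) else v i,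
      fun S i => ?_⟩
    dsimp only
    split_ifs <;> rfl
  symm
  refine Finset.card_bij (fun S _ => f S) ?_ ?_ ?_
  · intro S hS
    rw [Finset.mem_powersetCard] at hS
    simp only [Finset.mem_filter, Finset.mem_univ, true_and]
    constructor
    · refine rel_row_iff.2 ⟨fun i hi => Fin.ext ?_, fun t => ?_⟩
      · rw [hf, if_neg]
        rw [hmP]; omega
      · simp only [Fin.ext_iff]
        by_cases ht : (t : ℕ) = τ
        · rw [ht]
          have : (Finset.univ.filter fun i : Fin r => (i : ℕ) < p ∧ (f S i : ℕ) = τ) = S := by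
            ext i
            simp only [Finset.mem_filter, Finset.mem_univ, true_and]
            rw [hf]
            constructor
            · rintro ⟨h1, h2⟩
              split_ifs at h2 with h3 h4
              · exact h4
              · omega
              · exact absurd ((hmP i).2 ⟨h1, Or.inl h2⟩) h3
            · intro h
              have h1 := hS.1 h
              rw [if_pos h1, if_pos h]
              exact ⟨((hmP i).1 h1).1, rfl⟩
          rw [this, hS.2]
        · by_cases ht' : (t : ℕ) = τ + 1
          · rw [ht']
            have : (Finset.univ.filter fun i : Fin r => (i : ℕ) < p ∧ (f S i : ℕ) = τ + 1) =
                P \ S := by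
              ext i
              simp only [Finset.mem_filter, Finset.mem_univ, true_and, Finset.mem_sdiff]
              rw [hf]
              constructor
              · rintro ⟨h1, h2⟩
                split_ifs at h2 with h3 h4
                · omega
                · exact ⟨h3, h4⟩
                · exact absurd ((hmP i).2 ⟨h1, Or.inr h2⟩) h3
              · rintro ⟨h1, h2⟩
                rw [if_pos h1, if_neg h2]
                exact ⟨((hmP i).1 h1).1, rfl⟩
            rw [this, Finset.card_sdiff_of_subset hS.1, hS.2, hP,
              Finset.card_union_of_disjoint hdisj]
            exact (Nat.add_sub_cancel_left (n := X0.card) (m := X1.card)).symm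
          · congr 1
            ext i
            simp only [Finset.mem_filter, Finset.mem_univ, true_and]
            refine and_congr_right fun hi => ?_
            rw [hf]
            split_ifs with h3 h4
            · have := ((hmP i).1 h3).2; omega
            · have := ((hmP i).1 h3).2; omega
            · rfl
    · rw [hcoll]
      intro i
      rw [hf]
      split_ifs with h3 h4
      · exact Or.inr ⟨Or.inl rfl, ((hmP i).1 h3).2⟩
      · exact Or.inr ⟨Or.inr rfl, ((hmP i).1 h3).2⟩
      · exact Or.inl rfl
  · intro S hS S' hS' h
    rw [Finset.mem_powersetCard] at hS hS'
    have key : ∀ S ⊆ P, ∀ i, i ∈ S ↔ i ∈ P ∧ (f S i : ℕ) = τ := by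
      intro S hS i
      rw [hf]
      constructor
      · intro hi
        rw [if_pos (hS hi), if_pos hi]
        exact ⟨hS hi, rfl⟩
      · rintro ⟨h1, h2⟩
        rw [if_pos h1] at h2
        split_ifs at h2 with h3
        · exact h3
        · omega
    ext i
    rw [key S hS.1, key S' hS'.1]
    have := congrFun h i
    rw [this]
  · intro u hu
    simp only [Finset.mem_filter, Finset.mem_univ, true_and] at hu
    obtain ⟨hu1, hu2⟩ := hu
    rw [rel_row_iff] at hu1
    rw [hcoll] at hu2
    have hSP : (Finset.univ.filter fun i : Fin r => (i : ℕ) < p ∧ (u i : ℕ) = τ) ⊆ P := by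
      intro i hi
      simp only [Finset.mem_filter, Finset.mem_univ, true_and] at hi
      rw [hmP]
      refine ⟨hi.1, ?_⟩
      have := hu2 i
      omega
    refine ⟨Finset.univ.filter fun i : Fin r => (i : ℕ) < p ∧ (u i : ℕ) = τ, ?_, ?_⟩
    · rw [Finset.mem_powersetCard]
      refine ⟨hSP, ?_⟩
      have := hu1.2 ⟨τ, by omega⟩
      simp only [Fin.ext_iff] at this
      exact this.symm
    · ext i
      rw [hf]
      simp only [Finset.mem_filter, Finset.mem_univ, true_and]
      have h2 := hu2 i
      have h3 := hmP i
      by_cases hi : (i : ℕ) < p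
      · split_ifs with h4 h5
        · exact h5.2.symm
        · have h6 : ¬ (u i : ℕ) = τ := fun h => h5 ⟨hi, h⟩
          have h7 := (h3.1 h4).2
          omega
        · have h5 : ¬ ((v i : ℕ) = τ ∨ (v i : ℕ) = τ + 1) := fun h => h4 (h3.2 ⟨hi, h⟩)
          omega
      · rw [if_neg fun h => hi (h3.1 h).1, hu1.1 i (by omega)]

/-- The places after the row. -/
abbrev tailPlaces (r p : ℕ) : Set (Fin r) := {i | p ≤ (i : ℕ)}

lemma rel_comp_swap {v u : TWord n r} {i j : Fin r} (hi : p ≤ (i : ℕ)) (hj : p ≤ (j : ℕ))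
    (h : Rel (rowCol r p) v u) :
    Rel (rowCol r p) (v ∘ Equiv.swap i j) (u ∘ Equiv.swap i j) := by
  obtain ⟨σ, hσ, rfl⟩ := h
  refine ⟨σ, hσ, ?_⟩
  have hfix := rowCol_comp_iff.1 hσ
  ext1 k
  simp only [Function.comp_apply]
  congr 1
  by_cases hki : k = i
  · rw [hki, Equiv.swap_apply_left, hfix j hj, hfix i hi, Equiv.swap_apply_left]
  · by_cases hkj : k = j
    · rw [hkj, Equiv.swap_apply_right, hfix i hi, hfix j hj, Equiv.swap_apply_right]
    · rw [Equiv.swap_apply_of_ne_of_ne hki hkj, Equiv.swap_apply_of_ne_of_ne]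
      · intro h; exact hki (σ.injective (h.trans (hfix i hi).symm))
      · intro h; exact hkj (σ.injective (h.trans (hfix j hj).symm))

lemma comp_swap_swap (v : TWord n r) (i j : Fin r) :
    (v ∘ Equiv.swap i j) ∘ Equiv.swap i j = v := by
  ext1 k; simp

lemma placePerm_swap_orb {i j : Fin r} (hi : p ≤ (i : ℕ)) (hj : p ≤ (j : ℕ)) (v : TWord n r) :
    placePerm n (Equiv.swap i j) (orb (rowCol r p) v) =
      orb (rowCol r p) (v ∘ Equiv.swap i j) := by
  classical
  apply co_ext
  intro u
  rw [co_placePerm, co_orb, co_orb]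
  have : Rel (rowCol r p) v (u ∘ Equiv.swap i j) ↔
      Rel (rowCol r p) (v ∘ Equiv.swap i j) u := by
    constructor
    · intro h
      have := rel_comp_swap hi hj h
      rwa [comp_swap_swap] at this
    · intro h
      have := rel_comp_swap hi hj h
      rwa [comp_swap_swap] at this
  simp only [this]

lemma orb_add_orb_swap_mem {i j : Fin r} (hi : p ≤ (i : ℕ)) (hj : p ≤ (j : ℕ)) (hij : i ≠ j)
    (v : TWord n r) : orb (rowCol r p) v + orb (rowCol r p) (v ∘ Equiv.swap i j) ∈
      altRelations n r (tailPlaces r p) := by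
  rw [← placePerm_swap_orb hi hj]
  exact add_placePerm_swap_mem _ hi hj hij

lemma orb_mem_altRelations {i j : Fin r} (hi : p ≤ (i : ℕ)) (hj : p ≤ (j : ℕ)) (hij : i ≠ j)
    {v : TWord n r} (h : v i = v j) :
    orb (rowCol r p) v ∈ altRelations n r (tailPlaces r p) := by
  refine mem_altRelations_of_swap (B := tailPlaces r p) hi hj hij ?_
  rw [placePerm_swap_orb hi hj]
  congr 1
  ext1 k
  rw [Function.comp_apply]
  by_cases hki : k = i
  · rw [hki, Equiv.swap_apply_left, h]
  · by_cases hkj : k = j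
    · rw [hkj, Equiv.swap_apply_right, h]
    · rw [Equiv.swap_apply_of_ne_of_ne hki hkj]

end rowOrbits

/-! ### Recovering a list from its word -/

section listOfWord

lemma eq_of_monotone_of_card_fiber {m : ℕ} {f g : Fin m → ℕ} (hf : Monotone f) (hg : Monotone g)
    (h : ∀ c, (Finset.univ.filter fun i => f i = c).card =
      (Finset.univ.filter fun i => g i = c).card) : f = g := by
  obtain ⟨σ, rfl⟩ := exists_perm_of_card_fiber f g h
  have h1 : f ∘ (1 : Equiv.Perm (Fin m)) = f ∘ Tuple.sort f :=
    Tuple.comp_sort_eq_comp_iff_monotone.2 hf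
  exact h1.trans (Tuple.comp_sort_eq_comp_iff_monotone.2 hg).symm

lemma eq_of_blockIdx_eq {r : ℕ} {B B' : Finset ℕ} (hB : B ⊆ Finset.Ico 1 r)
    (hB' : B' ⊆ Finset.Ico 1 r) (h : ∀ i < r, blockIdx B i = blockIdx B' i) : B = B' := by
  have key : ∀ B ⊆ Finset.Ico 1 r, ∀ B' ⊆ Finset.Ico 1 r,
      (∀ i < r, blockIdx B i = blockIdx B' i) → B ⊆ B' := by
    intro B hB B' _ h t ht
    have h1 := Finset.mem_Ico.1 (hB ht)
    by_contra ht'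
    obtain ⟨t, rfl⟩ : ∃ s, t = s + 1 := ⟨t - 1, by omega⟩
    have h2 := blockIdx_lt_of_mem ht (Nat.lt_succ_self t)
    rw [h _ h1.2, h t (by omega), blockIdx_succ_of_notMem ht'] at h2
    exact lt_irrefl _ h2
  exact Finset.Subset.antisymm (key B hB B' hB' h)
    (key B' hB' B hB fun i hi => (h i hi).symm)

lemma exists_blockIdx_eq {r : ℕ} (hr : 1 ≤ r) {B : Finset ℕ} (hB : B ⊆ Finset.Ico 1 r) {c : ℕ}
    (hc : c ≤ B.card) : ∃ i < r, blockIdx B i = c := by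
  induction B using Finset.induction_on_max generalizing c with
  | empty => exact ⟨0, hr, by simp at hc; simp [blockIdx, hc]⟩
  | insert t B ht ih =>
    have htB : t ∉ B := fun h => lt_irrefl _ (ht t h)
    rw [Finset.card_insert_of_notMem htB] at hc
    rcases Nat.lt_or_ge B.card c with h | h
    · refine ⟨t, (Finset.mem_Ico.1 (hB (Finset.mem_insert_self _ _))).2, ?_⟩
      rw [blockIdx, Finset.filter_true_of_mem, Finset.card_insert_of_notMem htB]
      · omega
      · intro s hs
        rcases Finset.mem_insert.1 hs with rfl | hs
        · exact le_rfl
        · exact (ht s hs).le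
    · obtain ⟨i, hi, hic⟩ := ih ((Finset.subset_insert _ _).trans hB) h
      by_cases hit : t ≤ i
      · refine ⟨t - 1, ?_, ?_⟩
        · have := (Finset.mem_Ico.1 (hB (Finset.mem_insert_self _ _))); omega
        · have h1 : 1 ≤ t := (Finset.mem_Ico.1 (hB (Finset.mem_insert_self _ _))).1
          rw [← hic, blockIdx, blockIdx]
          congr 1
          ext s
          simp only [Finset.mem_filter, Finset.mem_insert]
          constructor
          · rintro ⟨rfl | hs, hst⟩
            · omega
            · exact ⟨hs, by omega⟩
          · rintro ⟨hs, hsi⟩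
            have := ht s hs
            exact ⟨Or.inr hs, by omega⟩
      · refine ⟨i, hi, ?_⟩
        rw [← hic, blockIdx, blockIdx, Finset.filter_insert, if_neg hit]

variable {n r : ℕ} [NeZero n]

/-- A rearrangement of the word filling the blocks that is strictly increasing after the row is the
word of a list, up to permutations of the row. -/
lemma exists_list_of_word {a p q N i : ℕ} (ha : 1 ≤ a) (har : a ≤ r) (hr : r = p + q)
    {B : Finset ℕ} (hB : B ⊆ Finset.Ico a r) (hBn : B.card < n) (hN : B.card + 1 + i = N)
    {v : TWord n r} (hv : ∃ σ : Equiv.Perm (Fin r), v = blockWord n r B ∘ σ)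
    (hinc : ∀ j k : Fin r, p ≤ (j : ℕ) → j < k → v j < v k) :
    ∃ L ∈ barIndex a p q N i, bars 0 L = B ∧ Rel (rowCol r p) v (listWord n r L) := by
  classical
  have hB1 : B ⊆ Finset.Ico 1 r := hB.trans (Finset.Ico_subset_Ico_left ha)
  let X : ℕ → ℕ := fun c => (Finset.univ.filter fun j : Fin r => (j : ℕ) < p ∧ (v j : ℕ) = c).card
  let Y : ℕ → ℕ := fun c => (Finset.univ.filter fun j : Fin r => p ≤ (j : ℕ) ∧ (v j : ℕ) = c).card
  have hY : ∀ c, Y c ≤ 1 := by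
    intro c
    rw [Finset.card_le_one]
    intro j hj k hk
    simp only [Finset.mem_filter, Finset.mem_univ, true_and] at hj hk
    have hvjk : v j = v k := Fin.ext (hj.2.trans hk.2.symm)
    rcases lt_trichotomy j k with h | h | h
    · exact absurd hvjk (hinc j k hj.1 h).ne
    · exact h
    · exact absurd hvjk (hinc k j hk.1 h).ne'
  have hYb : ∀ c, (decide (Y c = 1)).toNat = Y c := by
    intro c
    have := hY c
    interval_cases Y c <;> rfl
  have hXY : ∀ c, X c + Y c = (Finset.univ.filter fun j : Fin r => blockIdx B j = c).card := by
    intro c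
    have h1 : (Finset.univ.filter fun j : Fin r => (v j : ℕ) = c).card =
        (Finset.univ.filter fun j : Fin r => blockIdx B j = c).card := by
      obtain ⟨σ, rfl⟩ := hv
      refine Finset.card_bij (fun j _ => σ j) ?_ ?_ ?_
      · intro j hj
        simpa [blockWord_val hBn] using hj
      · intro j _ k _ h; exact σ.injective h
      · intro j hj
        exact ⟨σ.symm j, by simpa [blockWord_val hBn] using hj, by simp⟩
    rw [← h1, ← Finset.card_filter_add_card_filter_not (s := Finset.univ.filter fun j : Fin r =>
      (v j : ℕ) = c) (p := fun j : Fin r => (j : ℕ) < p), Finset.filter_filter,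
      Finset.filter_filter]
    refine congrArg₂ (· + ·) (congrArg Finset.card ?_) (congrArg Finset.card ?_)
    · ext j; simp only [Finset.mem_filter]; tauto
    · ext j; simp only [Finset.mem_filter, not_lt]; tauto
  have hvle : ∀ j, (v j : ℕ) < B.card + 1 := by
    intro j
    obtain ⟨σ, rfl⟩ := hv
    rw [Function.comp_apply, blockWord_val hBn, Nat.lt_succ_iff]
    exact blockIdx_le_card _ _
  have hX0 : ∀ c, B.card + 1 ≤ c → X c = 0 ∧ Y c = 0 := by
    intro c hc
    constructor <;>
    · rw [Finset.card_eq_zero, Finset.filter_eq_empty_iff]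
      rintro j - ⟨-, h⟩
      have := hvle j
      omega
  let L : List Letter := List.ofFn fun c : Fin (B.card + 1) => (X c, decide (Y c = 1))
  have hlen : L.length = B.card + 1 := List.length_ofFn
  have hget : ∀ c, L.getD c (0, false) = (X c, decide (Y c = 1)) := by
    intro c
    by_cases hc : c < B.card + 1
    · rw [List.getD_eq_getElem _ _ (by rw [hlen]; exact hc), List.getElem_ofFn]
    · rw [List.getD_eq_default _ _ (by rw [hlen]; omega), (hX0 c (by omega)).1,
        (hX0 c (by omega)).2]
      rfl
  have hdeg : ∀ c, (L.getD c (0, false)).deg =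
      (Finset.univ.filter fun j : Fin r => blockIdx B j = c).card := by
    intro c
    rw [hget, Letter.deg, ← hXY, hYb]
  have hmem : ∀ w ∈ L, ∃ c ≤ B.card, w = L.getD c (0, false) := by
    intro w hw
    obtain ⟨c, hc, rfl⟩ := List.mem_iff_getElem.1 hw
    exact ⟨c, by omega, (List.getD_eq_getElem _ _ hc).symm⟩
  have hpos : ∀ w ∈ L, w ≠ (0, false) := by
    intro w hw h0
    obtain ⟨c, hc, rfl⟩ := hmem w hw
    have h1 := hdeg c
    rw [h0] at h1
    obtain ⟨j, hj, hjc⟩ := exists_blockIdx_eq (by omega) hB1 hc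
    have h2 : (⟨j, hj⟩ : Fin r) ∈ Finset.univ.filter fun j : Fin r => blockIdx B j = c := by
      simpa using hjc
    rw [Finset.card_eq_zero.1 h1.symm] at h2
    exact absurd h2 (Finset.notMem_empty _)
  have hsum : ∀ (P : Fin r → Prop) [DecidablePred P],
      ∑ c : Fin (B.card + 1), (Finset.univ.filter fun j : Fin r => P j ∧ (v j : ℕ) = c).card =
        (Finset.univ.filter P).card := by
    intro P _
    rw [Finset.card_eq_sum_card_fiberwise (f := fun j => (⟨v j, hvle j⟩ : Fin (B.card + 1)))
      (t := Finset.univ) (fun _ _ => Finset.mem_coe.2 (Finset.mem_univ _))]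
    refine Finset.sum_congr rfl fun c _ => ?_
    rw [Finset.filter_filter]
    simp only [Fin.ext_iff]
  have hL : L ∈ barIndex a p q N i := by
    refine ⟨by rw [hlen]; exact hN, ?_, ?_, hpos, ?_⟩
    · rw [List.map_ofFn, List.sum_ofFn]
      refine (hsum fun j => (j : ℕ) < p).trans ?_
      rw [card_fin_filter r fun j => j < p, hr, Nat.count_add]
      rw [Nat.count_eq_card_filter_range, Nat.count_eq_card_filter_range,
        Finset.filter_true_of_mem fun j hj => Finset.mem_range.1 hj,
        Finset.filter_false_of_mem fun j _ => by omega]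
      simp
    · have h1 : ∀ L : List Letter, L.countP (·.2) = (L.map fun w => w.2.toNat).sum := by
        intro L
        induction L with
        | nil => rfl
        | cons w L ih =>
          rw [List.countP_cons, ih, List.map_cons, List.sum_cons]
          cases w.2 <;> simp [add_comm]
      rw [h1, List.map_ofFn, List.sum_ofFn]
      simp only [Function.comp_apply, hYb]
      refine (hsum fun j => p ≤ (j : ℕ)).trans ?_
      rw [card_fin_filter r fun j => p ≤ j, hr, Nat.count_add]
      rw [Nat.count_eq_card_filter_range, Nat.count_eq_card_filter_range,
        Finset.filter_false_of_mem fun j hj => by have := Finset.mem_range.1 hj; omega,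
        Finset.filter_true_of_mem fun j _ => by omega]
      simp
    · intro w hw
      have hw' : w = L.getD 0 (0, false) := by
        rcases hL : L with _ | ⟨w', L'⟩
        · rw [hL] at hlen; simp at hlen
        · rw [hL] at hw
          rw [List.getD_cons_zero]
          simpa using hw.symm
      rw [hw', hdeg]
      have h1 : (Finset.univ.filter fun j : Fin r => (j : ℕ) < a).card = a := by
        rw [card_fin_filter r fun j => j < a, Nat.count_eq_card_filter_range]
        have : (Finset.range r).filter (· < a) = Finset.range a := by
          ext j; simp only [Finset.mem_filter, Finset.mem_range]; omega
        rw [this, Finset.card_range]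
      conv_lhs => rw [← h1]
      refine Finset.card_le_card fun j hj => ?_
      simp only [Finset.mem_filter, Finset.mem_univ, true_and] at hj ⊢
      rw [blockIdx, Finset.card_eq_zero, Finset.filter_eq_empty_iff]
      intro t ht
      have := (Finset.mem_Ico.1 (hB ht)).1
      omega
  have hLn : L.length ≤ n := by omega
  refine ⟨L, hL, ?_, ?_⟩
  · refine eq_of_blockIdx_eq (r := r) ?_ hB1 fun j hj => ?_
    · have := bars_subset hL
      rw [← hr] at this
      exact this.trans (Finset.Ico_subset_Ico_left ha)
    · have key : (fun j : Fin r => blockIdx (bars 0 L) j) = fun j : Fin r => blockIdx B j :=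
        eq_of_monotone_of_card_fiber (fun j k h => blockIdx_mono _ h)
          (fun j k h => blockIdx_mono _ h) fun c => by rw [card_blockIdx_bars hL hr, hdeg]
      exact congrFun key ⟨j, hj⟩
  · rw [rel_row_iff]
    constructor
    · intro j hj
      have hmono : ∀ u : TWord n r, (∀ j k : Fin r, p ≤ (j : ℕ) → j < k → u j < u k) →
          Monotone fun j : Fin r => if p ≤ (j : ℕ) then (u j : ℕ) + 1 else 0 := by
        intro u hu j k hjk
        have hjk' : (j : ℕ) ≤ k := hjk
        dsimp only
        split_ifs with h1 h2
        · rcases hjk.lt_or_eq with h | h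
          · have := hu j k h1 h
            have h' : (u j : ℕ) < u k := this
            omega
          · rw [h]
        · omega
        · omega
        · omega
      have hcard : ∀ c, (Finset.univ.filter fun j : Fin r =>
            (if p ≤ (j : ℕ) then (v j : ℕ) + 1 else 0) = c).card =
          (Finset.univ.filter fun j : Fin r =>
            (if p ≤ (j : ℕ) then (listWord n r L j : ℕ) + 1 else 0) = c).card := by
        intro c
        cases c with
        | zero =>
          congr 1
          ext j
          simp only [Finset.mem_filter, Finset.mem_univ, true_and]
          split_ifs <;> simp
        | succ c =>
          have h1 : ∀ u : TWord n r, (Finset.univ.filter fun j : Fin r =>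
              (if p ≤ (j : ℕ) then (u j : ℕ) + 1 else 0) = c + 1) =
              Finset.univ.filter fun j : Fin r => p ≤ (j : ℕ) ∧ (u j : ℕ) = c := by
            intro u
            ext j
            simp only [Finset.mem_filter, Finset.mem_univ, true_and]
            split_ifs with h <;> simp [h]
          rw [h1, h1, card_listWord_tail hL hLn hr, hget]
          exact (hYb c).symm
      have h1 := congrFun (eq_of_monotone_of_card_fiber (hmono v hinc)
        (hmono (listWord n r L) fun j k hj hjk => listWord_lt_listWord hL hLn hr hj hjk) hcard) j
      rw [if_pos hj, if_pos hj] at h1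
      exact Fin.ext (by omega)
    · intro t
      simp only [Fin.ext_iff]
      rw [card_listWord_row hL hLn hr, hget]

end listOfWord

/-! ### From lists of letters to families of weight vectors -/

section bridge

variable {n r p q a N i : ℕ} {M : Type} [AddCommGroup M] [Module (schurAlgebra n r) M]

/-- Shortcut instance: the general search is slow. -/
instance invariantsModule (κ : Fin r → ℕ) : Module (schurAlgebra n r) (invariants n κ) :=
  Submodule.module _

/-- Shortcut instance: the general search is slow. -/
instance invariantsSMul (κ : Fin r → ℕ) : SMul (schurAlgebra n r) (invariants n κ) :=
  (invariantsModule κ).toSMul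

/-- The image in `M` of the orbit sum of a word, symmetric in the row. -/
def orbImage (ρ : invariants n (rowCol r p) →ₗ[schurAlgebra n r] M) (v : TWord n r) : M :=
  ρ ⟨orb (rowCol r p) v, orb_mem _ _⟩

/-- The map `ρ` presents `M` as the module of tensors symmetric in the first `p` places and
alternating in the other places. -/
def PresentsRowTail (ρ : invariants n (rowCol r p) →ₗ[schurAlgebra n r] M) : Prop :=
  Function.Surjective ρ ∧
    ∀ x, ρ x = 0 ↔ (x : TensorSpace n r) ∈ altRelations n r (tailPlaces r p)

variable {ρ : invariants n (rowCol r p) →ₗ[schurAlgebra n r] M}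

lemma orbImage_eq_of_rel {v u : TWord n r} (h : Rel (rowCol r p) v u) :
    orbImage ρ v = orbImage ρ u :=
  congrArg ρ (Subtype.ext (orb_eq_of_rel h).symm)

lemma orbImage_eq_zero (hρ : PresentsRowTail ρ) {v : TWord n r} {j k : Fin r}
    (hj : p ≤ (j : ℕ)) (hk : p ≤ (k : ℕ)) (hjk : j ≠ k) (h : v j = v k) : orbImage ρ v = 0 :=
  (hρ.2 _).2 (orb_mem_altRelations hj hk hjk h)

lemma orbImage_add_swap (hρ : PresentsRowTail ρ) (v : TWord n r) {j k : Fin r}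
    (hj : p ≤ (j : ℕ)) (hk : p ≤ (k : ℕ)) (hjk : j ≠ k) :
    orbImage ρ v + orbImage ρ (v ∘ Equiv.swap j k) = 0 := by
  rw [orbImage, orbImage, ← map_add]
  exact (hρ.2 _).2 (orb_add_orb_swap_mem hj hk hjk v)

lemma weightIdem_smul_orbImage {w v : TWord n r} (h : ∃ σ : Equiv.Perm (Fin r), v = w ∘ σ) :
    weightIdem w • orbImage ρ v = orbImage ρ v := by
  classical
  rw [orbImage, ← map_smul]
  congr 1
  apply Subtype.ext
  apply co_ext
  intro u
  change co (weightIdem w • orb (rowCol r p) v) u = co (orb (rowCol r p) v) u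
  rw [co_weightIdem]
  split_ifs with hu
  · rfl
  · rw [co_orb, if_neg]
    rintro ⟨τ, -, rfl⟩
    obtain ⟨σ, rfl⟩ := h
    exact hu ⟨σ * τ, rfl⟩

lemma letterMap_orbImage {τ : ℕ} (hτ : τ + 1 < n) (v : TWord n r) :
    letterMap n r M τ (orbImage ρ v) =
      ((((Finset.univ.filter fun i : Fin r => (i : ℕ) < p ∧ (v i : ℕ) = τ).card +
        (Finset.univ.filter fun i : Fin r => (i : ℕ) < p ∧ (v i : ℕ) = τ + 1).card).choose
        (Finset.univ.filter fun i : Fin r => (i : ℕ) < p ∧ (v i : ℕ) = τ).card : ℕ) : ℤ) •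
        orbImage ρ (collapseFin n τ ∘ v) := by
  change subst r (collapseFin n τ) • orbImage ρ v = _
  rw [orbImage, orbImage, ← map_smul, ← map_zsmul, ← card_rel_collapse hτ]
  congr 1
  exact Subtype.ext (subst_smul_orb _ _ _)

variable [NeZero n]

/-- Identifying the letters `τ` and `τ + 1` corresponds to multiplying letters in the bar
construction: the binomial coefficient comes from the divided powers, and a square of the exterior
letter is zero because the tensor then has equal entries in two alternating places. -/
lemma letterMap_orbImage_listWord (hρ : PresentsRowTail ρ) {L : List Letter}
    (hL : L ∈ barIndex a p q N i) (hn : L.length ≤ n) (hr : r = p + q) {τ : ℕ}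
    (hτ : τ + 1 < L.length) :
    letterMap n r M τ (orbImage ρ (listWord n r L)) =
      mergeCoeff τ L • orbImage ρ (listWord n r (mergeAt τ L)) := by
  rw [letterMap_orbImage (by omega), card_listWord_row hL hn hr, card_listWord_row hL hn hr,
    mergeCoeff_eq hτ]
  by_cases hy : ((L.getD τ (0, false)).2 && (L.getD (τ + 1) (0, false)).2) = true
  · rw [if_pos hy, zero_smul]
    rw [Bool.and_eq_true] at hy
    have key : ∀ c, (L.getD c (0, false)).2 = true →
        ∃ j : Fin r, p ≤ (j : ℕ) ∧ (listWord n r L j : ℕ) = c := by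
      intro c hc
      have h1 := card_listWord_tail hL hn hr c
      have h2 : 0 < (Finset.univ.filter fun j : Fin r =>
          p ≤ (j : ℕ) ∧ (listWord n r L j : ℕ) = c).card := by
        rw [h1, hc]; exact Nat.one_pos
      obtain ⟨j, hj⟩ := Finset.card_pos.1 h2
      exact ⟨j, by simpa using hj⟩
    obtain ⟨j, hj, hjτ⟩ := key _ hy.1
    obtain ⟨k, hk, hkτ⟩ := key _ hy.2
    rw [orbImage_eq_zero hρ hj hk, smul_zero]
    · rintro rfl
      omega
    · apply Fin.ext
      change collapse τ (listWord n r L j : ℕ) = collapse τ (listWord n r L k : ℕ)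
      rw [collapse_eq_collapse]
      omega
  · rw [if_neg hy, listWord_mergeAt hn hτ (by simpa using hy)]

/-- The comparison map from the bar construction to families of weight vectors. -/
def listHom (ρ : invariants n (rowCol r p) →ₗ[schurAlgebra n r] M) :
    BarMod →ₗ[ℤ] (Finset ℕ → M) :=
  Finsupp.linearCombination ℤ fun L => Pi.single (bars 0 L) (orbImage ρ (listWord n r L))

lemma listHom_single (L : List Letter) (c : ℤ) : listHom ρ (Finsupp.single L c) =
    c • Pi.single (bars 0 L) (orbImage ρ (listWord n r L)) :=
  Finsupp.linearCombination_single ..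

lemma coboundary_listHom (hρ : PresentsRowTail ρ) (hr : r = p + q) (hn : N ≤ n) {x : BarMod}
    (hx : x ∈ barPart a p q N i) :
    coboundary (Finset.Ico a r) (letterMap n r M) (listHom ρ x) = listHom ρ (barD x) := by
  suffices barPart a p q N i ≤ LinearMap.eqLocus
      ((coboundary (Finset.Ico a r) (letterMap n r M)).comp (listHom ρ)) ((listHom ρ).comp barD)
    from this hx
  rw [barPart, Finsupp.supported_eq_span_single, Submodule.span_le]
  rintro _ ⟨L, hL, rfl⟩
  change coboundary (Finset.Ico a r) (letterMap n r M) (listHom ρ (Finsupp.single L 1)) =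
    listHom ρ (barD (Finsupp.single L 1))
  have hbars := bars_subset hL
  rw [← hr] at hbars
  have hlen : L.length ≤ n := by have := hL.1; omega
  rw [listHom_single, one_smul, coboundary_single _ _ hbars, barD_single,
    barList_eq_sum 0 L hL.2.2.2.1, map_sum]
  refine Finset.sum_congr rfl fun t ht => ?_
  have hne : L ≠ [] := by rintro rfl; simp [bars] at ht
  have hrk : rk (bars 0 L) t + 1 < L.length := by
    rw [← card_bars (s := 0) hL.2.2.2.1 hne]
    have : rk (bars 0 L) t < (bars 0 L).card := by
      apply Finset.card_lt_card
      rw [Finset.ssubset_iff_of_subset (Finset.filter_subset _ _)]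
      exact ⟨t, ht, by simp⟩
    omega
  rw [letterMap_orbImage_listWord hρ hL hlen hr hrk, map_zsmul, listHom_single]
  congr 1
  by_cases hc : mergeCoeff (rk (bars 0 L) t) L = 0
  · rw [hc, zero_smul, zero_smul, Pi.single_zero]
  · rw [bars_mergeAt hL.2.2.2.1 ht hc, Pi.single_smul]

variable {b : ℕ}

lemma listHom_mem (hr : r = p + q) (hab : r = a + b) (ha : 1 ≤ a) (hn : b + 1 ≤ n) {x : BarMod}
    (hx : x ∈ barPart a p q (b + 1) i) :
    listHom ρ x ∈ famPart n r M (Finset.Ico a r) i := by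
  suffices barPart a p q (b + 1) i ≤ (famPart n r M (Finset.Ico a r) i).comap (listHom ρ) from
    this hx
  rw [barPart, Finsupp.supported_eq_span_single, Submodule.span_le]
  rintro _ ⟨L, hL, rfl⟩
  change listHom ρ (Finsupp.single L 1) ∈ famPart n r M (Finset.Ico a r) i
  rw [listHom_single, one_smul]
  have hbars := bars_subset hL
  rw [← hr] at hbars
  have h1 := hL.1
  have hne : L ≠ [] := by
    rintro rfl
    have := hL.2.1
    have := hL.2.2.1
    simp at *
    omega
  have hcard := card_bars (s := 0) hL.2.2.2.1 hne
  refine ⟨fun B => ?_, fun B hB => ?_⟩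
  · by_cases h : B = bars 0 L
    · rw [h, Pi.single_eq_same]
      exact weightIdem_smul_orbImage (exists_listWord_eq hL (by omega) hr (by omega))
    · rw [Pi.single_eq_of_ne h, smul_zero]
  · by_cases h : B = bars 0 L
    · rw [h, Nat.card_Ico]
      exact ⟨hbars, by omega⟩
    · rw [Pi.single_eq_of_ne h] at hB
      exact absurd rfl hB

/-- The words of different lists are linearly independent modulo the alternating relations: the
antisymmetrization of such a word contains itself once, and none of the other words. -/
lemma rel_listWord_comp {L L' : List Letter} (hL : L ∈ barIndex a p q N i)
    (hL' : L' ∈ barIndex a p q N i) (hn : N ≤ n) (hr : r = p + q) {π : Equiv.Perm (Fin r)}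
    (hπ : ∀ j, j ∉ tailPlaces r p → π j = j)
    (h : Rel (rowCol r p) (listWord n r L) (listWord n r L' ∘ π)) : π = 1 ∧ L = L' := by
  have hlen : L.length ≤ n := by have := hL.1; omega
  have hlen' : L'.length ≤ n := by have := hL'.1; omega
  have hfix : ∀ j : Fin r, (j : ℕ) < p → π j = j := fun j hj => hπ j (not_le.2 hj)
  have hπ1 : π = 1 := by
    rcases le_total (lexRank (listWord n r L' ∘ π)) (lexRank (listWord n r L')) with h1 | h1
    · exact eq_one_of_lexRank_le (fun j k hj hjk => listWord_lt_listWord hL' hlen' hr hj hjk)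
        hfix h1
    · have h2 : π⁻¹ = 1 := by
        refine eq_one_of_lexRank_le (c := p) (v := listWord n r L' ∘ π) ?_ ?_ ?_
        · intro j k hj hjk
          rw [← (rel_row_iff.1 h).1 j hj, ← (rel_row_iff.1 h).1 k (hj.trans hjk.le)]
          exact listWord_lt_listWord hL hlen hr hj hjk
        · intro j hj
          rw [Equiv.Perm.inv_eq_iff_eq]
          exact (hfix j hj).symm
        · have : (listWord n r L' ∘ π) ∘ (π⁻¹ : Equiv.Perm (Fin r)) =
              listWord n r L' := by ext1 k; simp
          rw [this]
          exact h1
      exact inv_eq_one.1 h2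
  refine ⟨hπ1, ?_⟩
  rw [hπ1, Equiv.Perm.coe_one, Function.comp_id] at h
  have h1 : ∀ c, L.getD c (0, false) = L'.getD c (0, false) := by
    intro c
    apply Prod.ext
    · rw [← card_listWord_row hL hlen hr, ← card_listWord_row hL' hlen' hr]
      by_cases hc : c < n
      · have := (rel_row_iff.1 h).2 ⟨c, hc⟩
        simpa only [Fin.ext_iff] using this
      · congr 1
        ext j
        simp only [Finset.mem_filter, Finset.mem_univ, true_and]
        refine and_congr_right fun _ => ?_
        have := (listWord n r L j).2
        have := (listWord n r L' j).2
        omega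
    · have h2 : (L.getD c (0, false)).2.toNat = (L'.getD c (0, false)).2.toNat := by
        rw [← card_listWord_tail hL hlen hr, ← card_listWord_tail hL' hlen' hr]
        congr 1
        ext j
        simp only [Finset.mem_filter, Finset.mem_univ, true_and]
        refine and_congr_right fun hj => ?_
        rw [(rel_row_iff.1 h).1 j hj]
      revert h2
      cases (L.getD c (0, false)).2 <;> cases (L'.getD c (0, false)).2 <;> simp
  have hlenLL : L.length = L'.length := by
    have := hL.1
    have := hL'.1
    omega
  refine List.ext_getElem hlenLL fun c hc hc' => ?_
  have := h1 c
  rwa [List.getD_eq_getElem _ _ hc, List.getD_eq_getElem _ _ hc'] at this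

lemma listHom_injOn (hρ : PresentsRowTail ρ) (hr : r = p + q) (hn : N ≤ n) {x : BarMod}
    (hx : x ∈ barPart a p q N i) (h0 : listHom ρ x = 0) : x = 0 := by
  classical
  ext L0
  rw [Finsupp.zero_apply]
  by_contra hL0
  have hsupp : ∀ L ∈ x.support, L ∈ barIndex a p q N i := fun L hL => hx hL
  have hL0s : L0 ∈ x.support := Finsupp.mem_support_iff.2 hL0
  have hL0i := hsupp L0 hL0s
  let S := x.support.filter fun L => bars 0 L0 = bars 0 L
  have h1 : ∑ L ∈ S, x L • orbImage ρ (listWord n r L) = 0 := by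
    have h2 := congrFun h0 (bars 0 L0)
    rw [listHom, Finsupp.linearCombination_apply, Finsupp.sum, Finset.sum_apply] at h2
    rw [Finset.sum_filter]
    refine Eq.trans (Finset.sum_congr rfl fun L _ => ?_) h2
    rw [Pi.smul_apply]
    split_ifs with h
    · rw [h, Pi.single_eq_same]
    · rw [Pi.single_eq_of_ne h, smul_zero]
  let z : invariants n (rowCol r p) :=
    ∑ L ∈ S, x L • ⟨orb (rowCol r p) (listWord n r L), orb_mem _ _⟩
  have hz : ρ z = 0 := by
    rw [map_sum]
    refine Eq.trans (Finset.sum_congr rfl fun L _ => ?_) h1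
    exact map_zsmul ρ _ _
  have hzval : (z : TensorSpace n r) = ∑ L ∈ S, x L • orb (rowCol r p) (listWord n r L) := by
    rw [AddSubmonoidClass.coe_finsetSum]
    rfl
  have hcoz : ∀ u, co (z : TensorSpace n r) u =
      ∑ L ∈ S, x L * if Rel (rowCol r p) (listWord n r L) u then 1 else 0 := by
    intro u
    rw [hzval, co_sum]
    refine Finset.sum_congr rfl fun L _ => ?_
    rw [co_smul, co_orb]
  have h3 := co_antisymm (B := tailPlaces r p) (z : TensorSpace n r) (listWord n r L0)
  rw [antisymm_eq_zero ((hρ.2 z).1 hz), co_zero, Finset.sum_eq_single 1] at h3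
  · rw [Equiv.Perm.sign_one, Units.val_one, one_mul, hcoz, Finset.sum_eq_single L0] at h3
    · rw [if_pos, mul_one] at h3
      · exact hL0 h3.symm
      · exact Rel.refl _ _
    · intro L hL hne
      rw [if_neg, mul_zero]
      intro h
      exact hne (rel_listWord_comp (hsupp L (Finset.mem_filter.1 hL).1) hL0i hn hr
        (fun _ _ => rfl) h).2
    · intro h
      exact absurd (show L0 ∈ S from Finset.mem_filter.2 ⟨hL0s, rfl⟩) h
  · intro π hπ hπ1
    simp only [Finset.mem_filter, Finset.mem_univ, true_and] at hπ
    rw [hcoz, Finset.sum_eq_zero, mul_zero]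
    intro L hL
    rw [if_neg, mul_zero]
    intro h
    exact hπ1 (rel_listWord_comp (hsupp L (Finset.mem_filter.1 hL).1) hL0i hn hr hπ h).1
  · intro h
    refine absurd ?_ h
    simp only [Finset.mem_filter, Finset.mem_univ, true_and]
    exact fun _ _ => rfl

/-- Sorting the entries after the row, a word becomes the word of a list, up to sign, or vanishes
because of a repeated entry. -/
lemma single_orbImage_mem (hρ : PresentsRowTail ρ) (hr : r = p + q) (ha : 1 ≤ a) (har : a ≤ r)
    {B : Finset ℕ} (hB : B ⊆ Finset.Ico a r) (hBn : B.card < n) (hN : B.card + 1 + i = N)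
    {v : TWord n r} (hv : ∃ σ : Equiv.Perm (Fin r), v = blockWord n r B ∘ σ) :
    Pi.single B (orbImage ρ v) ∈ (barPart a p q N i).map (listHom ρ) := by
  induction hm : lexRank v using Nat.strong_induction_on generalizing v with
  | _ m ih =>
    by_cases hinc : ∀ j k : Fin r, p ≤ (j : ℕ) → j < k → v j < v k
    · obtain ⟨L, hL, rfl, hrel⟩ := exists_list_of_word ha har hr hB hBn hN hv hinc
      refine ⟨Finsupp.single L 1, Finsupp.single_mem_supported ℤ _ hL, ?_⟩
      rw [listHom_single, one_smul, orbImage_eq_of_rel hrel]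
    · push Not at hinc
      obtain ⟨j, k, hj, hjk, hle⟩ := hinc
      have hk : p ≤ (k : ℕ) := hj.trans hjk.le
      rcases hle.eq_or_lt with heq | hlt
      · rw [orbImage_eq_zero hρ hj hk hjk.ne heq.symm, Pi.single_zero]
        exact zero_mem _
      · have h1 : orbImage ρ v = - orbImage ρ (v ∘ Equiv.swap j k) :=
          eq_neg_of_add_eq_zero_left (orbImage_add_swap hρ v hj hk hjk.ne)
        rw [h1, Pi.single_neg]
        refine neg_mem (ih (lexRank (v ∘ Equiv.swap j k)) ?_ ?_ rfl)
        · rw [← hm, lexRank_lt_iff]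
          refine ⟨j, fun l hl => ?_, ?_⟩
          · change v (Equiv.swap j k l) = v l
            rw [Equiv.swap_apply_of_ne_of_ne hl.ne (hl.trans hjk).ne]
          · change v (Equiv.swap j k j) < v j
            rw [Equiv.swap_apply_left]
            exact hlt
        · obtain ⟨σ, rfl⟩ := hv
          exact ⟨σ * Equiv.swap j k, rfl⟩

lemma exists_listHom_eq (hρ : PresentsRowTail ρ) (hr : r = p + q) (hab : r = a + b) (ha : 1 ≤ a)
    (hn : b + 1 ≤ n) {m : Finset ℕ → M} (hm : m ∈ famPart n r M (Finset.Ico a r) i) :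
    m ∈ (barPart a p q (b + 1) i).map (listHom ρ) := by
  classical
  have hsum : m = ∑ B ∈ (Finset.Ico a r).powerset, Pi.single B (m B) := by
    ext1 B
    rw [Finset.sum_apply]
    by_cases hB : B ∈ (Finset.Ico a r).powerset
    · rw [Finset.sum_eq_single B, Pi.single_eq_same]
      · intro B' _ hne
        rw [Pi.single_eq_of_ne hne.symm]
      · intro h; exact absurd hB h
    · rw [Finset.sum_eq_zero]
      · by_contra h
        exact hB (Finset.mem_powerset.2 (hm.2 B h).1)
      · intro B' hB'
        rw [Pi.single_eq_of_ne]
        rintro rfl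
        exact hB hB'
  rw [hsum]
  refine sum_mem fun B _ => ?_
  by_cases hmB : m B = 0
  · rw [hmB, Pi.single_zero]; exact zero_mem _
  obtain ⟨hBI, hcard⟩ := hm.2 B hmB
  rw [Nat.card_Ico] at hcard
  obtain ⟨x, hx⟩ := hρ.1 (m B)
  have hx' : ρ (weightIdem (blockWord n r B) • x) = m B := by
    rw [map_smul, hx, hm.1]
  have key : ∀ z ∈ Submodule.span ℤ (orb (rowCol r p) ''
      {v | ∃ σ : Equiv.Perm (Fin r), v = blockWord n r B ∘ σ}),
      ∃ hz : z ∈ invariants n (rowCol r p),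
        Pi.single B (ρ ⟨z, hz⟩) ∈ (barPart a p q (b + 1) i).map (listHom ρ) := by
    intro z hz
    induction hz using Submodule.span_induction with
    | mem z hz =>
      obtain ⟨v, hv, rfl⟩ := hz
      exact ⟨orb_mem _ _, single_orbImage_mem hρ hr ha (by omega) hBI (by omega) (by omega) hv⟩
    | zero =>
      refine ⟨zero_mem _, ?_⟩
      have : ρ ⟨0, zero_mem _⟩ = 0 := map_zero ρ
      rw [this, Pi.single_zero]
      exact zero_mem _
    | add z z' _ _ h h' =>
      obtain ⟨hz, h⟩ := h
      obtain ⟨hz', h'⟩ := h'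
      refine ⟨add_mem hz hz', ?_⟩
      have : ρ ⟨z + z', add_mem hz hz'⟩ = ρ ⟨z, hz⟩ + ρ ⟨z', hz'⟩ := map_add ρ ⟨z, hz⟩ ⟨z', hz'⟩
      rw [this, Pi.single_add]
      exact add_mem h h'
    | smul c z _ h =>
      obtain ⟨hz, h⟩ := h
      refine ⟨zsmul_mem hz c, ?_⟩
      have : ρ ⟨c • z, zsmul_mem hz c⟩ = c • ρ ⟨z, hz⟩ := map_zsmul ρ c ⟨z, hz⟩
      rw [this, Pi.single_smul]
      exact Submodule.smul_mem _ c h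
  obtain ⟨hz, h⟩ := key (weightIdem (blockWord n r B) • (x : TensorSpace n r)) (by
    refine Submodule.span_mono (Set.image_mono fun v hv => ?_)
      (mem_span_orb (weightIdem (blockWord n r B) • x).2)
    have hv' : co (weightIdem (blockWord n r B) • (x : TensorSpace n r)) v ≠ 0 := hv
    rw [co_weightIdem] at hv'
    by_contra h'
    rw [if_neg (show ¬ ∃ σ : Equiv.Perm (Fin r), v = blockWord n r B ∘ σ from h')] at hv'
    exact hv' rfl)
  rw [← hx']
  exact h

end bridge

/-! ### The second extension group in terms of the bar construction -/

section extBar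

/-- Shortcut instance: the general search is slow. -/
instance resPartAddCommGroup (n r : ℕ) (I : Finset ℕ) (q : ℕ) : AddCommGroup (resPart n r I q) :=
  Submodule.addCommGroup _

/-- Shortcut instance: the general search is slow. -/
instance tensorSpaceModule (n r : ℕ) : Module (schurAlgebra n r) (TensorSpace n r) :=
  inferInstance

open CategoryTheory CategoryTheory.Abelian

lemma subQuot_addEquiv_of_surjective {V A : Type*} [AddCommGroup V] [AddCommGroup A]
    {Z B : Submodule ℤ V} (g : Z →+ A) (hg : Function.Surjective g)
    (hker : ∀ z, g z = 0 ↔ (z : V) ∈ B) : Nonempty (SubQuot Z B ≃+ A) := by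
  have h : B.submoduleOf Z = LinearMap.ker g.toIntLinearMap := by
    ext z
    exact (hker z).symm
  exact ⟨((Submodule.quotEquivOfEq _ _ h).trans
    (LinearMap.quotKerEquivOfSurjective g.toIntLinearMap hg)).toAddEquiv⟩

variable {n r : ℕ}

lemma resD_exact {I : Finset ℕ} {q : ℕ} (x : resPart n r I (q + 1)) :
    resD n r I q x = 0 ↔ ∃ y, resD n r I (q + 1) y = x := by
  constructor
  · intro h
    obtain ⟨y, hy, hyx⟩ := resPart_exact (Nat.le_add_left 1 q) x.2 (congrArg Subtype.val h)
    exact ⟨⟨y, hy⟩, Subtype.ext hyx⟩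
  · rintro ⟨y, rfl⟩
    exact Subtype.ext (schur_bdry_bdry I y.1)

/-- The augmentation of the resolution. -/
def augmentation {X : Type} [AddCommGroup X] [Module (schurAlgebra n r) X] {a : ℕ}
    (ε : invariants n (rowCol r a) →ₗ[schurAlgebra n r] X) :
    resPart n r (Finset.Ico a r) 0 →ₗ[schurAlgebra n r] X :=
  ε.comp
    (((LinearMap.proj (Finset.Ico a r)).comp
      (resPart n r (Finset.Ico a r) 0).subtype).codRestrict
    (invariants n (rowCol r a)) fun x => x.2.1 _)

lemma augmentation_surjective {X : Type} [AddCommGroup X] [Module (schurAlgebra n r) X] {a : ℕ}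
    {ε : invariants n (rowCol r a) →ₗ[schurAlgebra n r] X} (hε : Function.Surjective ε) :
    Function.Surjective (augmentation ε) := by
  intro z
  obtain ⟨x, rfl⟩ := hε z
  refine ⟨⟨Pi.single (Finset.Ico a r) (x : TensorSpace n r), fun B => ?_, fun B hB => ?_⟩, ?_⟩
  · by_cases h : B = Finset.Ico a r
    · subst h
      rw [Pi.single_eq_same]; exact x.2
    · rw [Pi.single_eq_of_ne h]; exact zero_mem _
  · by_cases h : B = Finset.Ico a r
    · rw [h]; exact ⟨Finset.Subset.refl _, rfl⟩
    · rw [Pi.single_eq_of_ne h] at hB; exact absurd rfl hB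
  · refine congrArg ε (Subtype.ext ?_)
    exact Pi.single_eq_same (M := fun _ => TensorSpace n r) _ _

lemma augmentation_eq_zero_iff {X : Type} [AddCommGroup X] [Module (schurAlgebra n r) X] {a : ℕ}
    (ha : 1 ≤ a) (har : a ≤ r) {ε : invariants n (rowCol r a) →ₗ[schurAlgebra n r] X}
    (hε : ∀ x, ε x = 0 ↔ (x : TensorSpace n r) ∈ altRelations n r (hookColumn r a))
    (x : resPart n r (Finset.Ico a r) 0) :
    augmentation ε x = 0 ↔ ∃ y, resD n r (Finset.Ico a r) 0 y = x := by
  have h : augmentation ε x = 0 ↔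
      x.1 (Finset.Ico a r) ∈ altRelations n r (hookColumn r a) := hε _
  rw [h]
  constructor
  · intro h
    obtain ⟨y, hy, hyx⟩ := exists_bdry_of_mem_altRelations ha har x.2 fun B => by
      by_cases hB : x.1 B = 0
      · rw [hB]; exact zero_mem _
      · obtain ⟨h1, h2⟩ := x.2.2 B hB
        rw [Finset.eq_of_subset_of_card_le h1 (by omega)]
        exact h
    exact ⟨⟨y, hy⟩, Subtype.ext hyx⟩
  · rintro ⟨y, rfl⟩
    exact bdry_mem_altRelations ha y.2 (Finset.Ico a r)

/-- Transport of the homology in degree two along a comparison map `F` that is bijective in each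
degree. -/
lemma subQuot_addEquiv_of_cocycles {V H₁ H₂ H₃ A : Type*} [AddCommGroup V] [AddCommGroup H₁]
    [AddCommGroup H₂] [AddCommGroup H₃] [AddCommGroup A] [Module ℤ H₂] [Module ℤ H₃]
    {C₁ C₂ C₃ : Submodule ℤ V} {D : V →ₗ[ℤ] V} (hD₁ : ∀ x ∈ C₁, D x ∈ C₂) (hD₂ : ∀ x ∈ C₂, D x ∈ C₃)
    {F₁ : V →+ H₁} {F₂ : V →+ H₂} {F₃ : V →+ H₃} {d : H₁ → H₂} {e : H₂ →ₗ[ℤ] H₃}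
    (h₁ : ∀ x ∈ C₁, F₂ (D x) = d (F₁ x)) (h₂ : ∀ x ∈ C₂, F₃ (D x) = e (F₂ x))
    (hs₁ : ∀ f, ∃ x ∈ C₁, F₁ x = f) (hs₂ : ∀ f, ∃ x ∈ C₂, F₂ x = f)
    (hi₂ : ∀ x ∈ C₂, F₂ x = 0 → x = 0) (hi₃ : ∀ x ∈ C₃, F₃ x = 0 → x = 0)
    {Φ : LinearMap.ker e →+ A} (hΦ : Function.Surjective Φ)
    (hΦ' : ∀ f, Φ f = 0 ↔ ∃ g, (f : H₂) = d g) :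
    Nonempty (SubQuot (C₂ ⊓ LinearMap.ker D) (C₁.map D) ≃+ A) := by
  let g : (C₂ ⊓ LinearMap.ker D : Submodule ℤ V) →+ LinearMap.ker e :=
    { toFun := fun z => ⟨F₂ z.1, by
        rw [LinearMap.mem_ker, ← h₂ _ z.2.1, LinearMap.mem_ker.1 z.2.2, map_zero]⟩
      map_zero' := Subtype.ext (map_zero F₂)
      map_add' := fun z z' => Subtype.ext (map_add F₂ z.1 z'.1) }
  refine subQuot_addEquiv_of_surjective (Φ.comp g) (hΦ.comp fun f => ?_) fun z => ?_
  · obtain ⟨x, hx, hxf⟩ := hs₂ f.1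
    refine ⟨⟨x, hx, hi₃ _ (hD₂ x hx) ?_⟩, Subtype.ext hxf⟩
    rw [h₂ x hx, hxf]
    exact f.2
  · rw [AddMonoidHom.comp_apply, hΦ']
    constructor
    · rintro ⟨f, hf⟩
      obtain ⟨x, hx, rfl⟩ := hs₁ f
      refine ⟨x, hx, sub_eq_zero.1 (hi₂ _ (sub_mem (hD₁ x hx) z.2.1) ?_)⟩
      rw [map_sub, h₁ x hx, sub_eq_zero]
      exact hf.symm
    · rintro ⟨x, hx, hxz⟩
      refine ⟨F₁ x, ?_⟩
      rw [← h₁ x hx, hxz]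
      rfl

section comparison

variable [NeZero n] {a b p q : ℕ} {M : Type} [AddCommGroup M] [Module (schurAlgebra n r) M]

/-- The comparison map from the bar construction to the homomorphisms from a term of the
resolution. -/
def comparison (a : ℕ) (ρ : invariants n (rowCol r p) →ₗ[schurAlgebra n r] M) (i : ℕ) :
    BarMod →+ (resPart n r (Finset.Ico a r) i →ₗ[schurAlgebra n r] M) :=
  (famHom (Finset.Ico a r) i).comp (listHom ρ).toAddMonoidHom

variable {ρ : invariants n (rowCol r p) →ₗ[schurAlgebra n r] M} {i : ℕ}

lemma comparison_apply (x : BarMod) :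
    comparison a ρ i x = famHom (Finset.Ico a r) i (listHom ρ x) := rfl

lemma comparison_barD (hρ : PresentsRowTail ρ) (ha : 1 ≤ a) (hab : r = a + b) (hr : r = p + q)
    (hn : b + 1 ≤ n) {x : BarMod} (hx : x ∈ barPart a p q (b + 1) i) :
    comparison a ρ (i + 1) (barD x) = comparison a ρ i x ∘ₗ resD n r (Finset.Ico a r) i := by
  have hI : (Finset.Ico a r).card < n := by rw [Nat.card_Ico]; omega
  rw [comparison_apply, comparison_apply, ← coboundary_listHom hρ hr hn hx]
  exact (famHom_comp_resD hI (listHom_mem hr hab ha hn hx)).2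

lemma exists_comparison_eq (hρ : PresentsRowTail ρ) (ha : 1 ≤ a) (hab : r = a + b) (hr : r = p + q)
    (hn : b + 1 ≤ n) (f : resPart n r (Finset.Ico a r) i →ₗ[schurAlgebra n r] M) :
    ∃ x ∈ barPart a p q (b + 1) i, comparison a ρ i x = f := by
  have hI : (Finset.Ico a r).card < n := by rw [Nat.card_Ico]; omega
  obtain ⟨m, hm, rfl⟩ := exists_famHom_eq hI f
  obtain ⟨x, hx, rfl⟩ := exists_listHom_eq hρ hr hab ha hn hm
  exact ⟨x, hx, rfl⟩

lemma comparison_injOn (hρ : PresentsRowTail ρ) (ha : 1 ≤ a) (hab : r = a + b) (hr : r = p + q)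
    (hn : b + 1 ≤ n) {x : BarMod} (hx : x ∈ barPart a p q (b + 1) i)
    (h0 : comparison a ρ i x = 0) : x = 0 := by
  have hI : (Finset.Ico a r).card < n := by rw [Nat.card_Ico]; omega
  exact listHom_injOn hρ hr hn hx (famHom_injOn hI (listHom_mem hr hab ha hn hx) h0)

end comparison

/-- The second extension group of the Weyl module of a hook by a tensor product of a divided and an
exterior power is a homology group of the bar construction. -/
theorem exists_bar_addEquiv_ext [NeZero n] {a b p q : ℕ} (ha : 1 ≤ a) (hab : r = a + b)
    (hr : r = p + q) (hn : b + 1 ≤ n) {X M : Type} [AddCommGroup X] [AddCommGroup M]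
    [Module (schurAlgebra n r) X] [Module (schurAlgebra n r) M]
    {ε : invariants n (rowCol r a) →ₗ[schurAlgebra n r] X} (hε : Function.Surjective ε)
    (hε' : ∀ x, ε x = 0 ↔ (x : TensorSpace n r) ∈ altRelations n r (hookColumn r a))
    {ρ : invariants n (rowCol r p) →ₗ[schurAlgebra n r] M} (hρ : PresentsRowTail ρ) :
    Nonempty (SubQuot (barCycles a p q (b + 1)) (barBoundaries a p q (b + 1)) ≃+
      Ext.{0} (ModuleCat.of (schurAlgebra n r) X) (ModuleCat.of (schurAlgebra n r) M) 2) := by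
  have hI : (Finset.Ico a r).card < n := by rw [Nat.card_Ico]; omega
  have hproj0 := projective_resPart (r := r) hI 0
  have hproj1 := projective_resPart (r := r) hI 1
  obtain ⟨Φ, hΦ, hΦ'⟩ := exists_extTwo_hom (R := schurAlgebra n r) (M := M)
    (P0 := resPart n r (Finset.Ico a r) 0) (P1 := resPart n r (Finset.Ico a r) 1)
    (P2 := resPart n r (Finset.Ico a r) 2) (P3 := resPart n r (Finset.Ico a r) 3)
    (d1 := resD n r (Finset.Ico a r) 0) (d2 := resD n r (Finset.Ico a r) 1)
    (d3 := resD n r (Finset.Ico a r) 2) (augmentation_surjective hε)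
    (augmentation_eq_zero_iff ha (by omega) hε') resD_exact resD_exact
  exact subQuot_addEquiv_of_cocycles (fun _ => barD_mem) (fun _ => barD_mem)
    (fun _ => comparison_barD hρ ha hab hr hn) (fun _ => comparison_barD hρ ha hab hr hn)
    (exists_comparison_eq hρ ha hab hr hn) (exists_comparison_eq hρ ha hab hr hn)
    (fun _ => comparison_injOn hρ ha hab hr hn) (fun _ => comparison_injOn hρ ha hab hr hn) hΦ hΦ'

end extBar

/-! ### The modules as quotients of modules of symmetric tensors -/

section presentations

variable {n r : ℕ}

/-- The projection of the tensors symmetric in the first `p` places to their image modulo the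
alternating relations. -/
def rowProjection (n r p : ℕ) (B : Set (Fin r)) : invariants n (rowCol r p) →ₗ[schurAlgebra n r]
    symAltImage n r {i | (i : ℕ) < p} B :=
  (altRelations n r B).mkQ.restrict fun x hx => ⟨x, by rw [symTensors_row]; exact hx, rfl⟩

lemma rowProjection_surjective (n r p : ℕ) (B : Set (Fin r)) :
    Function.Surjective (rowProjection n r p B) := by
  rintro ⟨_, x, hx, rfl⟩
  rw [symTensors_row] at hx
  exact ⟨⟨x, hx⟩, rfl⟩

lemma rowProjection_eq_zero_iff {p : ℕ} {B : Set (Fin r)} (x : invariants n (rowCol r p)) :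
    rowProjection n r p B x = 0 ↔ (x : TensorSpace n r) ∈ altRelations n r B := by
  rw [← Submodule.Quotient.mk_eq_zero, Subtype.ext_iff]
  rfl

lemma hookColumn_one (r : ℕ) : hookColumn r 1 = Set.univ := by
  ext i
  simp only [Set.mem_ofPred_eq, Set.mem_univ, iff_true]
  omega

lemma mem_invariants_row_one (x : TensorSpace n r) : x ∈ invariants n (rowCol r 1) := by
  intro σ hσ
  rw [rowCol_comp_iff] at hσ
  have h1 : σ = 1 := by
    have h2 : ∀ i : Fin r, 1 ≤ (i : ℕ) → σ i = i := hσ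
    ext1 i
    by_cases hi : 1 ≤ (i : ℕ)
    · exact h2 i hi
    · by_contra hne
      have h3 : 1 ≤ (σ i : ℕ) := by
        have : (σ i : ℕ) ≠ i := fun h => hne (Fin.ext h)
        omega
      exact hne (σ.injective (h2 _ h3))
  rw [h1, placePerm_one]

lemma mem_altRelations_tail_self {x : TensorSpace n r} :
    x ∈ altRelations n r (tailPlaces r r) ↔ x = 0 := by
  have h : {x : TensorSpace n r | ∃ v : Fin r → NatMod n,
      (∃ i ∈ tailPlaces r r, ∃ j ∈ tailPlaces r r, i ≠ j ∧ v i = v j) ∧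
        x = PiTensorProduct.tprod ℤ v} = ∅ := by
    rw [Set.eq_empty_iff_forall_notMem]
    rintro _ ⟨v, ⟨i, hi, -⟩, -⟩
    exact absurd i.2 (not_lt.2 hi)
  rw [altRelations, h, Submodule.span_empty, Submodule.mem_bot]

/-- The divided power as the case of an empty exterior part. -/
def divPowerProjection (n r : ℕ) :
    invariants n (rowCol r r) →ₗ[schurAlgebra n r] symTensors n r Set.univ :=
  Submodule.inclusion fun _ hx σ _ =>
    hx σ (rowCol_comp_iff.2 fun i hi => absurd i.2 (not_lt.2 hi))

lemma presents_divPowerProjection (n r : ℕ) : PresentsRowTail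
    (M := symTensors n r Set.univ) (divPowerProjection n r) := by
  refine ⟨fun x => ⟨⟨x.1, fun σ _ => x.2 σ fun i hi => absurd (Set.mem_univ i) hi⟩, rfl⟩,
    fun _ => ?_⟩
  rw [mem_altRelations_tail_self, Subtype.ext_iff]
  rfl


/-- The exterior power as the Weyl module of a column. -/
def extPowerProjection (n r : ℕ) : invariants n (rowCol r 1) →ₗ[schurAlgebra n r]
    TensorSpace n r ⧸ altRelations n r Set.univ :=
  (altRelations n r Set.univ).mkQ.comp (invariants n (rowCol r 1)).subtype

lemma extPowerProjection_surjective (n r : ℕ) : Function.Surjective (extPowerProjection n r) := by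
  intro z
  obtain ⟨x, rfl⟩ := Submodule.mkQ_surjective _ z
  exact ⟨⟨x, mem_invariants_row_one x⟩, rfl⟩

lemma extPowerProjection_eq_zero_iff (x : invariants n (rowCol r 1)) :
    extPowerProjection n r x = 0 ↔ (x : TensorSpace n r) ∈ altRelations n r (hookColumn r 1) := by
  rw [hookColumn_one, ← Submodule.Quotient.mk_eq_zero]
  rfl

end presentations

section main

open CategoryTheory CategoryTheory.Abelian

lemma exists_bar_addEquiv_ext_hook {n a b k : ℕ} (ha : 1 ≤ a) (hn : b + 1 ≤ n) (hk : k < b) :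
    Nonempty (SubQuot (barCycles a (a + k) (b - k) (b + 1))
        (barBoundaries a (a + k) (b - k) (b + 1)) ≃+
      Ext.{0} (hookWeyl n a b) (divTensorExt n (a + b) (a + k)) 2) := by
  have : NeZero n := ⟨by omega⟩
  exact exists_bar_addEquiv_ext ha rfl (by omega) hn
    (rowProjection_surjective n (a + b) a (hookColumn (a + b) a)) rowProjection_eq_zero_iff
    (ρ := rowProjection n (a + b) (a + k) (tailPlaces (a + b) (a + k)))
    ⟨rowProjection_surjective _ _ _ _, rowProjection_eq_zero_iff⟩

lemma exists_bar_addEquiv_ext_extPower {n k r : ℕ} (hr : r = k + 1) (hn : k + 1 ≤ n) :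
    Nonempty (SubQuot (barCycles 1 r 0 (k + 1)) (barBoundaries 1 r 0 (k + 1)) ≃+
      Ext.{0} (extPower n r) (divPower n r) 2) := by
  have : NeZero n := ⟨by omega⟩
  exact exists_bar_addEquiv_ext (a := 1) (b := k) (p := r) (q := 0)
    (X := TensorSpace n r ⧸ altRelations n r Set.univ) (M := symTensors n r Set.univ)
    le_rfl (by omega) (by omega) hn (extPowerProjection_surjective n r)
    extPowerProjection_eq_zero_iff (presents_divPowerProjection n r)

end main

end HookExt

end

theorem lemma2p4 (n a b k : ℕ) (ha : 1 ≤ a) (hn : b + 1 ≤ n) (hk : k < b) :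
    Nonempty
      (CategoryTheory.Abelian.Ext.{0} (HookExt.hookWeyl n a b)
          (HookExt.divTensorExt n (a + b) (a + k)) 2 ≃+
        CategoryTheory.Abelian.Ext.{0} (HookExt.extPower n (k + 1))
          (HookExt.divPower n (k + 1)) 2) ∧
    ((k = 2 ∨ k = 3) →
      Nonempty
        (CategoryTheory.Abelian.Ext.{0} (HookExt.hookWeyl n a b)
          (HookExt.divTensorExt n (a + b) (a + k)) 2 ≃+ ZMod 3)) ∧
    (¬ (k = 2 ∨ k = 3) →
      Subsingleton
        (CategoryTheory.Abelian.Ext.{0} (HookExt.hookWeyl n a b)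
          (HookExt.divTensorExt n (a + b) (a + k)) 2)) := by
  obtain ⟨e₁⟩ := HookExt.exists_bar_addEquiv_ext_hook ha hn hk
  obtain ⟨e₂⟩ := HookExt.exists_bar_addEquiv_ext_extPower (n := n) (k := k) rfl (by omega)
  obtain ⟨e₃⟩ := HookExt.bar_strip_all a k b ha hk
  refine ⟨⟨(e₁.symm.trans e₃).trans e₂⟩, fun h => ?_, fun h => ?_⟩
  · obtain ⟨e₄⟩ := HookExt.bar_divided_zmod (K := k + 1) (by omega)
    exact ⟨(e₁.symm.trans e₃).trans e₄⟩
  · have := HookExt.bar_divided_subsingleton (K := k + 1) (by omega) (by omega) (by omega)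
    exact (e₁.symm.trans e₃).toEquiv.subsingleton
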